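/- Setting. Logarithms are to base $2$. A dynamic graph is a graph on a fixed set of $n$ vertices that is initially edgeless and changes by insertions and deletions of single edges. Algorithms are programs for a word RAM (words of $O(\log N)$ bits, where $N$ is the sum of the input parameters, i.e. the number of vertices, the numbers of colors and the degree bound below; unit-cost arithmetic, memory access and uniform random numbers), given black-box access to the following algorithms. * Static black box: for every graph $G$ of a class $\mathcal G$ on $n$ vertices and every set $S$ of vertices it produces a $C$-coloring of the induced graph $G[S]$ of the current graph $G$ in time $T(|S|)$, where $T$ is nondecreasing and $T(m)\ge m$. * Dynamic black box (used only by the deterministic algorithm): a deterministic algorithm that maintains a proper coloring of dynamic graphs with $n$ vertices and maximum degree at most $\Delta$ with at most $\kappa\Delta$ colors, in amortized update time $T'(\Delta,n)$ (for instance an optimal one), and with at most $R$ amortized recolorings per update. Let $n\ge 2$, $0<\beta\le\log n$, $\Delta_\beta=\lceil \log^2 n/\beta\rceil$, and let the dynamic graph be in $\mathcal G$ at all times. All $O$-constants are absolute, and after a preprocessing in time $O(n)$ the color of any vertex can be read in constant time at any moment. **Theorem.** (1) There is a randomized algorithm, not using the dynamic black box, that always maintains a proper coloring with $O\big(\frac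 C\beta\log^2 n\,(1+\log\log n+\max(0,\log\frac1\beta))\big)$ colors and that, for every update sequence fixed in advance (oblivious adversary), makes an expected amortized number of $O(1+\beta)$ recolorings per update and has expected amortized update time $$O\Big(1+\frac{\beta}{n\log n}\sum_{i=0}^{\lfloor\log n\rfloor}2^i\,T(\lfloor n/2^i\rfloor)\Big).$$ (2) There is a deterministic algorithm that maintains a proper coloring with $O\big(\kappa\frac C\beta\log^3 n\big)$ colors, makes amortized $O(1+\beta+R)$ recolorings per update, and has amortized update time $$O\Big(1+\frac{\beta}{n\log n}\sum_{i=0}^{\lfloor\log n\rfloor}2^i\,T(\lfloor n/2^i\rfloor)+T'(\Delta_\beta,n)\Big).$$ (For $\beta\ge 1$ the summands $1$ in the time and recoloring bounds are dominated by the terms in $\beta$ and can be omitted.) -/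

import Mathlib

open scoped ENNReal

noncomputable section

namespace DynColoring

/-! ### Dynamic graphs on the vertex set `Fin n` -/

/-- One update step of a fully dynamic graph: insertion or deletion of an edge. -/
inductive Update (n : ℕ) where
  | insert (u v : Fin n)
  | delete (u v : Fin n)

/-- The graph after the update. -/
def Update.apply {n : ℕ} : Update n → SimpleGraph (Fin n) → SimpleGraph (Fin n)
  | .insert u v, G => G ⊔ SimpleGraph.edge u v
  | .delete u v, G => G \ SimpleGraph.edge u v

/-- Only absent edges (and no loops) are inserted, only present edges are deleted. -/
def Update.Legal {n : ℕ} : Update n → SimpleGraph (Fin n) → Prop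
  | .insert u v, G => u ≠ v ∧ ¬ G.Adj u v
  | .delete u v, G => G.Adj u v

/-- The current graph after a sequence of updates, starting from the empty graph.
Histories list the updates with the most recent one first. -/
def graphOf {n : ℕ} : List (Update n) → SimpleGraph (Fin n)
  | [] => ⊥
  | x :: h => x.apply (graphOf h)

/-- `h` is a legal update sequence during which the graph satisfies `P` at all times. -/
def IsHistory {n : ℕ} (P : SimpleGraph (Fin n) → Prop) : List (Update n) → Prop
  | [] => P ⊥
  | x :: h => x.Legal (graphOf h) ∧ P (graphOf (x :: h)) ∧ IsHistory P h

/-- Every vertex of `G` has degree at most `Δ`. -/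
def MaxDegreeLE {n : ℕ} (Δ : ℕ) (G : SimpleGraph (Fin n)) : Prop :=
  ∀ v, (G.neighborSet v).ncard ≤ Δ

/-- `f` is a proper vertex coloring of `G`. -/
def Proper {n : ℕ} (G : SimpleGraph (Fin n)) (f : Fin n → ℕ) : Prop :=
  ∀ u v, G.Adj u v → f u ≠ f v

/-- The number of vertices whose color differs in `f` and `g`. -/
def changes {n : ℕ} (f g : Fin n → ℕ) : ℕ :=
  (Finset.univ.filter fun v => f v ≠ g v).card

/-! ### The two black boxes -/

/-- The input-output behavior of a static algorithm: from a graph `G` and a set `S` of vertices it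
computes a color for each vertex of `S` (values outside `S` are never used). -/
abbrev StaticAlgorithm (n : ℕ) := SimpleGraph (Fin n) → Finset (Fin n) → Fin n → ℕ

/-- On every graph `G` of the class and every `S`, the result is a proper coloring of the induced
graph `G[S]` with the `C` colors `0, …, C - 1`. -/
def StaticAlgorithm.Colors {n : ℕ} (A : StaticAlgorithm n) (𝒢 : Set (SimpleGraph (Fin n)))
    (C : ℕ) : Prop :=
  ∀ G ∈ 𝒢, ∀ S : Finset (Fin n), (∀ v ∈ S, A G S v < C) ∧
    ∀ u ∈ S, ∀ v ∈ S, G.Adj u v → A G S u ≠ A G S v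

/-- A deterministic dynamic coloring algorithm: a function of the updates received so far.
`color h` is the maintained coloring after the history `h`, and `time h` is the number of steps
spent on the last update of `h`. -/
structure DynamicAlgorithm (n : ℕ) where
  color : List (Update n) → Fin n → ℕ
  time : List (Update n) → ℕ

namespace DynamicAlgorithm

variable {n : ℕ}

/-- Total time spent on the updates of a history. -/
def totalTime (A : DynamicAlgorithm n) : List (Update n) → ℕ
  | [] => 0
  | x :: h => A.time (x :: h) + A.totalTime h

/-- Total number of recolorings during a history. -/
def totalRecolorings (A : DynamicAlgorithm n) : List (Update n) → ℕ
  | [] => 0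
  | x :: h => changes (A.color h) (A.color (x :: h)) + A.totalRecolorings h

/-- As long as all degrees are at most `Δ`, the maintained coloring is proper and uses the `k`
colors `0, …, k - 1`. -/
def Colors (A : DynamicAlgorithm n) (Δ k : ℕ) : Prop :=
  ∀ h, IsHistory (MaxDegreeLE Δ) h → Proper (graphOf h) (A.color h) ∧ ∀ v, A.color h v < k

/-- On graphs of maximum degree `Δ`, the amortized update time is at most `τ`. -/
def AmortizedTime (A : DynamicAlgorithm n) (Δ : ℕ) (τ : ℝ) : Prop :=
  ∀ h, IsHistory (MaxDegreeLE Δ) h → (A.totalTime h : ℝ) ≤ τ * h.length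

/-- On graphs of maximum degree `Δ`, the amortized number of recolorings is at most `R`. -/
def AmortizedRecolorings (A : DynamicAlgorithm n) (Δ : ℕ) (R : ℝ) : Prop :=
  ∀ h, IsHistory (MaxDegreeLE Δ) h → (A.totalRecolorings h : ℝ) ≤ R * h.length

/-- The black box that gives no help (it always answers `0`): used where no dynamic black box is
available. -/
def null (n : ℕ) : DynamicAlgorithm n := ⟨fun _ _ => 0, fun _ => 0⟩

end DynamicAlgorithm

/-! ### A word RAM with random numbers and calls to the black boxes

All memory cells hold words, i.e. numbers below `W`; all arithmetic is modulo `W`; all cells are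
addressable. A program is a fixed finite syntactic object; the time is the number of elementary
operations. -/

/-- Binary word operations. -/
inductive Op where
  | add | sub | mul | div | lt

/-- `sub` is truncated at `0`, `div` is the integer quotient (`x / 0 = 0`), `lt` is a test. -/
def Op.eval (W : ℕ) : Op → ℕ → ℕ → ℕ
  | .add, a, b => (a + b) % W
  | .sub, a, b => a - b
  | .mul, a, b => (a * b) % W
  | .div, a, b => a / b
  | .lt, a, b => if a < b then 1 else 0

/-- Expressions: a constant, the content of the cell with the given address, an operation, or the
current color that the dynamic black box gives to a vertex. -/
inductive Expr where
  | lit (k : ℕ)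
  | cell (a : Expr)
  | op (o : Op) (a b : Expr)
  | dynColor (v : Expr)

/-- Number of elementary operations needed to evaluate an expression. -/
def Expr.size : Expr → ℕ
  | .lit _ => 1
  | .cell a => a.size + 1
  | .op _ a b => a.size + b.size + 1
  | .dynColor v => v.size + 1

/-- Programs. -/
inductive Prog where
  /-- do nothing -/
  | skip
  /-- store the value of `e` at address `a` -/
  | assign (a e : Expr)
  /-- store at address `a` a uniformly random number from `{0, …, k}` -/
  | random (a k : Expr)
  | seq (p q : Prog)
  /-- run `p` if `c ≠ 0`, and `q` otherwise -/
  | ite (c : Expr) (p q : Prog)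
  /-- while `c ≠ 0` run `p` -/
  | loop (c : Expr) (p : Prog)
  /-- run the static black box on the current graph and the vertices listed in the `len` cells
  from address `src` on; the color of the `j`-th listed vertex is stored at address `dst + j` -/
  | callStatic (src len dst : Expr)
  /-- tell the dynamic black box to insert the edge `uv` into its graph -/
  | callInsert (u v : Expr)
  /-- tell the dynamic black box to delete the edge `uv` from its graph -/
  | callDelete (u v : Expr)

/-- The program draws no random numbers. -/
def Prog.NoRandom : Prog → Prop
  | .random _ _ => False
  | .seq p q => p.NoRandom ∧ q.NoRandom
  | .ite _ p q => p.NoRandom ∧ q.NoRandom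
  | .loop _ p => p.NoRandom
  | _ => True

/-- The surroundings in which programs run: the bound `W` on words, the static black box, its
running time, and the dynamic black box. -/
structure Machine (n : ℕ) where
  W : ℕ
  static : StaticAlgorithm n
  T : ℕ → ℕ
  dyn : DynamicAlgorithm n

/-- Memory, the history of the graph held by the dynamic black box, and two counters
that programs cannot access: elapsed time and number of recolorings. -/
structure State (n : ℕ) where
  mem : ℕ → ℕ
  dynHist : List (Update n)
  time : ℕ
  recolorings : ℕ

variable {n : ℕ}

/-- Let `t` time steps pass. -/
def State.tick (s : State n) (t : ℕ) : State n := { s with time := s.time + t }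

/-- Write `x` at address `a`. -/
def State.write (s : State n) (a x : ℕ) : State n := { s with mem := Function.update s.mem a x }

/-- Value of an expression. -/
def Expr.eval (M : Machine n) (s : State n) : Expr → ℕ
  | .lit k => k % M.W
  | .cell a => s.mem (a.eval M s)
  | .op o a b => o.eval M.W (a.eval M s) (b.eval M s)
  | .dynColor v =>
      if h : v.eval M s < n then M.dyn.color s.dynHist ⟨v.eval M s, h⟩ % M.W else 0

/-- The effect of running the static black box on the graph `G`; entries of the list that are not
vertices are ignored. The time is `T len`, that is `T |S|` when the list has no repetitions. -/
def State.callStatic (M : Machine n) (G : SimpleGraph (Fin n)) (s : State n)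
    (src len dst : ℕ) : State n :=
  let S : Finset (Fin n) := Finset.univ.filter fun v => ∃ j < len, s.mem (src + j) = v
  { s with
    mem := fun a =>
      if dst ≤ a ∧ a < dst + len then
        if h : s.mem (src + (a - dst)) < n then
          M.static G S ⟨s.mem (src + (a - dst)), h⟩ % M.W
        else 0
      else s.mem a
    time := s.time + M.T len }

/-- The effect of handing an update to the dynamic black box (nothing happens if `u` or `v` is not
a vertex). -/
def State.callDynamic (M : Machine n) (s : State n) (f : Fin n → Fin n → Update n) (u v : ℕ) :
    State n :=
  if h : u < n ∧ v < n then
    { s with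
      dynHist := f ⟨u, h.1⟩ ⟨v, h.2⟩ :: s.dynHist
      time := s.time + M.dyn.time (f ⟨u, h.1⟩ ⟨v, h.2⟩ :: s.dynHist) }
  else s

/-- Sequential composition of random computations that may run out of fuel (`none`). -/
def andThen {α : Type} (p : PMF (Option α)) (f : α → PMF (Option α)) : PMF (Option α) :=
  p.bind fun o => o.elim (PMF.pure none) f

/-- A while loop, cut off (with result `none`) after `fuel` tests of the condition `c`. -/
def whileLoop (M : Machine n) (c : Expr) (body : State n → PMF (Option (State n))) :
    ℕ → State n → PMF (Option (State n))
  | 0, _ => PMF.pure none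
  | fuel + 1, s =>
      if c.eval M s = 0 then PMF.pure (some (s.tick (c.size + 1)))
      else andThen (body (s.tick (c.size + 1))) (whileLoop M c body fuel)

/-- The distribution of the final state of a program while the current graph is `G`. The result
is `none` if some while loop is tested more than `fuel` times; otherwise it does not depend on
`fuel`. -/
def Prog.exec (M : Machine n) (G : SimpleGraph (Fin n)) (fuel : ℕ) :
    Prog → State n → PMF (Option (State n))
  | .skip, s => PMF.pure (some (s.tick 1))
  | .assign a e, s =>
      PMF.pure (some ((s.write (a.eval M s) (e.eval M s)).tick (a.size + e.size + 1)))
  | .random a k, s =>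
      (PMF.uniformOfFintype (Fin (k.eval M s + 1))).map fun x =>
        some ((s.write (a.eval M s) x).tick (a.size + k.size + 1))
  | .seq p q, s => andThen (p.exec M G fuel s) (q.exec M G fuel)
  | .ite c p q, s =>
      if c.eval M s = 0 then q.exec M G fuel (s.tick (c.size + 1))
      else p.exec M G fuel (s.tick (c.size + 1))
  | .loop c p, s => whileLoop M c (p.exec M G fuel) fuel s
  | .callStatic src len dst, s =>
      PMF.pure (some ((s.callStatic M G (src.eval M s) (len.eval M s) (dst.eval M s)).tick
        (src.size + len.size + dst.size + 1)))
  | .callInsert u v, s =>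
      PMF.pure (some ((s.callDynamic M .insert (u.eval M s) (v.eval M s)).tick
        (u.size + v.size + 1)))
  | .callDelete u v, s =>
      PMF.pure (some ((s.callDynamic M .delete (u.eval M s) (v.eval M s)).tick
        (u.size + v.size + 1)))

/-! ### Dynamic coloring algorithms on the machine -/

/-- A dynamic coloring algorithm: a program that is run once in the beginning, a program that is
run after each update, and an expression that computes the current color of the vertex in cell `0`
(so that colors are available in constant time). -/
structure Algorithm where
  preprocess : Prog
  update : Prog
  color : Expr

/-- The algorithm is deterministic. -/
def Algorithm.Deterministic (P : Algorithm) : Prop :=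
  P.preprocess.NoRandom ∧ P.update.NoRandom

/-- The initial state: the parameters are in the cells `3, 4, …` and all other cells are `0`. -/
def State.start (n : ℕ) (params : List ℕ) : State n where
  mem := fun a => if a < 3 then 0 else params.getD (a - 3) 0
  dynHist := []
  time := 0
  recolorings := 0

/-- An update is announced in the cells `0` (`1` for an insertion, `0` for a deletion), `1` and `2`
(the endpoints). -/
def State.announce (s : State n) : Update n → State n
  | .insert u v => ((s.write 0 1).write 1 u).write 2 v
  | .delete u v => ((s.write 0 0).write 1 u).write 2 v

/-- The coloring maintained by the algorithm. -/
def Algorithm.coloring (P : Algorithm) (M : Machine n) (s : State n) (v : Fin n) : ℕ :=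
  P.color.eval M (s.write 0 v)

/-- The distribution of the state after the preprocessing (of the edgeless graph). -/
def Algorithm.prepare (P : Algorithm) (M : Machine n) (params : List ℕ) (fuel : ℕ) :
    PMF (Option (State n)) :=
  P.preprocess.exec M ⊥ fuel (State.start n params)

/-- The distribution of the state after the updates of a history that was fixed in advance
(an oblivious adversary). The counter `time` measures the time since the end of the
preprocessing; `recolorings` counts the color changes caused by the updates. -/
def Algorithm.run (P : Algorithm) (M : Machine n) (params : List ℕ) (fuel : ℕ) :
    List (Update n) → PMF (Option (State n))
  | [] => (P.prepare M params fuel).map (Option.map fun s => { s with time := 0 })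
  | x :: h => andThen (P.run M params fuel h) fun s =>
      (P.update.exec M (graphOf (x :: h)) fuel (s.announce x)).map (Option.map fun s' =>
        { s' with recolorings := s.recolorings + changes (P.coloring M s) (P.coloring M s') })

/-- Expectation of a counter of the final state (`none` contributes nothing). -/
def expect (p : PMF (Option (State n))) (f : State n → ℕ) : ℝ≥0∞ :=
  ∑' o, p o * ((o.elim 0 f : ℕ) : ℝ≥0∞)

/-! ### Parameters and bounds -/

/-- `log² n / β`, rounded up. -/
def degreeBound (n : ℕ) (β : ℝ) : ℕ := ⌈Real.logb 2 n ^ 2 / β⌉₊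

/-- The parameters that the algorithm knows: `n`, `C`, and `β` through the integers
`⌊log n / β⌋` and `⌈log² n / β⌉`. -/
def params (n C : ℕ) (β : ℝ) : List ℕ := [n, C, ⌊Real.logb 2 n / β⌋₊, degreeBound n β]

/-- `(β / (n log n)) ∑_{i = 0}^{log n} 2 ^ i T(n / 2 ^ i)`. -/
def staticBound (n : ℕ) (β : ℝ) (T : ℕ → ℕ) : ℝ :=
  β / (n * Real.logb 2 n) * ∑ i ∈ Finset.range (Nat.log 2 n + 1), (2 : ℝ) ^ i * T (n / 2 ^ i)

end DynColoring

end

open DynColoring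

/-! # Dynamic coloring with few recolorings

Let `K = ⌊log n / β⌋`. Both algorithms distribute the vertices over the levels `0, …, ⌊log n⌋`, and a
vertex has a static color, which the static black box computed when the vertex entered its level. The
color of a vertex consists of its level, its static color and a further color that takes care of the
edges that were inserted later.

*Levels.* The partners of a vertex in the insertions since it entered its level form the list of its
recent insertions. When this list has length `K`, the vertex is pushed, and a rebuild follows: it finds
the finest level `k` such that at most `n / 2 ^ k` vertices were pushed since the last rebuild of a
coarser level (level `0` always takes all vertices), and moves all of them to level `k`, with new static
colors for the current graph. In this way a rebuild of level `k` empties all finer levels, and the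
static color is the same for two adjacent vertices of one level only if they are recent partners of each
other (`Layers.sound_after`). A push uses up `K` recent insertions, of which each update creates at most
two, and level `k` is rebuilt only after `n / 2 ^ (k + 1)` pushes, so that `h.length` updates cause
rebuilds of total cost at most `(4 * h.length / (K * n)) * ∑ k, 2 ^ k * T (n / 2 ^ k)`
(`Layers.rebuildCost_le`). For `T` this is the bound for the time, and for the identity in place of `T`
it bounds the number of vertices that change their level by `O(β)` per update.

*Deterministic algorithm.* The edges between recent partners form a graph of maximum degree at most
`K ≤ ⌈log² n / β⌉`, and the dynamic black box colors it. Edges are deleted from it when an endpoint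
moves; as many edges were inserted before, it receives at most three updates for each update of the
graph (`DetInv`).

*Randomized algorithm.* Every vertex has a random color among `5 * K`, which is drawn anew when the
vertex moves. If a new edge is monochromatic, then its first endpoint gets a random one of the at least
`4 * K` colors that none of its recent partners has. Thus recent partners always have different colors.
Since the insertions are fixed in advance, the probability that two given vertices have the same random
color grows by at most `1 / (10 * K ^ 2)` with each recent insertion of one of them, and so remains below
`2 / (5 * K)` (`RandSetting.mean_clash_le`). Hence the `O(K)` steps for recoloring an endpoint cost
`O(1)` in expectation. At most one vertex per update is recolored for this reason.

Programs are verified with the triples `Triple`, which say that a program surely terminates, and bound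
its running time; `MeanLE` bounds expectations. -/

namespace DynColoring

variable {n : ℕ}

/-! ### Levels, pushes and rebuilds -/

/-- The part of the memory of the algorithms that does not depend on the coloring of recent edges:
for every vertex its level, its static color and the list of its partners in the insertions since it
last got a static color; the stack of all vertices pushed so far, on top of a list of all vertices;
and for each `k` the height `start k` of the stack at the last rebuild of a level below `k`. -/
structure Layers (n : ℕ) where
  level : Fin n → ℕ
  base : Fin n → ℕ
  recent : Fin n → List (Fin n)
  stack : List (Fin n)
  start : ℕ → ℕ

namespace Layers

/-- All vertices are in level `0`, and nothing has been pushed. -/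
def initial (n : ℕ) : Layers n where
  level _ := 0
  base _ := 0
  recent _ := []
  stack := List.finRange n
  start j := if j = 0 then 0 else n

/-- Note the insertion of the edge `uv`. -/
def record (σ : Layers n) (u v : Fin n) : Layers n :=
  { σ with recent := fun x =>
      if x = u then σ.recent x ++ [v] else if x = v then σ.recent x ++ [u] else σ.recent x }

/-- Push a vertex with at least `K` recent insertions. -/
def push (K : ℕ) (σ : Layers n) (x : Fin n) : Layers n :=
  if K ≤ (σ.recent x).length then { σ with stack := σ.stack ++ [x] } else σ

/-- The finest level among `0, …, k` that has room for the vertices pushed since the last rebuild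
of a coarser level: level `j` has room for `n / 2 ^ j` of them. -/
def room (σ : Layers n) : ℕ → ℕ
  | 0 => 0
  | k + 1 => if n / 2 ^ (k + 1) < σ.stack.length - σ.start (k + 1) then σ.room k else k + 1

/-- A rebuild of level `0` starts with an empty stack. -/
def restrict (σ : Layers n) (k : ℕ) : Layers n :=
  if k = 0 then { σ with stack := σ.stack.take n } else σ

/-- The vertices that a rebuild of level `k` moves to level `k`. -/
def part (σ : Layers n) (k : ℕ) : List (Fin n) := σ.stack.drop (σ.start k)

/-- Move the vertices of `σ.part k` to level `k`, with new static colors `f`. -/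
def move (σ : Layers n) (k : ℕ) (f : Fin n → ℕ) : Layers n where
  level x := if x ∈ σ.part k then k else σ.level x
  base x := if x ∈ σ.part k then f x else σ.base x
  recent x := if x ∈ σ.part k then [] else σ.recent x
  stack := σ.stack
  start j := if k < j then σ.stack.length else σ.start j

/-- The level that is rebuilt next. -/
def target (σ : Layers n) : ℕ := σ.room (Nat.log 2 n)

/-- The vertices that move in the next rebuild. -/
def moving (σ : Layers n) : List (Fin n) := (σ.restrict σ.target).part σ.target

/-- The rebuild with the static algorithm `A` on the current graph `G`. -/
def rebuild (A : StaticAlgorithm n) (G : SimpleGraph (Fin n)) (σ : Layers n) : Layers n :=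
  (σ.restrict σ.target).move σ.target (A G σ.moving.toFinset)

/-- Note an insertion and push its endpoints when they have `K` recent insertions. -/
def pushed (K : ℕ) (σ : Layers n) (u v : Fin n) : Layers n := ((σ.record u v).push K u).push K v

/-- The insertion of `uv` causes a rebuild. -/
def Full (K : ℕ) (σ : Layers n) (u v : Fin n) : Prop :=
  σ.stack.length < (σ.pushed K u v).stack.length

instance (K : ℕ) (σ : Layers n) (u v : Fin n) : Decidable (σ.Full K u v) :=
  inferInstanceAs (Decidable (_ < _))

/-- The effect of an update, where `G` is the graph after it. -/
def step (A : StaticAlgorithm n) (K : ℕ) (G : SimpleGraph (Fin n)) (σ : Layers n) :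
    Update n → Layers n
  | .insert u v => if σ.Full K u v then (σ.pushed K u v).rebuild A G else σ.pushed K u v
  | .delete _ _ => σ

/-- The layers after a history. -/
def after (A : StaticAlgorithm n) (K : ℕ) : List (Update n) → Layers n
  | [] => initial n
  | x :: h => (after A K h).step A K (graphOf (x :: h)) x

/-- The invariants that also hold in the middle of an update, between the pushes and the rebuild:
at most two vertices lie above `start (⌊log n⌋ + 1)`, the height of the stack after the last rebuild.
A vertex of level `k` lies in the stack above `start k`, so that every rebuild of a level up to `k`
moves it. -/
structure Valid (K : ℕ) (σ : Layers n) : Prop where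
  start_zero : σ.start 0 = 0
  start_mono : Monotone σ.start
  start_le : ∀ j, σ.start j ≤ σ.stack.length
  start_succ : ∀ j, σ.start (j + 1) ≤ σ.start j + n
  le_start : ∀ j, j ≠ 0 → n ≤ σ.start j
  take_stack : σ.stack.take n = List.finRange n
  level_le : ∀ v, σ.level v ≤ Nat.log 2 n
  mem_part : ∀ v, v ∈ σ.part (σ.level v)
  length_recent : ∀ v, (σ.recent v).length ≤ K
  not_mem_recent : ∀ v, v ∉ σ.recent v
  length_stack : σ.stack.length ≤ σ.start (Nat.log 2 n + 1) + 2

/-- The invariants that hold between updates: a vertex with `K` recent insertions has been moved. -/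
structure Settled (K : ℕ) (σ : Layers n) : Prop extends Valid K σ where
  length_recent_lt : ∀ v, (σ.recent v).length < K
  length_stack_eq : σ.stack.length = σ.start (Nat.log 2 n + 1)

theorem Valid.n_le {K : ℕ} {σ : Layers n} (h : σ.Valid K) : n ≤ σ.stack.length := by
  have := congrArg List.length h.take_stack
  simp at this
  exact this

theorem settled_initial {K : ℕ} (hK : 0 < K) : (initial n).Settled K where
  start_zero := rfl
  start_mono i j hij := by
    simp only [initial]; split_ifs <;> omega
  start_le j := by simp only [initial, List.length_finRange]; split_ifs <;> omega
  start_succ j := by simp [initial]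
  le_start j hj := by simp [initial, hj]
  take_stack := by
    simp only [initial]
    rw [List.take_of_length_le (by simp)]
  level_le v := Nat.zero_le _
  mem_part v := by simp [initial, part]
  length_recent v := Nat.zero_le _
  not_mem_recent v := by simp [initial]
  length_stack := by simp [initial]
  length_recent_lt v := by simpa [initial] using hK
  length_stack_eq := by simp [initial]

@[simp] theorem record_level (σ : Layers n) (u v : Fin n) : (σ.record u v).level = σ.level := rfl
@[simp] theorem record_base (σ : Layers n) (u v : Fin n) : (σ.record u v).base = σ.base := rfl
@[simp] theorem record_stack (σ : Layers n) (u v : Fin n) : (σ.record u v).stack = σ.stack := rfl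
@[simp] theorem record_start (σ : Layers n) (u v : Fin n) : (σ.record u v).start = σ.start := rfl

@[simp] theorem push_level (K : ℕ) (σ : Layers n) (x : Fin n) : (σ.push K x).level = σ.level := by
  unfold push; split_ifs <;> rfl
@[simp] theorem push_base (K : ℕ) (σ : Layers n) (x : Fin n) : (σ.push K x).base = σ.base := by
  unfold push; split_ifs <;> rfl
@[simp] theorem push_start (K : ℕ) (σ : Layers n) (x : Fin n) : (σ.push K x).start = σ.start := by
  unfold push; split_ifs <;> rfl
@[simp] theorem push_recent (K : ℕ) (σ : Layers n) (x : Fin n) :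
    (σ.push K x).recent = σ.recent := by
  unfold push; split_ifs <;> rfl

theorem push_stack (K : ℕ) (σ : Layers n) (x : Fin n) : (σ.push K x).stack =
    if K ≤ (σ.recent x).length then σ.stack ++ [x] else σ.stack := by
  unfold push; split_ifs <;> rfl

@[simp] theorem restrict_level (σ : Layers n) (k : ℕ) : (σ.restrict k).level = σ.level := by
  unfold restrict; split_ifs <;> rfl
@[simp] theorem restrict_base (σ : Layers n) (k : ℕ) : (σ.restrict k).base = σ.base := by
  unfold restrict; split_ifs <;> rfl
@[simp] theorem restrict_start (σ : Layers n) (k : ℕ) : (σ.restrict k).start = σ.start := by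
  unfold restrict; split_ifs <;> rfl
@[simp] theorem restrict_recent (σ : Layers n) (k : ℕ) : (σ.restrict k).recent = σ.recent := by
  unfold restrict; split_ifs <;> rfl

@[simp] theorem pushed_level (K : ℕ) (σ : Layers n) (u v : Fin n) :
    (σ.pushed K u v).level = σ.level := by simp [pushed]
@[simp] theorem pushed_base (K : ℕ) (σ : Layers n) (u v : Fin n) :
    (σ.pushed K u v).base = σ.base := by simp [pushed]
@[simp] theorem pushed_start (K : ℕ) (σ : Layers n) (u v : Fin n) :
    (σ.pushed K u v).start = σ.start := by simp [pushed]
@[simp] theorem pushed_recent (K : ℕ) (σ : Layers n) (u v : Fin n) :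
    (σ.pushed K u v).recent = (σ.record u v).recent := by simp [pushed]

theorem pushed_stack (K : ℕ) (σ : Layers n) (u v : Fin n) : (σ.pushed K u v).stack =
    σ.stack ++ ((if K ≤ ((σ.record u v).recent u).length then [u] else []) ++
      (if K ≤ ((σ.record u v).recent v).length then [v] else [])) := by
  simp only [pushed, push_stack, push_recent, record_stack]
  split_ifs <;> simp

theorem length_record_recent (σ : Layers n) {u v : Fin n} (huv : u ≠ v) (x : Fin n) :
    ((σ.record u v).recent x).length =
      (σ.recent x).length + (if x = u then 1 else 0) + (if x = v then 1 else 0) := by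
  simp only [record]
  split_ifs with h1 h2 h2 <;> simp_all

theorem mem_record_recent (σ : Layers n) {u v : Fin n} (huv : u ≠ v) (x y : Fin n) :
    y ∈ (σ.record u v).recent x ↔ y ∈ σ.recent x ∨ (x = u ∧ y = v) ∨ (x = v ∧ y = u) := by
  simp only [record]
  split_ifs with h1 h2 <;> simp_all

theorem Settled.valid_record {K : ℕ} {σ : Layers n} (h : σ.Settled K) {u v : Fin n}
    (huv : u ≠ v) : (σ.record u v).Valid K where
  start_zero := h.start_zero
  start_mono := h.start_mono
  start_le := h.start_le
  start_succ := h.start_succ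
  le_start := h.le_start
  take_stack := h.take_stack
  level_le := h.level_le
  mem_part := h.mem_part
  length_recent x := by
    rw [length_record_recent σ huv]
    have := h.length_recent_lt x
    split_ifs with h1 h2
    · exact absurd (h1.symm.trans h2) huv
    all_goals omega
  not_mem_recent x := by
    rw [mem_record_recent σ huv]
    rintro (h1 | ⟨h1, h2⟩ | ⟨h1, h2⟩)
    · exact h.not_mem_recent x h1
    · exact huv (h1.symm.trans h2)
    · exact huv (h2.symm.trans h1)
  length_stack := h.length_stack

theorem Settled.valid_pushed {K : ℕ} {σ : Layers n} (h : σ.Settled K) {u v : Fin n}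
    (huv : u ≠ v) : (σ.pushed K u v).Valid K := by
  have hr := h.valid_record huv
  constructor
  · simpa using h.start_zero
  · simpa using h.start_mono
  · intro j
    have := h.start_le j
    simp only [pushed_start, pushed_stack, List.length_append]
    omega
  · simpa using h.start_succ
  · simpa using h.le_start
  · rw [pushed_stack, List.take_append_of_le_length h.n_le, h.take_stack]
  · simpa using h.level_le
  · intro x
    have := h.mem_part x
    simp only [part, pushed_start, pushed_level, pushed_stack] at this ⊢
    rw [List.drop_append_of_le_length (h.start_le _)]
    exact List.mem_append_left _ this
  · simpa using hr.length_recent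
  · simpa using hr.not_mem_recent
  · have := h.length_stack_eq
    simp only [pushed_start, pushed_stack, List.length_append]
    split_ifs <;> simp <;> omega

theorem room_le (σ : Layers n) (k : ℕ) : σ.room k ≤ k := by
  induction k with
  | zero => simp [room]
  | succ k ih => simp only [room]; split_ifs <;> omega

/-- The pushed vertices fit into the level that `room` finds, unless this is level `0`. -/
theorem length_le_of_room (σ : Layers n) (k : ℕ) (h : σ.room k ≠ 0) :
    σ.stack.length - σ.start (σ.room k) ≤ n / 2 ^ σ.room k := by
  induction k with
  | zero => simp [room] at h
  | succ k ih =>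
    simp only [room] at h ⊢
    split_ifs at h ⊢ with h1
    · exact ih h
    · omega

/-- `room` passes over a level only when the pushed vertices do not fit into it. -/
theorem lt_of_lt_room (σ : Layers n) (k j : ℕ) (hj : j ≤ k) (h : σ.room k < j) :
    n / 2 ^ j < σ.stack.length - σ.start j := by
  induction k with
  | zero => omega
  | succ k ih =>
    simp only [room] at h
    split_ifs at h with h1
    · rcases Nat.lt_or_ge k j with h2 | h2
      · obtain rfl : j = k + 1 := by omega
        exact h1
      · exact ih h2 h
    · omega

theorem target_le (σ : Layers n) : σ.target ≤ Nat.log 2 n := σ.room_le _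

theorem Valid.restrict {K : ℕ} {σ : Layers n} (h : σ.Valid K) :
    (σ.restrict σ.target).stack.take n = List.finRange n := by
  unfold Layers.restrict
  split_ifs
  · simp [h.take_stack]
  · exact h.take_stack

theorem Valid.moving_zero {K : ℕ} {σ : Layers n} (h : σ.Valid K) (h0 : σ.target = 0) :
    σ.moving = List.finRange n := by
  rw [moving, h0, part, restrict_start, h.start_zero, List.drop_zero, Layers.restrict, if_pos rfl]
  exact h.take_stack

theorem moving_of_ne_zero {σ : Layers n} (h0 : σ.target ≠ 0) : σ.moving = σ.part σ.target := by
  rw [moving, Layers.restrict, if_neg h0]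

/-- A rebuild of level `k` moves at most `n / 2 ^ k` vertices. -/
theorem Valid.length_moving {K : ℕ} {σ : Layers n} (h : σ.Valid K) :
    σ.moving.length ≤ n / 2 ^ σ.target := by
  by_cases h0 : σ.target = 0
  · simp [h.moving_zero h0, h0]
  · rw [moving_of_ne_zero h0, part, List.length_drop]
    exact σ.length_le_of_room _ h0

theorem Valid.start_le_restrict {K : ℕ} {σ : Layers n} (h : σ.Valid K) {j : ℕ}
    (hj : j ≤ σ.target) : σ.start j ≤ (σ.restrict σ.target).stack.length := by
  unfold Layers.restrict
  split_ifs with h0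
  · obtain rfl : j = 0 := by omega
    simp [h.start_zero]
  · exact h.start_le j

theorem Valid.n_le_restrict {K : ℕ} {σ : Layers n} (h : σ.Valid K) :
    n ≤ (σ.restrict σ.target).stack.length := by
  have := congrArg List.length h.restrict
  simp at this
  exact this

/-- All vertices of the level that is rebuilt, and of all finer levels, move. -/
theorem Valid.mem_moving {K : ℕ} {σ : Layers n} (h : σ.Valid K) {x : Fin n}
    (hx : σ.target ≤ σ.level x) : x ∈ σ.moving := by
  by_cases h0 : σ.target = 0
  · simp [h.moving_zero h0]
  · rw [moving_of_ne_zero h0]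
    have h1 := h.mem_part x
    have h2 := h.start_mono hx
    rw [part] at h1 ⊢
    exact (List.drop_subset_drop_left _ h2) h1

theorem rebuild_recent (A : StaticAlgorithm n) (G : SimpleGraph (Fin n)) (σ : Layers n)
    (x : Fin n) : (σ.rebuild A G).recent x = if x ∈ σ.moving then [] else σ.recent x := by
  simp only [rebuild, move, restrict_recent]
  rfl

theorem rebuild_level (A : StaticAlgorithm n) (G : SimpleGraph (Fin n)) (σ : Layers n)
    (x : Fin n) : (σ.rebuild A G).level x = if x ∈ σ.moving then σ.target else σ.level x := by
  simp only [rebuild, move, restrict_level]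
  rfl

theorem rebuild_base (A : StaticAlgorithm n) (G : SimpleGraph (Fin n)) (σ : Layers n)
    (x : Fin n) : (σ.rebuild A G).base x =
      if x ∈ σ.moving then A G σ.moving.toFinset x else σ.base x := by
  simp only [rebuild, move, restrict_base]
  rfl

theorem Valid.rebuild {K : ℕ} {σ : Layers n} (h : σ.Valid K) (A : StaticAlgorithm n)
    (G : SimpleGraph (Fin n)) : (σ.rebuild A G).Valid K ∧
      (σ.rebuild A G).stack.length = (σ.rebuild A G).start (Nat.log 2 n + 1) := by
  have hstart : ∀ j, (σ.rebuild A G).start j =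
      if σ.target < j then (σ.restrict σ.target).stack.length else σ.start j := by
    intro j; simp [Layers.rebuild, move]
  have hstack : (σ.rebuild A G).stack = (σ.restrict σ.target).stack := rfl
  have hlen := h.length_moving
  have hle := h.start_le_restrict (le_refl _)
  have hdiv : n / 2 ^ σ.target ≤ n := Nat.div_le_self _ _
  have hmv : σ.moving.length = (σ.restrict σ.target).stack.length - σ.start σ.target := by
    simp [moving, part]
  have heq : (σ.rebuild A G).stack.length = (σ.rebuild A G).start (Nat.log 2 n + 1) := by
    rw [hstart, if_pos (by have := σ.target_le; omega), hstack]
  refine ⟨?_, heq⟩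
  constructor
  · rw [hstart, if_neg (by omega), h.start_zero]
  · intro i j hij
    have h1 := h.start_mono hij
    rw [hstart, hstart]
    split_ifs
    · rfl
    · omega
    · exact h.start_le_restrict (by omega)
    · exact h1
  · intro j
    rw [hstart, hstack]
    split_ifs
    · rfl
    · exact h.start_le_restrict (by omega)
  · intro j
    have h1 := h.start_succ j
    rw [hstart, hstart]
    split_ifs with h2 h3 h3
    · omega
    · obtain rfl : j = σ.target := by omega
      omega
    · omega
    · exact h1
  · intro j hj
    have h1 := h.le_start j hj
    rw [hstart]
    split_ifs
    · exact h.n_le_restrict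
    · exact h1
  · rw [hstack]; exact h.restrict
  · intro v
    rw [rebuild_level]
    split_ifs
    · exact σ.target_le
    · exact h.level_le v
  · intro x
    rw [part, rebuild_level, hstart, hstack]
    split_ifs with h1 h2 h2
    · omega
    · simpa [moving, part] using h1
    · exact absurd (h.mem_moving h2.le) h1
    · have h0 : σ.target ≠ 0 := by
        intro h0
        exact h1 (by simp [h.moving_zero h0])
      rw [Layers.restrict, if_neg h0]
      exact h.mem_part x
  · intro v
    rw [rebuild_recent]
    split_ifs
    · simp
    · exact h.length_recent v
  · intro v
    rw [rebuild_recent]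
    split_ifs
    · simp
    · exact h.not_mem_recent v
  · omega

theorem Settled.not_full_iff {K : ℕ} {σ : Layers n} (u v : Fin n) :
    ¬ σ.Full K u v ↔ (σ.pushed K u v).stack = σ.stack ∧
      ((σ.record u v).recent u).length < K ∧ ((σ.record u v).recent v).length < K := by
  rw [Full, pushed_stack]
  split_ifs <;> simp <;> omega

/-- A vertex that is pushed moves in the rebuild that follows. -/
theorem Settled.mem_moving_pushed {K : ℕ} {σ : Layers n} (h : σ.Settled K) {u v : Fin n}
    (huv : u ≠ v) {x : Fin n} (hx : x = u ∨ x = v)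
    (hK : K ≤ ((σ.record u v).recent x).length) : x ∈ (σ.pushed K u v).moving := by
  have hv := h.valid_pushed huv
  by_cases h0 : (σ.pushed K u v).target = 0
  · simp [hv.moving_zero h0]
  · rw [moving_of_ne_zero h0, part, pushed_start, pushed_stack,
      List.drop_append_of_le_length (h.start_le _)]
    refine List.mem_append_right _ ?_
    rcases hx with rfl | rfl
    · simp [hK]
    · simp [hK]

theorem Settled.step {K : ℕ} {σ : Layers n} (h : σ.Settled K) (A : StaticAlgorithm n)
    {G G' : SimpleGraph (Fin n)} {x : Update n} (hx : x.Legal G) :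
    (σ.step A K G' x).Settled K := by
  cases x with
  | delete u v => exact h
  | insert u v =>
    have huv : u ≠ v := hx.1
    have hp := h.valid_pushed huv
    simp only [Layers.step]
    split_ifs with hf
    · obtain ⟨h1, h2⟩ := hp.rebuild A G'
      refine { h1 with length_recent_lt := fun x => ?_, length_stack_eq := h2 }
      rw [rebuild_recent]
      have h0 := h.length_recent_lt x
      split_ifs with hm
      · simp; omega
      · by_contra hc
        rw [pushed_recent] at hc
        by_cases hxu : x = u ∨ x = v
        · exact hm (h.mem_moving_pushed huv hxu (by omega))
        · push Not at hxu
          rw [length_record_recent σ huv, if_neg hxu.1, if_neg hxu.2] at hc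
          omega
    · rw [Settled.not_full_iff] at hf
      refine { hp with length_recent_lt := fun x => ?_, length_stack_eq := ?_ }
      · rw [pushed_recent]
        by_cases h1 : x = u
        · subst h1; exact hf.2.1
        · by_cases h2 : x = v
          · subst h2; exact hf.2.2
          · rw [length_record_recent σ huv, if_neg h1, if_neg h2]
            exact h.length_recent_lt x
      · rw [hf.1, pushed_start]
        exact h.length_stack_eq

theorem settled_after {K : ℕ} (hK : 0 < K) (A : StaticAlgorithm n)
    {P : SimpleGraph (Fin n) → Prop} {h : List (Update n)} (hh : IsHistory P h) :
    (after A K h).Settled K := by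
  induction h with
  | nil => exact settled_initial hK
  | cons x h ih => exact (ih hh.2.2).step A hh.1

/-- Vertices of the same level that are adjacent in `G` differ in their static colors, unless they
were joined after they got them. -/
structure Sound (C : ℕ) (G : SimpleGraph (Fin n)) (σ : Layers n) : Prop where
  base_lt : ∀ v, σ.base v < C
  base_ne : ∀ u v, G.Adj u v → σ.level u = σ.level v →
    σ.base u ≠ σ.base v ∨ (v ∈ σ.recent u ∧ u ∈ σ.recent v)

/-- After a rebuild, the level that was rebuilt consists of the moved vertices only, because everything
in it or in a finer level was moved. So the colors that the static algorithm gives to the moved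
vertices need not agree with older ones. -/
theorem Sound.rebuild {K C : ℕ} {G : SimpleGraph (Fin n)} {σ : Layers n} (hs : σ.Sound C G)
    (h : σ.Valid K) {A : StaticAlgorithm n} {𝒢 : Set (SimpleGraph (Fin n))} (hA : A.Colors 𝒢 C)
    (hG : G ∈ 𝒢) : (σ.rebuild A G).Sound C G where
  base_lt v := by
    rw [rebuild_base]
    split_ifs with h1
    · exact (hA G hG _).1 v (by simpa using h1)
    · exact hs.base_lt v
  base_ne u v huv := by
    simp only [rebuild_base, rebuild_level, rebuild_recent]
    split_ifs with h1 h2 h2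
    · intro _
      exact Or.inl ((hA G hG _).2 u (by simpa using h1) v (by simpa using h2) huv)
    · intro h3
      exact absurd (h.mem_moving h3.le) h2
    · intro h3
      exact absurd (h.mem_moving h3.ge) h1
    · exact hs.base_ne u v huv

theorem Sound.step {K C : ℕ} {G : SimpleGraph (Fin n)} {σ : Layers n} (hs : σ.Sound C G)
    (h : σ.Settled K) {A : StaticAlgorithm n} {𝒢 : Set (SimpleGraph (Fin n))} (hA : A.Colors 𝒢 C)
    {x : Update n} (hx : x.Legal G) (hG : x.apply G ∈ 𝒢) :
    (σ.step A K (x.apply G) x).Sound C (x.apply G) := by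
  cases x with
  | delete u v =>
    refine ⟨hs.base_lt, fun a b hab => hs.base_ne a b ?_⟩
    exact hab.1
  | insert u v =>
    have huv : u ≠ v := hx.1
    have hp : (σ.pushed K u v).Sound C (Update.apply (.insert u v) G) := by
      refine ⟨by simpa using hs.base_lt, fun a b hab hl => ?_⟩
      simp only [pushed_level, pushed_base, pushed_recent, mem_record_recent σ huv] at hl ⊢
      rcases hab with hab | hab
      · rcases hs.base_ne a b hab hl with h1 | h1
        · exact Or.inl h1
        · exact Or.inr ⟨Or.inl h1.1, Or.inl h1.2⟩
      · rw [SimpleGraph.edge_adj] at hab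
        rcases hab.1 with ⟨rfl, rfl⟩ | ⟨rfl, rfl⟩ <;> simp
    simp only [Layers.step]
    split_ifs with hf
    · exact hp.rebuild (h.valid_pushed huv) hA hG
    · exact hp

theorem sound_after {K C : ℕ} (hK : 0 < K) (hC : 0 < C) {A : StaticAlgorithm n}
    {𝒢 : Set (SimpleGraph (Fin n))} (hA : A.Colors 𝒢 C) {h : List (Update n)}
    (hh : IsHistory (fun G => G ∈ 𝒢) h) : (after A K h).Sound C (graphOf h) := by
  induction h with
  | nil => exact ⟨fun v => hC, fun u v huv => absurd huv (by simp [graphOf])⟩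
  | cons x h ih => exact (ih hh.2.2).step (settled_after hK A hh.2.2) hA hh.1 hh.2.1

/-! ### Counting rebuilds -/

/-- The number of recent insertions, over all vertices. -/
def pending (σ : Layers n) : ℕ := ∑ v, (σ.recent v).length

/-- `w k` if the update makes level `k` be rebuilt, and `0` if it causes no rebuild. -/
def weight (K : ℕ) (w : ℕ → ℕ) (σ : Layers n) : Update n → ℕ
  | .insert u v => if σ.Full K u v then w (σ.pushed K u v).target else 0
  | .delete _ _ => 0

/-- The total cost of the rebuilds when one of level `k` costs `w k`. -/
def rebuildCost (A : StaticAlgorithm n) (K : ℕ) (w : ℕ → ℕ) : List (Update n) → ℕ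
  | [] => 0
  | x :: h => (after A K h).weight K w x + rebuildCost A K w h

/-- The number of vertices that an update pushes. -/
def pushes (K : ℕ) (σ : Layers n) : Update n → ℕ
  | .insert u v => (σ.pushed K u v).stack.length - σ.stack.length
  | .delete _ _ => 0

/-- The number of vertices pushed during a history. -/
def pushCount (A : StaticAlgorithm n) (K : ℕ) : List (Update n) → ℕ
  | [] => 0
  | x :: h => (after A K h).pushes K x + pushCount A K h

theorem pending_record (σ : Layers n) {u v : Fin n} (huv : u ≠ v) :
    (σ.record u v).pending = σ.pending + 2 := by
  simp only [pending, length_record_recent σ huv, Finset.sum_add_distrib]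
  simp

/-- Make the vertices of a list forget their recent insertions. -/
def forget (σ : Layers n) (L : List (Fin n)) : Layers n :=
  { σ with recent := fun x => if x ∈ L then [] else σ.recent x }

theorem pending_forget_append (σ : Layers n) (L : List (Fin n)) (x : Fin n) :
    (σ.forget (L ++ [x])).pending + ((σ.forget L).recent x).length = (σ.forget L).pending := by
  simp only [pending, forget]
  rw [← Finset.sum_erase_add _ _ (Finset.mem_univ x),
    ← Finset.sum_erase_add Finset.univ (fun y => (if y ∈ L then [] else σ.recent y).length)
      (Finset.mem_univ x)]
  have : ∑ y ∈ Finset.univ.erase x, (if y ∈ L ++ [x] then [] else σ.recent y).length =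
      ∑ y ∈ Finset.univ.erase x, (if y ∈ L then [] else σ.recent y).length := by
    refine Finset.sum_congr rfl fun y hy => ?_
    simp [Finset.ne_of_mem_erase hy]
  rw [this]
  simp

theorem pending_forget_le (σ : Layers n) (L : List (Fin n)) :
    (σ.forget L).pending ≤ σ.pending := by
  refine Finset.sum_le_sum fun x _ => ?_
  simp only [forget]
  split_ifs <;> simp

theorem pending_rebuild (A : StaticAlgorithm n) (G : SimpleGraph (Fin n)) (σ : Layers n) :
    (σ.rebuild A G).pending = (σ.forget σ.moving).pending := by
  simp only [pending, rebuild_recent]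
  rfl

/-- Every pushed vertex loses its `K` recent insertions. -/
theorem Settled.pending_step {K : ℕ} {σ : Layers n} (h : σ.Settled K) (A : StaticAlgorithm n)
    {G G' : SimpleGraph (Fin n)} {x : Update n} (hx : x.Legal G) :
    (σ.step A K G' x).pending + K * σ.pushes K x ≤ σ.pending + 2 := by
  cases x with
  | delete u v => simp [Layers.step, pushes]
  | insert u v =>
    have huv : u ≠ v := hx.1
    have hpend : (σ.pushed K u v).pending = σ.pending + 2 := by
      rw [← σ.pending_record huv]; simp [pending]
    simp only [Layers.step, pushes]
    split_ifs with hf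
    · rw [pending_rebuild]
      have key : ∀ S : Finset (Fin n), (∀ x ∈ S, x ∈ (σ.pushed K u v).moving ∧
          K ≤ ((σ.record u v).recent x).length) →
          ((σ.pushed K u v).forget (σ.pushed K u v).moving).pending + K * S.card ≤
            σ.pending + 2 := by
        intro S hS
        rw [← hpend, pending, pending, ← Finset.sum_compl_add_sum S,
          ← Finset.sum_compl_add_sum S (fun x => ((σ.pushed K u v).recent x).length), add_assoc]
        refine add_le_add (Finset.sum_le_sum fun x _ => ?_) ?_
        · simp only [forget]; split_ifs <;> simp
        · rw [Finset.sum_eq_zero fun x hx => ?_, zero_add, mul_comm, ← smul_eq_mul]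
          · refine Finset.card_nsmul_le_sum _ _ _ fun x hx => ?_
            simpa using (hS x hx).2
          · simp [forget, (hS x hx).1]
      rw [pushed_stack]
      have hu := h.mem_moving_pushed huv (x := u) (Or.inl rfl)
      have hv := h.mem_moving_pushed huv (x := v) (Or.inr rfl)
      split_ifs with h1 h2 h2
      · have := key {u, v} (by simp_all)
        rw [Finset.card_pair huv] at this
        simpa using this
      · simpa using key {u} (by simp_all)
      · simpa using key {v} (by simp_all)
      · simpa using key ∅ (by simp)
    · rw [Settled.not_full_iff] at hf
      simp [hf.1, hpend]

/-- Every insertion adds two recent insertions, and every push is paid for by `K` of them. -/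
theorem pending_after {K : ℕ} (hK : 0 < K) (A : StaticAlgorithm n)
    {P : SimpleGraph (Fin n) → Prop} {h : List (Update n)} (hh : IsHistory P h) :
    (after A K h).pending + K * pushCount A K h ≤ 2 * h.length := by
  induction h with
  | nil => simp [after, pending, initial, pushCount]
  | cons x h ih =>
    have h1 := ih hh.2.2
    have h2 := (settled_after hK A hh.2.2).pending_step A (G' := graphOf (x :: h)) hh.1
    simp only [after, pushCount, List.length_cons, mul_add]
    omega

/-- Level `k` is rebuilt only when the next finer level has no room. -/
theorem Settled.lt_of_full {K : ℕ} {σ : Layers n} (h : σ.Settled K) {u v : Fin n}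
    (hf : σ.Full K u v) : n / 2 ^ ((σ.pushed K u v).target + 1) <
      (σ.pushed K u v).stack.length - (σ.pushed K u v).start ((σ.pushed K u v).target + 1) := by
  have h1 := (σ.pushed K u v).target_le
  rcases Nat.lt_or_ge (σ.pushed K u v).target (Nat.log 2 n) with h2 | h2
  · exact lt_of_lt_room _ _ _ h2 (Nat.lt_succ_self _)
  · have h3 : (σ.pushed K u v).target = Nat.log 2 n := by omega
    -- There is no level finer than `⌊log n⌋`, but then `n / 2 ^ (k + 1)` is `0`, and something was
    -- pushed.
    rw [h3, Nat.div_eq_of_lt (Nat.lt_pow_succ_log_self (by norm_num) n), pushed_start,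
      ← h.length_stack_eq]
    unfold Full at hf
    omega

/-- The potential argument that bounds the number of rebuilds of level `k`. -/
theorem Settled.potential_step {K : ℕ} {σ : Layers n} (h : σ.Settled K) (A : StaticAlgorithm n)
    {G G' : SimpleGraph (Fin n)} {x : Update n} (hx : x.Legal G) (k : ℕ) :
    n * σ.weight K (fun j => if j = k then 1 else 0) x + 2 ^ (k + 1) *
        ((σ.step A K G' x).stack.length - (σ.step A K G' x).start (k + 1)) ≤
      2 ^ (k + 1) * (σ.stack.length - σ.start (k + 1)) + 2 ^ (k + 1) * σ.pushes K x := by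
  cases x with
  | delete u v => simp [Layers.step, pushes, weight]
  | insert u v =>
    have huv : u ≠ v := hx.1
    have hle := h.start_le (k + 1)
    have hge : σ.stack.length ≤ (σ.pushed K u v).stack.length := by
      rw [pushed_stack]; simp
    have hsum : 2 ^ (k + 1) * (σ.stack.length - σ.start (k + 1)) + 2 ^ (k + 1) *
        ((σ.pushed K u v).stack.length - σ.stack.length) =
        2 ^ (k + 1) * ((σ.pushed K u v).stack.length - σ.start (k + 1)) := by
      rw [← mul_add]; congr 1; omega
    simp only [Layers.step, pushes, weight, hsum]
    split_ifs with hf h1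
    · have h2 : k < k + 1 := Nat.lt_succ_self k
      have h3 := h.lt_of_full hf
      rw [h1, pushed_start] at h3
      have h4 : n < 2 ^ (k + 1) * (n / 2 ^ (k + 1) + 1) := Nat.lt_mul_div_succ n (by positivity)
      have h5 : 2 ^ (k + 1) * (n / 2 ^ (k + 1) + 1) ≤
          2 ^ (k + 1) * ((σ.pushed K u v).stack.length - σ.start (k + 1)) :=
        Nat.mul_le_mul_left _ h3
      have h6 : ((σ.pushed K u v).rebuild A G').stack.length -
          ((σ.pushed K u v).rebuild A G').start (k + 1) = 0 := by
        simp [Layers.rebuild, move, h1]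
      rw [h6]
      omega
    · rw [mul_zero, zero_add]
      refine Nat.mul_le_mul_left _ ?_
      simp only [Layers.rebuild, move]
      split_ifs with h2
      · omega
      · rw [Layers.restrict, if_neg (by omega), pushed_start]
    · simp

/-- Level `k` is rebuilt at most `2 ^ (k + 1) / n` times as often as vertices are pushed. -/
theorem potential_after {K : ℕ} (hK : 0 < K) (A : StaticAlgorithm n)
    {P : SimpleGraph (Fin n) → Prop} {h : List (Update n)} (hh : IsHistory P h) (k : ℕ) :
    n * rebuildCost A K (fun j => if j = k then 1 else 0) h + 2 ^ (k + 1) *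
        ((after A K h).stack.length - (after A K h).start (k + 1)) ≤
      2 ^ (k + 1) * pushCount A K h := by
  induction h with
  | nil => simp [after, initial, pushCount, rebuildCost]
  | cons x h ih =>
    have h1 := ih hh.2.2
    have h2 := (settled_after hK A hh.2.2).potential_step A (G' := graphOf (x :: h)) hh.1 k
    simp only [after, pushCount, rebuildCost, mul_add] at h1 h2 ⊢
    omega

theorem rebuildCost_eq (A : StaticAlgorithm n) (K : ℕ) (w : ℕ → ℕ) (h : List (Update n)) :
    rebuildCost A K w h = ∑ k ∈ Finset.range (Nat.log 2 n + 1),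
      w k * rebuildCost A K (fun j => if j = k then 1 else 0) h := by
  induction h with
  | nil => simp [rebuildCost]
  | cons x h ih =>
    simp only [rebuildCost, mul_add, Finset.sum_add_distrib, ← ih]
    congr 1
    cases x with
    | delete u v => simp [weight]
    | insert u v =>
      simp only [weight]
      split_ifs with hf
      · have := target_le ((after A K h).pushed K u v)
        simp [this]
      · simp

/-- The amortized cost of the rebuilds: there are at most `2 * h.length / K` pushes, and a rebuild of
level `k` is paid for by `n / 2 ^ (k + 1)` of them. -/
theorem rebuildCost_le {K : ℕ} (hK : 0 < K) (A : StaticAlgorithm n)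
    {P : SimpleGraph (Fin n) → Prop} {h : List (Update n)} (hh : IsHistory P h) (w : ℕ → ℕ) :
    K * n * rebuildCost A K w h ≤
      4 * h.length * ∑ k ∈ Finset.range (Nat.log 2 n + 1), 2 ^ k * w k := by
  rw [rebuildCost_eq, Finset.mul_sum, Finset.mul_sum]
  refine Finset.sum_le_sum fun k _ => ?_
  have h1 := potential_after hK A hh k
  have h2 := pending_after hK A hh
  have h3 : n * rebuildCost A K (fun j => if j = k then 1 else 0) h ≤
      2 ^ (k + 1) * pushCount A K h := by omega
  have h4 : K * pushCount A K h ≤ 2 * h.length := by omega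
  calc K * n * (w k * rebuildCost A K (fun j => if j = k then 1 else 0) h)
      = w k * K * (n * rebuildCost A K (fun j => if j = k then 1 else 0) h) := by ring
    _ ≤ w k * K * (2 ^ (k + 1) * pushCount A K h) := Nat.mul_le_mul_left _ h3
    _ = w k * 2 ^ (k + 1) * (K * pushCount A K h) := by ring
    _ ≤ w k * 2 ^ (k + 1) * (2 * h.length) := Nat.mul_le_mul_left _ h4
    _ = 4 * h.length * (2 ^ k * w k) := by ring

end Layers

/-! ### Random computations -/

/-- The computation never runs out of fuel, and every possible result satisfies `Q`. -/
def Surely (p : PMF (Option (State n))) (Q : State n → Prop) : Prop :=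
  ∀ o ∈ p.support, ∃ s, o = some s ∧ Q s

/-- The expectation of `g`, where running out of fuel counts as `∞`. -/
noncomputable def mean (p : PMF (Option (State n))) (g : State n → ℝ≥0∞) : ℝ≥0∞ :=
  ∑' o, p o * o.elim ⊤ g

namespace Surely

theorem mono {p : PMF (Option (State n))} {Q R : State n → Prop} (h : Surely p Q)
    (hQ : ∀ s, Q s → R s) : Surely p R := fun o ho =>
  let ⟨s, hs, hq⟩ := h o ho
  ⟨s, hs, hQ s hq⟩

theorem pure {s : State n} {Q : State n → Prop} (h : Q s) : Surely (PMF.pure (some s)) Q := by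
  intro o ho
  rw [PMF.mem_support_pure_iff] at ho
  exact ⟨s, ho, h⟩

theorem andThen {p : PMF (Option (State n))} {f : State n → PMF (Option (State n))}
    {Q : State n → Prop} (h : Surely p fun s => Surely (f s) Q) :
    Surely (DynColoring.andThen p f) Q := by
  intro o ho
  rw [DynColoring.andThen, PMF.mem_support_bind_iff] at ho
  obtain ⟨o', ho', hoo⟩ := ho
  obtain ⟨s, rfl, hs⟩ := h o' ho'
  exact hs o hoo

theorem map {p : PMF (Option (State n))} {f : State n → State n} {Q : State n → Prop}
    (h : Surely p fun s => Q (f s)) : Surely (p.map (Option.map f)) Q := by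
  intro o ho
  rw [PMF.mem_support_map_iff] at ho
  obtain ⟨o', ho', rfl⟩ := ho
  obtain ⟨s, rfl, hs⟩ := h o' ho'
  exact ⟨f s, rfl, hs⟩

theorem uniform {k : ℕ} {f : Fin (k + 1) → State n} {Q : State n → Prop} (h : ∀ x, Q (f x)) :
    Surely ((PMF.uniformOfFintype (Fin (k + 1))).map fun x => some (f x)) Q := by
  intro o ho
  rw [PMF.mem_support_map_iff] at ho
  obtain ⟨x, -, rfl⟩ := ho
  exact ⟨f x, rfl, h x⟩

theorem none_notMem {p : PMF (Option (State n))} {Q : State n → Prop} (h : Surely p Q) :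
    none ∉ p.support := fun hn => by
  obtain ⟨s, hs, -⟩ := h none hn
  cases hs

theorem of_mem {p : PMF (Option (State n))} {Q : State n → Prop} (h : Surely p Q) {s : State n}
    (hs : some s ∈ p.support) : Q s := by
  obtain ⟨s', hs', hq⟩ := h _ hs
  cases hs'
  exact hq

end Surely

theorem mean_pure (s : State n) (g : State n → ℝ≥0∞) : mean (PMF.pure (some s)) g = g s := by
  rw [mean, tsum_eq_single (some s)]
  · simp
  · intro o ho
    simp [PMF.pure_apply, ho]

theorem mean_andThen {p : PMF (Option (State n))} {f : State n → PMF (Option (State n))}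
    {Q : State n → Prop} (h : Surely p Q) (g : State n → ℝ≥0∞) :
    mean (andThen p f) g = mean p fun s => mean (f s) g := by
  simp only [mean, andThen, PMF.bind_apply]
  simp_rw [← ENNReal.tsum_mul_right]
  rw [ENNReal.tsum_comm]
  refine tsum_congr fun o => ?_
  simp_rw [mul_assoc, ENNReal.tsum_mul_left]
  by_cases ho : o ∈ p.support
  · obtain ⟨s, rfl, -⟩ := h o ho
    rfl
  · rw [PMF.mem_support_iff, not_not] at ho
    simp [ho]

theorem mean_map (p : PMF (Option (State n))) (f : State n → State n) (g : State n → ℝ≥0∞) :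
    mean (p.map (Option.map f)) g = mean p fun s => g (f s) := by
  simp only [mean, PMF.map, PMF.bind_apply]
  simp_rw [← ENNReal.tsum_mul_right]
  rw [ENNReal.tsum_comm]
  refine tsum_congr fun o => ?_
  rw [tsum_eq_single (o.map f)]
  · cases o <;> simp
  · intro o' ho'
    simp [PMF.pure_apply, ho']

theorem mean_uniform {k : ℕ} (f : Fin (k + 1) → State n) (g : State n → ℝ≥0∞) :
    mean ((PMF.uniformOfFintype (Fin (k + 1))).map fun x => some (f x)) g =
      (∑ x, g (f x)) / (k + 1 : ℕ) := by
  simp only [mean, PMF.map, PMF.bind_apply]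
  simp_rw [← ENNReal.tsum_mul_right]
  rw [ENNReal.tsum_comm, ENNReal.div_eq_inv_mul, tsum_fintype, Finset.mul_sum]
  refine Finset.sum_congr rfl fun x _ => ?_
  rw [tsum_eq_single (some (f x))]
  · simp
  · intro o' ho'
    simp [PMF.pure_apply, ho']

theorem mean_mono {p : PMF (Option (State n))} {g g' : State n → ℝ≥0∞}
    (h : Surely p fun s => g s ≤ g' s) : mean p g ≤ mean p g' := by
  refine ENNReal.tsum_le_tsum fun o => ?_
  by_cases ho : o ∈ p.support
  · obtain ⟨s, rfl, hs⟩ := h o ho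
    exact mul_le_mul_right hs _
  · rw [PMF.mem_support_iff, not_not] at ho
    simp [ho]

theorem mean_const {p : PMF (Option (State n))} {Q : State n → Prop} (h : Surely p Q)
    (c : ℝ≥0∞) : mean p (fun _ => c) = c := by
  calc mean p (fun _ => c) = ∑' o, p o * c := by
        refine tsum_congr fun o => ?_
        by_cases ho : o ∈ p.support
        · obtain ⟨s, rfl, hs⟩ := h o ho
          rfl
        · rw [PMF.mem_support_iff, not_not] at ho
          simp [ho]
    _ = c := by rw [ENNReal.tsum_mul_right, PMF.tsum_coe, one_mul]

theorem mean_le {p : PMF (Option (State n))} {g : State n → ℝ≥0∞} {c : ℝ≥0∞}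
    (h : Surely p fun s => g s ≤ c) : mean p g ≤ c :=
  (mean_mono h).trans_eq (mean_const h c)

theorem mean_add_mul {p : PMF (Option (State n))} {Q : State n → Prop} (h : Surely p Q)
    (g g' : State n → ℝ≥0∞) (c : ℝ≥0∞) :
    mean p (fun s => g s + c * g' s) = mean p g + c * mean p g' := by
  simp only [mean]
  rw [← ENNReal.tsum_mul_left, ← ENNReal.tsum_add]
  refine tsum_congr fun o => ?_
  by_cases ho : o ∈ p.support
  · obtain ⟨s, rfl, hs⟩ := h o ho
    simp only [Option.elim]
    ring
  · rw [PMF.mem_support_iff, not_not] at ho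
    simp [ho]

theorem expect_le_mean (p : PMF (Option (State n))) (f : State n → ℕ) :
    expect p f ≤ mean p fun s => f s := by
  refine ENNReal.tsum_le_tsum fun o => ?_
  cases o <;> simp

/-! ### Stores

The memory is divided into segments of length `Z`: the cell with address `Z * i + x`, where `x < Z`,
is the cell `x` of segment `i`. Segment `0` holds the scalar variables. -/

/-- The content of the memory: a number for every segment and every index. -/
abbrev Store := ℕ → ℕ → ℕ

/-- The memory with the given segments of length `Z`. -/
def flat (Z : ℕ) (μ : Store) : ℕ → ℕ := fun a => μ (a / Z) (a % Z)

/-- Write `y` into the cell `x` of segment `i`. -/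
def Store.set (μ : Store) (i x y : ℕ) : Store := Function.update μ i (Function.update (μ i) x y)

/-- The state with the given memory, black-box history and counters. -/
def mkState (Z : ℕ) (μ : Store) (D : List (Update n)) (t r : ℕ) : State n := ⟨flat Z μ, D, t, r⟩

theorem Store.set_same (μ : Store) (i x y : ℕ) : (μ.set i x y) i = Function.update (μ i) x y := by
  simp [Store.set]

theorem Store.set_ne (μ : Store) {i j : ℕ} (x y : ℕ) (h : j ≠ i) : (μ.set i x y) j = μ j := by
  simp [Store.set, h]

theorem flat_at {Z : ℕ} (μ : Store) (i : ℕ) {x : ℕ} (h : x < Z) : flat Z μ (Z * i + x) = μ i x := by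
  have hZ : 0 < Z := by omega
  rw [flat, Nat.mul_add_div hZ, Nat.div_eq_of_lt h, Nat.mul_add_mod, Nat.mod_eq_of_lt h, add_zero]

theorem flat_small {Z : ℕ} (μ : Store) {x : ℕ} (h : x < Z) : flat Z μ x = μ 0 x := by
  simpa using flat_at μ 0 h

theorem update_flat {Z : ℕ} (μ : Store) (i : ℕ) {x : ℕ} (y : ℕ) (h : x < Z) :
    Function.update (flat Z μ) (Z * i + x) y = flat Z (μ.set i x y) := by
  have hZ : 0 < Z := by omega
  funext a
  by_cases ha : a = Z * i + x
  · subst ha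
    rw [Function.update_self, flat_at _ _ h, Store.set_same, Function.update_self]
  · rw [Function.update_of_ne ha]
    simp only [flat]
    by_cases hi : a / Z = i
    · have hx : a % Z ≠ x := by
        rintro rfl
        exact ha (by rw [← hi, Nat.div_add_mod])
      rw [hi, Store.set_same, Function.update_of_ne hx]
    · rw [Store.set_ne _ _ _ hi]

/-- The store that a memory represents. -/
def unflat (Z : ℕ) (m : ℕ → ℕ) : Store := fun i x => m (Z * i + x)

theorem flat_unflat {Z : ℕ} (m : ℕ → ℕ) : flat Z (unflat Z m) = m := by
  funext a
  simp [flat, unflat, Nat.div_add_mod]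

/-- The value of an expression, which does not depend on the counters. -/
noncomputable def value (M : Machine n) (Z : ℕ) (D : List (Update n)) (μ : Store) (e : Expr) : ℕ :=
  e.eval M (mkState Z μ D 0 0)

section value

variable (M : Machine n) (Z : ℕ) (D : List (Update n)) (μ : Store)

theorem eval_mkState (t r : ℕ) (e : Expr) : e.eval M (mkState Z μ D t r) = value M Z D μ e := by
  unfold value
  induction e with
  | lit k => rfl
  | cell a ih => simp only [Expr.eval, ih]; rfl
  | op o a b iha ihb => simp only [Expr.eval, iha, ihb]
  | dynColor v ih => simp only [Expr.eval, ih]; rfl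

end value

theorem exec_random {M : Machine n} {G : SimpleGraph (Fin n)} {fuel N : ℕ} {a k : Expr}
    {s : State n} (hk : k.eval M s = N) : (Prog.random a k).exec M G fuel s =
      (PMF.uniformOfFintype (Fin (N + 1))).map fun y : Fin (N + 1) =>
        some ((s.write (a.eval M s) y).tick (a.size + k.size + 1)) := by
  subst hk
  simp only [Prog.exec, PMF.map]
  exact (PMF.bind_bind _ _ _).trans (congrArg _ (funext fun y => PMF.pure_bind _ _))

/-! ### Triples -/

/-- Started in the store `μ` with black-box history `D`, the program surely terminates, the final
store and history satisfy `Q`, and the elapsed time is at most `c` plus the time that the dynamic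
black box spent. -/
def Triple (M : Machine n) (G : SimpleGraph (Fin n)) (fuel Z : ℕ) (p : Prog) (μ : Store)
    (D : List (Update n)) (c : ℕ) (Q : Store → List (Update n) → Prop) : Prop :=
  ∀ t r, Surely (p.exec M G fuel (mkState Z μ D t r)) fun s => ∃ μ' D' t',
    s = mkState Z μ' D' t' r ∧ t' + M.dyn.totalTime D ≤ t + c + M.dyn.totalTime D' ∧ Q μ' D'

namespace Triple

variable {M : Machine n} {G : SimpleGraph (Fin n)} {fuel Z : ℕ} {p q : Prog} {μ : Store}
  {D : List (Update n)} {c c₁ c₂ : ℕ} {Q R : Store → List (Update n) → Prop}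

theorem mono (h : Triple M G fuel Z p μ D c₁ R) (hc : c₁ ≤ c) (hQ : ∀ μ D, R μ D → Q μ D) :
    Triple M G fuel Z p μ D c Q := fun t r =>
  (h t r).mono fun _ ⟨μ', D', t', hs, ht, hq⟩ => ⟨μ', D', t', hs, by omega, hQ _ _ hq⟩

theorem weaken (h : Triple M G fuel Z p μ D c₁ Q) (hc : c₁ ≤ c) : Triple M G fuel Z p μ D c Q :=
  h.mono hc fun _ _ => id

theorem seq (h : Triple M G fuel Z p μ D c₁ fun μ' D' => Triple M G fuel Z q μ' D' c₂ Q) :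
    Triple M G fuel Z (.seq p q) μ D (c₁ + c₂) Q := fun t r => by
  refine Surely.andThen ((h t r).mono ?_)
  rintro s ⟨μ', D', t', rfl, ht, hq⟩
  refine (hq t' r).mono ?_
  rintro s ⟨μ'', D'', t'', rfl, ht', hq'⟩
  exact ⟨μ'', D'', t'', rfl, by omega, hq'⟩

theorem seq_of (c₁ c₂ : ℕ) (h : Triple M G fuel Z p μ D c₁ R)
    (hq : ∀ μ' D', R μ' D' → Triple M G fuel Z q μ' D' c₂ Q) (hc : c₁ + c₂ ≤ c) :
    Triple M G fuel Z (.seq p q) μ D c Q :=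
  ((h.mono le_rfl hq).seq).weaken hc

theorem skip (h : Q μ D) : Triple M G fuel Z .skip μ D 1 Q := fun t _ =>
  Surely.pure ⟨μ, D, t + 1, rfl, le_rfl, h⟩

theorem assign {a e : Expr} (i x y : ℕ) (hx : x < Z) (ha : value M Z D μ a = Z * i + x)
    (he : value M Z D μ e = y) (h : Q (μ.set i x y) D) :
    Triple M G fuel Z (.assign a e) μ D (a.size + e.size + 1) Q := fun t r => by
  refine Surely.pure ⟨μ.set i x y, D, t + (a.size + e.size + 1), ?_, le_rfl, h⟩
  rw [eval_mkState, eval_mkState, ha, he]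
  simp only [State.write, State.tick, mkState, update_flat _ _ _ hx]

theorem assign_seq {a e : Expr} (c₂ i x y : ℕ) (hx : x < Z) (ha : value M Z D μ a = Z * i + x)
    (he : value M Z D μ e = y) (hc : a.size + e.size + 1 + c₂ ≤ c)
    (h : Triple M G fuel Z q (μ.set i x y) D c₂ Q) :
    Triple M G fuel Z (.seq (.assign a e) q) μ D c Q :=
  (seq (assign i x y hx ha he h)).weaken hc

theorem random {a k : Expr} (i x N : ℕ) (hx : x < Z) (ha : value M Z D μ a = Z * i + x)
    (hk : value M Z D μ k = N) (h : ∀ y ≤ N, Q (μ.set i x y) D) :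
    Triple M G fuel Z (.random a k) μ D (a.size + k.size + 1) Q := fun t r => by
  rw [exec_random (by rw [eval_mkState, hk]), eval_mkState, ha]
  refine Surely.uniform (f := fun y : Fin (N + 1) =>
    ((mkState Z μ D t r).write (Z * i + x) y).tick (a.size + k.size + 1)) fun y =>
      ⟨μ.set i x y, D, t + (a.size + k.size + 1), ?_, le_rfl, h y (Nat.lt_succ_iff.1 y.isLt)⟩
  simp only [State.write, State.tick, mkState, update_flat _ _ _ hx]

theorem mkState_tick (t r t' : ℕ) :
    (mkState Z μ D t r).tick t' = mkState Z μ D (t + t') r := rfl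

theorem ite {b : Expr} (h0 : value M Z D μ b = 0 → Triple M G fuel Z q μ D c Q)
    (h1 : value M Z D μ b ≠ 0 → Triple M G fuel Z p μ D c Q) :
    Triple M G fuel Z (.ite b p q) μ D (b.size + 1 + c) Q := fun t r => by
  rw [Prog.exec, eval_mkState, mkState_tick]
  split_ifs with hb
  · refine (h0 hb _ r).mono ?_
    rintro s ⟨μ', D', t', rfl, ht, hq⟩
    exact ⟨μ', D', t', rfl, by omega, hq⟩
  · refine (h1 hb _ r).mono ?_
    rintro s ⟨μ', D', t', rfl, ht, hq⟩
    exact ⟨μ', D', t', rfl, by omega, hq⟩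

/-- A loop whose body is executed at most `N` times, where `f j` bounds the cost of round `j`. -/
theorem loop {b : Expr} (Inv : ℕ → Store → List (Update n) → Prop) (N : ℕ) (f : ℕ → ℕ)
    (h0 : Inv 0 μ D) (hN : N < fuel)
    (hstep : ∀ j ≤ N, ∀ μ D, Inv j μ D → (value M Z D μ b = 0 → Q μ D) ∧
      (value M Z D μ b ≠ 0 → j < N ∧ Triple M G fuel Z p μ D (f j) (Inv (j + 1)))) :
    Triple M G fuel Z (.loop b p) μ D
      (∑ j ∈ Finset.range N, f j + (N + 1) * (b.size + 1)) Q := by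
  have key : ∀ (k fuel' j : ℕ), N - j = k → j ≤ N → k < fuel' → ∀ μ D, Inv j μ D → ∀ t r,
      Surely (whileLoop M b (p.exec M G fuel) fuel' (mkState Z μ D t r)) fun s => ∃ μ' D' t',
        s = mkState Z μ' D' t' r ∧ t' + M.dyn.totalTime D ≤
          t + (∑ i ∈ Finset.Ico j N, f i + (k + 1) * (b.size + 1)) + M.dyn.totalTime D' ∧
          Q μ' D' := by
    intro k
    induction k with
    | zero =>
      intro fuel' j hk hj hf μ D hI t r
      obtain ⟨fuel', rfl⟩ : ∃ m, fuel' = m + 1 := ⟨fuel' - 1, by omega⟩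
      obtain ⟨hz, hnz⟩ := hstep j hj μ D hI
      rw [whileLoop, eval_mkState]
      have hb : value M Z D μ b = 0 := by
        by_contra hb
        have := (hnz hb).1
        omega
      rw [if_pos hb, mkState_tick]
      exact Surely.pure ⟨μ, D, _, rfl, by omega, hz hb⟩
    | succ k ih =>
      intro fuel' j hk hj hf μ D hI t r
      obtain ⟨fuel', rfl⟩ : ∃ m, fuel' = m + 1 := ⟨fuel' - 1, by omega⟩
      obtain ⟨hz, hnz⟩ := hstep j hj μ D hI
      rw [whileLoop, eval_mkState, mkState_tick]
      split_ifs with hb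
      · exact Surely.pure ⟨μ, D, _, rfl, by
          have := Nat.le_mul_of_pos_left (b.size + 1) (Nat.succ_pos (k + 1))
          simp only [Nat.succ_eq_add_one] at this
          omega, hz hb⟩
      · refine Surely.andThen (((hnz hb).2 _ r).mono ?_)
        rintro s ⟨μ', D', t', rfl, ht, hq⟩
        refine (ih fuel' (j + 1) (by omega) (by omega) (by omega) μ' D' hq t' r).mono ?_
        rintro s ⟨μ'', D'', t'', rfl, ht', hq'⟩
        refine ⟨μ'', D'', t'', rfl, ?_, hq'⟩
        rw [Finset.sum_eq_sum_Ico_succ_bot (by omega : j < N)]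
        have : (k + 1 + 1) * (b.size + 1) = (k + 1) * (b.size + 1) + (b.size + 1) := by ring
        omega
  intro t r
  have := key N fuel 0 (by omega) (by omega) hN μ D h0 t r
  rwa [← Finset.range_eq_Ico] at this

/-- A counting loop over `j = 0, …, N - 1` with rounds of cost at most `c`. -/
theorem loop_const {b : Expr} (Inv : ℕ → Store → List (Update n) → Prop) (N c : ℕ)
    (h0 : Inv 0 μ D) (hN : N < fuel)
    (hstep : ∀ j ≤ N, ∀ μ D, Inv j μ D → (value M Z D μ b = 0 → Q μ D) ∧
      (value M Z D μ b ≠ 0 → j < N ∧ Triple M G fuel Z p μ D c (Inv (j + 1)))) :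
    Triple M G fuel Z (.loop b p) μ D (N * c + (N + 1) * (b.size + 1)) Q := by
  simpa using loop Inv N (fun _ => c) h0 hN hstep

theorem callInsert {a b : Expr} {u v : Fin n} (ha : value M Z D μ a = u)
    (hb : value M Z D μ b = v) (h : Q μ (.insert u v :: D)) :
    Triple M G fuel Z (.callInsert a b) μ D (a.size + b.size + 1) Q := fun t r => by
  refine Surely.pure ⟨μ, .insert u v :: D,
    t + M.dyn.time (.insert u v :: D) + (a.size + b.size + 1), ?_, ?_, h⟩
  · rw [eval_mkState, eval_mkState, ha, hb, State.callDynamic, dif_pos ⟨u.isLt, v.isLt⟩]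
    rfl
  · simp only [DynamicAlgorithm.totalTime]; omega

theorem callDelete {a b : Expr} {u v : Fin n} (ha : value M Z D μ a = u)
    (hb : value M Z D μ b = v) (h : Q μ (.delete u v :: D)) :
    Triple M G fuel Z (.callDelete a b) μ D (a.size + b.size + 1) Q := fun t r => by
  refine Surely.pure ⟨μ, .delete u v :: D,
    t + M.dyn.time (.delete u v :: D) + (a.size + b.size + 1), ?_, ?_, h⟩
  · rw [eval_mkState, eval_mkState, ha, hb, State.callDynamic, dif_pos ⟨u.isLt, v.isLt⟩]
    rfl
  · simp only [DynamicAlgorithm.totalTime]; omega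

/-- A call of the static black box on a list `L` of vertices that is stored in segment `i` from
index `x` on; the result is put at the beginning of segment `j`. -/
theorem callStatic {src len dst : Expr} (i j x : ℕ) (L : List (Fin n))
    (hsrc : value M Z D μ src = Z * i + x) (hlen : value M Z D μ len = L.length)
    (hdst : value M Z D μ dst = Z * j) (hx : x + L.length ≤ Z)
    (hL : ∀ k (hk : k < L.length), μ i (x + k) = L[k])
    (h : ∀ μ' : Store, (∀ i ≠ j, μ' i = μ i) →
      (∀ k (hk : k < L.length), μ' j k = M.static G L.toFinset L[k] % M.W) → Q μ' D) :
    Triple M G fuel Z (.callStatic src len dst) μ D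
      (M.T L.length + (src.size + len.size + dst.size + 1)) Q := fun t r => by
  have hmem : ∀ k (hk : k < L.length), flat Z μ (Z * i + x + k) = L[k] := by
    intro k hk
    rw [add_assoc, flat_at _ _ (by omega), hL k hk]
  have hS : (Finset.univ.filter fun v : Fin n =>
      ∃ k < L.length, flat Z μ (Z * i + x + k) = v) = L.toFinset := by
    ext v
    simp only [Finset.mem_filter, Finset.mem_univ, true_and, List.mem_toFinset]
    constructor
    · rintro ⟨k, hk, hv⟩
      rw [hmem k hk] at hv
      rw [← Fin.ext hv]
      exact List.getElem_mem hk
    · intro hv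
      obtain ⟨k, hk, rfl⟩ := List.getElem_of_mem hv
      exact ⟨k, hk, hmem k hk⟩
  let μ' : Store := fun i' x' => if h : i' = j ∧ x' < L.length then
    M.static G L.toFinset (L[x']'h.2) % M.W else μ i' x'
  refine Surely.pure ⟨μ', D, t + M.T L.length + (src.size + len.size + dst.size + 1), ?_,
    by omega, h μ' ?_ ?_⟩
  · rw [eval_mkState, eval_mkState, eval_mkState, hsrc, hlen, hdst]
    simp only [State.callStatic, State.tick, mkState]
    congr 1
    funext a
    rcases Nat.eq_zero_or_pos L.length with h0 | h0
    · simp only [flat, μ', h0]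
      rw [if_neg (by omega), dif_neg (by omega)]
    have hZ : 0 < Z := by omega
    by_cases ha : Z * j ≤ a ∧ a < Z * j + L.length
    · obtain ⟨k, rfl⟩ : ∃ k, a = Z * j + k := ⟨a - Z * j, by omega⟩
      have hk : k < L.length := by omega
      have hk' : Z * j + k - Z * j = k := by omega
      rw [if_pos ha, flat_at _ _ (by omega)]
      simp only [hk', hmem k hk, μ']
      rw [dif_pos (L[k]).isLt, dif_pos ⟨trivial, hk⟩]
      congr 2
    · rw [if_neg ha]
      simp only [flat, μ']
      rw [dif_neg]
      rintro ⟨rfl, h2⟩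
      have := Nat.div_add_mod a Z
      omega
  · intro i' hi'
    funext x'
    simp [μ', hi']
  · intro k hk
    simp [μ', hk]

end Triple

section

/-! ### Programs: notation -/

instance : Add Expr := ⟨.op .add⟩
instance : Sub Expr := ⟨.op .sub⟩
instance : Mul Expr := ⟨.op .mul⟩
instance : Div Expr := ⟨.op .div⟩

/-- The test `a < b`. -/
abbrev less (a b : Expr) : Expr := .op .lt a b

/-- The scalar variable `k`, which is stored in cell `k`. -/
abbrev reg (k : ℕ) : Expr := .cell (.lit k)

/-- The address of the cell `e` of segment `i`; scalar variable `7` holds the length of segments. -/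
abbrev slot (i : ℕ) (e : Expr) : Expr := reg 7 * .lit i + e

/-- The content of the cell `e` of segment `i`. -/
abbrev item (i : ℕ) (e : Expr) : Expr := .cell (slot i e)

infixr:30 " ;; " => Prog.seq
infix:50 " ::= " => Prog.assign

section value

variable (M : Machine n) (Z : ℕ) (D : List (Update n)) (μ : Store)

@[simp] theorem value_lit (k : ℕ) : value M Z D μ (.lit k) = k % M.W := rfl
@[simp] theorem value_cell (a : Expr) :
    value M Z D μ (.cell a) = flat Z μ (value M Z D μ a) := rfl
@[simp] theorem value_add (a b : Expr) :
    value M Z D μ (a + b) = (value M Z D μ a + value M Z D μ b) % M.W := rfl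
@[simp] theorem value_sub (a b : Expr) :
    value M Z D μ (a - b) = value M Z D μ a - value M Z D μ b := rfl
@[simp] theorem value_mul (a b : Expr) :
    value M Z D μ (a * b) = (value M Z D μ a * value M Z D μ b) % M.W := rfl
@[simp] theorem value_div (a b : Expr) :
    value M Z D μ (a / b) = value M Z D μ a / value M Z D μ b := rfl
@[simp] theorem value_less (a b : Expr) : value M Z D μ (.op .lt a b) =
    if value M Z D μ a < value M Z D μ b then 1 else 0 := rfl

end value

attribute [simp] Store.set_same Store.set_ne flat_at flat_small

@[simp] theorem size_lit (k : ℕ) : (Expr.lit k).size = 1 := rfl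
@[simp] theorem size_cell (a : Expr) : (Expr.cell a).size = a.size + 1 := rfl
@[simp] theorem size_add (a b : Expr) : (a + b).size = a.size + b.size + 1 := rfl
@[simp] theorem size_sub (a b : Expr) : (a - b).size = a.size + b.size + 1 := rfl
@[simp] theorem size_mul (a b : Expr) : (a * b).size = a.size + b.size + 1 := rfl
@[simp] theorem size_div (a b : Expr) : (a / b).size = a.size + b.size + 1 := rfl
@[simp] theorem size_less (a b : Expr) : (Expr.op .lt a b).size = a.size + b.size + 1 := rfl

/-! ### Representing layers in the memory

The parameters `n`, `C` and `K = ⌊log n / β⌋` are in the scalar variables `3`, `4` and `5`; the length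
of segments, `⌊log n⌋`, `2 ^ ⌊log n⌋` and the height of the stack are in `7`, `8`, `9` and `10`. Segments
`1`, `2`, `4`, `5`, `6` and `7` hold levels, static colors, numbers of recent insertions, lists of recent
partners (`K` cells for each vertex), the stack and the heights `start k`. Segment `3` is for random
colors, `8` for the answers of the static black box; `9` and `10` are auxiliary. -/

/-- The length of memory segments, which leaves room for every one of them. -/
def segLen (n K : ℕ) : ℕ := (n + K + 16) * (n + K + 16)

/-- Words are large enough for the addresses in use, and the fuel for every loop. -/
structure Fits (M : Machine n) (K fuel : ℕ) : Prop where
  two_le : 2 ≤ n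
  K_pos : 0 < K
  le_W : 16 * segLen n K ≤ M.W
  le_fuel : segLen n K ≤ fuel

theorem segLen_ge (n K : ℕ) : 256 + 32 * n + 32 * K + n * n + n * K + K * K ≤ segLen n K := by
  unfold segLen; nlinarith

theorem pair_lt_segLen {K i : ℕ} (v : Fin n) (hi : i < K) : (v : ℕ) * K + i < segLen n K := by
  have h1 := segLen_ge n K
  have h2 : ((v : ℕ) + 1) * K ≤ n * K := Nat.mul_le_mul_right _ v.isLt
  have h3 : ((v : ℕ) + 1) * K = v * K + K := by ring
  omega

theorem edge_lt_segLen {K : ℕ} (v w : Fin n) : (v : ℕ) * n + w < segLen n K := by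
  have h1 := segLen_ge n K
  have h2 : ((v : ℕ) + 1) * n ≤ n * n := Nat.mul_le_mul_right _ v.isLt
  have h3 : ((v : ℕ) + 1) * n = v * n + n := by ring
  have := w.isLt
  omega

/-- The store `μ` represents the layers `σ`. The last two conditions keep the lists inside their
segments. -/
structure Core (C K : ℕ) (σ : Layers n) (μ : Store) : Prop where
  n_eq : μ 0 3 = n
  C_eq : μ 0 4 = C
  K_eq : μ 0 5 = K
  Z_eq : μ 0 7 = segLen n K
  I_eq : μ 0 8 = Nat.log 2 n
  P_eq : μ 0 9 = 2 ^ Nat.log 2 n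
  top_eq : μ 0 10 = σ.stack.length
  level_eq : ∀ v : Fin n, μ 1 v = σ.level v
  base_eq : ∀ v : Fin n, μ 2 v = σ.base v
  count_eq : ∀ v : Fin n, μ 4 v = (σ.recent v).length
  recent_eq : ∀ (v : Fin n) (i : ℕ) (h : i < (σ.recent v).length),
    μ 5 (v * K + i) = ((σ.recent v)[i] : Fin n)
  stack_eq : ∀ (i : ℕ) (h : i < σ.stack.length), μ 6 i = (σ.stack[i] : Fin n)
  start_eq : ∀ j ≤ Nat.log 2 n, μ 7 j = σ.start j
  recent_le : ∀ v, (σ.recent v).length ≤ K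
  stack_le : σ.stack.length ≤ n * n + 2

/-- The first three variables, the variables above `10` and the segments `3` and `8, 9, …` are not part
of the representation. -/
theorem Core.set {C K : ℕ} {σ : Layers n} {μ : Store} (h : Core C K σ μ) {i x : ℕ} (y : ℕ)
    (hi : (i = 0 ∧ (x < 3 ∨ 10 < x)) ∨ i = 3 ∨ 7 < i) : Core C K σ (μ.set i x y) := by
  have h0 : ∀ z, 3 ≤ z → z ≤ 10 → (μ.set i x y) 0 z = μ 0 z := by
    intro z hz hz'
    rcases hi with ⟨rfl, hx⟩ | hi
    · rw [Store.set_same, Function.update_of_ne (by omega)]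
    · rw [Store.set_ne _ _ _ (by omega)]
  have hs : ∀ j, 1 ≤ j → j ≤ 7 → j ≠ 3 → (μ.set i x y) j = μ j := by
    intro j hj hj' hj3
    exact Store.set_ne _ _ _ (by omega)
  constructor
  · rw [h0 3 (by omega) (by omega), h.n_eq]
  · rw [h0 4 (by omega) (by omega), h.C_eq]
  · rw [h0 5 (by omega) (by omega), h.K_eq]
  · rw [h0 7 (by omega) (by omega), h.Z_eq]
  · rw [h0 8 (by omega) (by omega), h.I_eq]
  · rw [h0 9 (by omega) (by omega), h.P_eq]
  · rw [h0 10 (by omega) (by omega), h.top_eq]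
  · rw [hs 1 (by omega) (by omega) (by omega)]; exact h.level_eq
  · rw [hs 2 (by omega) (by omega) (by omega)]; exact h.base_eq
  · rw [hs 4 (by omega) (by omega) (by omega)]; exact h.count_eq
  · rw [hs 5 (by omega) (by omega) (by omega)]; exact h.recent_eq
  · rw [hs 6 (by omega) (by omega) (by omega)]; exact h.stack_eq
  · rw [hs 7 (by omega) (by omega) (by omega)]; exact h.start_eq
  · exact h.recent_le
  · exact h.stack_le

/-- Search the level to be rebuilt: variable `11` becomes the level, `12` its power of two. -/
def seekCode : Prog :=
  .lit 11 ::= reg 8 ;; .lit 12 ::= reg 9 ;;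
  .loop (reg 11 * less (reg 3 / reg 12) (reg 10 - item 7 (reg 11)))
    (.lit 11 ::= reg 11 - .lit 1 ;; .lit 12 ::= reg 12 / .lit 2)

variable {M : Machine n} {G : SimpleGraph (Fin n)} {C K fuel : ℕ}

/-- The search starts at the finest level, so that it is paid for by the rebuild that follows. -/
theorem seekCode_spec (hF : Fits M K fuel) {σ : Layers n} {μ : Store} {D : List (Update n)}
    (hc : Core C K σ μ) : Triple M G fuel (segLen n K) seekCode μ D
      (100 * (Nat.log 2 n - σ.target + 1)) fun μ' D' => Core C K σ μ' ∧ μ' 0 11 = σ.target ∧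
        (∀ i ≠ 0, μ' i = μ i) ∧ D' = D := by
  have hZ := segLen_ge n K
  have hW := hF.le_W
  have hlog : Nat.log 2 n ≤ n := (Nat.log_lt_self 2 (by have := hF.two_le; omega)).le
  have hpow : 2 ^ Nat.log 2 n ≤ n := Nat.pow_log_le_self 2 (by have := hF.two_le; omega)
  have htop := hc.stack_le
  have htar := σ.target_le
  refine Triple.weaken (Triple.seq (Triple.assign 0 11 (Nat.log 2 n) (by omega)
    (by simp (disch := omega) [Nat.mod_eq_of_lt])
    (by simp (disch := omega) [Nat.mod_eq_of_lt, hc.I_eq]) (Triple.seq (Triple.assign 0 12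
    (2 ^ Nat.log 2 n) (by omega) (by simp (disch := omega) [Nat.mod_eq_of_lt])
    (by simp (disch := omega) [Nat.mod_eq_of_lt, hc.P_eq])
    (Triple.loop_const (fun j μ' D' => j ≤ Nat.log 2 n - σ.target ∧ Core C K σ μ' ∧
      σ.room (Nat.log 2 n - j) = σ.target ∧ μ' 0 11 = Nat.log 2 n - j ∧
      μ' 0 12 = 2 ^ (Nat.log 2 n - j) ∧ (∀ i ≠ 0, μ' i = μ i) ∧ D' = D)
      (Nat.log 2 n - σ.target) 50 ?_ ?_ ?_))))) ?_
  · refine ⟨Nat.zero_le _, (hc.set _ (by omega)).set _ (by omega), rfl, ?_, ?_, ?_, rfl⟩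
    · simp
    · simp
    · intro i hi
      simp (disch := omega)
  · have := hF.le_fuel
    omega
  · rintro j hj μ' D' ⟨hj', hc', hroom, h11, h12, hseg, rfl⟩
    have hst := hc'.start_eq (Nat.log 2 n - j) (Nat.sub_le _ _)
    have hpow' : 2 ^ (Nat.log 2 n - j) ≤ n :=
      (Nat.pow_le_pow_right (by norm_num) (Nat.sub_le _ _)).trans hpow
    have hv : value M (segLen n K) D' μ'
        (reg 11 * less (reg 3 / reg 12) (reg 10 - item 7 (reg 11))) =
        if n / 2 ^ (Nat.log 2 n - j) < σ.stack.length - σ.start (Nat.log 2 n - j)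
        then Nat.log 2 n - j else 0 := by
      simp (disch := omega) [Nat.mod_eq_of_lt, hc'.n_eq, hc'.Z_eq, h11, h12, hst, hc'.top_eq]
      split_ifs
      · exact Nat.mod_eq_of_lt (by omega)
      · exact Nat.zero_mod _
    rw [hv]
    obtain ⟨m, hm⟩ : ∃ m, m = Nat.log 2 n - j := ⟨_, rfl⟩
    rw [← hm] at hroom hst h11 h12 ⊢
    cases m with
    | zero =>
      simp only [Layers.room] at hroom
      refine ⟨fun _ => ⟨hc', by omega, hseg, rfl⟩, fun h => absurd ?_ h⟩
      simp
    | succ m =>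
      simp only [Layers.room] at hroom
      split_ifs at hroom ⊢ with hfull
      · refine ⟨fun h => False.elim (by omega), fun _ => ?_⟩
        have hle := σ.room_le m
        refine ⟨by omega, ?_⟩
        refine Triple.weaken (Triple.seq (Triple.assign 0 11 m (by omega)
          (by simp (disch := omega) [Nat.mod_eq_of_lt])
          (by simp (disch := omega) [Nat.mod_eq_of_lt, h11]) (Triple.assign 0 12 (2 ^ m) (by omega)
          (by simp (disch := omega) [Nat.mod_eq_of_lt])
          (by simp (disch := omega) [Nat.mod_eq_of_lt, h12, pow_succ]) ?_))) ?_
        · refine ⟨by omega, (hc'.set _ (by omega)).set _ (by omega), ?_, ?_, ?_, ?_, rfl⟩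
          · rw [show Nat.log 2 n - (j + 1) = m by omega, hroom]
          · simp; omega
          · simp [show Nat.log 2 n - (j + 1) = m by omega]
          · intro i hi
            simp (disch := omega) [hseg]
        · simp
      · refine ⟨fun _ => ⟨hc', by omega, hseg, rfl⟩, fun h => absurd rfl h⟩
  · simp
    omega

/-- The store is ready for moving the vertices of the list `L` to level `k`, with new static colors
`f`. -/
structure Ready (C K : ℕ) (σ : Layers n) (k : ℕ) (L : List (Fin n)) (f : Fin n → ℕ) (μ : Store) :
    Prop extends Core C K σ μ where
  part_eq : σ.part k = L
  le_log : k ≤ Nat.log 2 n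
  start_le : σ.start k ≤ σ.stack.length
  level_var : μ 0 11 = k
  length_var : μ 0 15 = L.length
  start_var : μ 0 18 = σ.start k
  color_eq : ∀ (j : ℕ) (h : j < L.length), μ 8 j = f L[j]

theorem Ready.length_eq {σ : Layers n} {k : ℕ} {L : List (Fin n)} {f : Fin n → ℕ} {μ : Store}
    (h : Ready C K σ k L f μ) : σ.stack.length = σ.start k + L.length := by
  have h1 := congrArg List.length h.part_eq
  have h2 := h.start_le
  simp only [Layers.part, List.length_drop] at h1
  omega

theorem Ready.stack_at {σ : Layers n} {k : ℕ} {L : List (Fin n)} {f : Fin n → ℕ} {μ : Store}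
    (h : Ready C K σ k L f μ) {j : ℕ} (hj : j < L.length) : μ 6 (σ.start k + j) = L[j] := by
  have h1 := h.length_eq
  rw [h.stack_eq _ (by omega)]
  simp [← h.part_eq, Layers.part]

theorem Ready.set {σ : Layers n} {k : ℕ} {L : List (Fin n)} {f : Fin n → ℕ} {μ : Store}
    (h : Ready C K σ k L f μ) {i x : ℕ} (y : ℕ)
    (hi : (i = 0 ∧ (x < 3 ∨ 10 < x ∧ x ≠ 11 ∧ x ≠ 15 ∧ x ≠ 18)) ∨ i = 3 ∨ 8 < i) :
    Ready C K σ k L f (μ.set i x y) := by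
  have h0 : ∀ z, z = 11 ∨ z = 15 ∨ z = 18 → (μ.set i x y) 0 z = μ 0 z := by
    intro z hz
    rcases hi with ⟨rfl, hx⟩ | hi
    · rw [Store.set_same, Function.update_of_ne (by omega)]
    · rw [Store.set_ne _ _ _ (by omega)]
  refine { h.toCore.set y (by omega) with
    part_eq := h.part_eq
    le_log := h.le_log
    start_le := h.start_le
    level_var := by rw [h0 11 (by omega), h.level_var]
    length_var := by rw [h0 15 (by omega), h.length_var]
    start_var := by rw [h0 18 (by omega), h.start_var]
    color_eq := ?_ }
  rw [Store.set_ne _ _ _ (by omega)]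
  exact h.color_eq

/-- Choose the level to be rebuilt and compute the new static colors: variable `18` becomes the
position in the stack of the vertices that move, and variable `15` their number. -/
def prepareCode : Prog :=
  seekCode ;;
  .ite (reg 11) .skip (.lit 10 ::= reg 3) ;;
  .lit 18 ::= item 7 (reg 11) ;;
  .lit 15 ::= reg 10 - reg 18 ;;
  .callStatic (slot 6 (reg 18)) (reg 15) (slot 8 (.lit 0))

theorem prepareCode_spec (hF : Fits M K fuel) {σ : Layers n} {μ : Store} {D : List (Update n)}
    (hc : Core C K σ μ) (hv : σ.Valid K) (hlt : ∀ S v, v ∈ S → M.static G S v < M.W) :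
    Triple M G fuel (segLen n K) prepareCode μ D
      (100 * (Nat.log 2 n - σ.target + 1) + 100 + M.T σ.moving.length) fun μ' D' =>
        Ready C K (σ.restrict σ.target) σ.target σ.moving (M.static G σ.moving.toFinset) μ' ∧
          μ' 3 = μ 3 ∧ μ' 9 = μ 9 ∧ D' = D := by
  have hZ := segLen_ge n K
  have hW := hF.le_W
  have hlog : Nat.log 2 n ≤ n := (Nat.log_lt_self 2 (by have := hF.two_le; omega)).le
  have htop := hc.stack_le
  have htar := σ.target_le
  have hn := hv.n_le
  refine Triple.seq_of _ (100 + M.T σ.moving.length) (seekCode_spec hF hc) ?_ (by omega)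
  · rintro μ₁ D' ⟨hc₁, h11, hseg, rfl⟩
    refine Triple.seq_of _ (70 + M.T σ.moving.length) (R := fun μ₂ D₂ =>
      Core C K (σ.restrict σ.target) μ₂ ∧ μ₂ 0 11 = σ.target ∧ (∀ i ≠ 0, μ₂ i = μ i) ∧ D₂ = D')
      (Triple.ite (c := 10) ?_ ?_) ?_ (by simp; omega)
    · intro h0
      have h0 : σ.target = 0 := by
        simpa (disch := omega) [Nat.mod_eq_of_lt, h11] using h0
      refine Triple.weaken (Triple.assign 0 10 n (by omega)
        (by simp (disch := omega) [Nat.mod_eq_of_lt])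
        (by simp (disch := omega) [Nat.mod_eq_of_lt, hc₁.n_eq]) ?_) (by simp)
      refine ⟨?_, by simp [h11], fun i hi => by simp (disch := omega) [hseg], rfl⟩
      have hlen : (σ.stack.take n).length = n := by simp [hn]
      rw [h0, Layers.restrict, if_pos rfl]
      constructor
      · simp [hc₁.n_eq]
      · simp [hc₁.C_eq]
      · simp [hc₁.K_eq]
      · simp [hc₁.Z_eq]
      · simp [hc₁.I_eq]
      · simp [hc₁.P_eq]
      · simp [hn]
      · simpa using hc₁.level_eq
      · simpa using hc₁.base_eq
      · simpa using hc₁.count_eq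
      · simpa using hc₁.recent_eq
      · intro i hi
        have hi' : i < σ.stack.length := by
          rw [hlen] at hi; omega
        simpa using hc₁.stack_eq i hi'
      · simpa using hc₁.start_eq
      · exact hc₁.recent_le
      · show (σ.stack.take n).length ≤ _
        omega
    · intro h0
      have h0 : σ.target ≠ 0 := by
        simpa (disch := omega) [Nat.mod_eq_of_lt, h11] using h0
      refine Triple.weaken (Triple.skip ?_) (by norm_num)
      rw [Layers.restrict, if_neg h0]
      exact ⟨hc₁, h11, hseg, rfl⟩
    · rintro μ₂ D₂ ⟨hc₂, h11₂, hseg₂, rfl⟩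
      have hst := hc₂.start_eq _ htar
      rw [Layers.restrict_start] at hst
      have hle := hv.start_le_restrict (le_refl _)
      have htop₂ := hc₂.stack_le
      have hlen : σ.moving.length = (σ.restrict σ.target).stack.length - σ.start σ.target := by
        simp [Layers.moving, Layers.part]
      have hcolor : ∀ v ∈ σ.moving.toFinset, M.static G σ.moving.toFinset v < M.W :=
        fun v hv => hlt _ v hv
      refine Triple.assign_seq (50 + M.T σ.moving.length) 0 18 (σ.start σ.target) (by omega)
        (by simp (disch := omega) [Nat.mod_eq_of_lt])
        (by simp (disch := omega) [Nat.mod_eq_of_lt, hc₂.Z_eq, h11₂, hst]) (by simp; omega) ?_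
      refine Triple.assign_seq (30 + M.T σ.moving.length) 0 15 σ.moving.length (by omega)
        (by simp (disch := omega) [Nat.mod_eq_of_lt])
        (by simp (disch := omega) [Nat.mod_eq_of_lt, hc₂.top_eq, hlen]) (by simp; omega) ?_
      refine Triple.weaken (Triple.callStatic 6 8 (σ.start σ.target) σ.moving ?_ ?_ ?_ ?_ ?_ ?_)
        (by simp; omega)
      · simp (disch := omega) [Nat.mod_eq_of_lt, hc₂.Z_eq]
      · simp (disch := omega) [Nat.mod_eq_of_lt]
      · simp (disch := omega) [Nat.mod_eq_of_lt, hc₂.Z_eq]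
      · omega
      · intro j hj
        simp (disch := omega)
        rw [hc₂.stack_eq _ (by omega)]
        simp [Layers.moving, Layers.part]
      · intro μ₃ hne h8
        refine ⟨?_, ?_, ?_, rfl⟩
        · have e0 := hne 0 (by omega)
          have e1 := hne 1 (by omega)
          have e2 := hne 2 (by omega)
          have e4 := hne 4 (by omega)
          have e5 := hne 5 (by omega)
          have e6 := hne 6 (by omega)
          have e7 := hne 7 (by omega)
          constructor
          · constructor
            · simp [e0, hc₂.n_eq]
            · simp [e0, hc₂.C_eq]
            · simp [e0, hc₂.K_eq]
            · simp [e0, hc₂.Z_eq]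
            · simp [e0, hc₂.I_eq]
            · simp [e0, hc₂.P_eq]
            · simp [e0, hc₂.top_eq]
            · simpa [e1] using hc₂.level_eq
            · simpa [e2] using hc₂.base_eq
            · simpa [e4] using hc₂.count_eq
            · simpa [e5] using hc₂.recent_eq
            · simpa [e6] using hc₂.stack_eq
            · simpa [e7] using hc₂.start_eq
            · exact hc₂.recent_le
            · exact hc₂.stack_le
          · rfl
          · exact htar
          · simpa using hle
          · simp [e0, h11₂]
          · simp [e0]
          · simp [e0]
          · intro j hj
            rw [h8 j hj]
            exact Nat.mod_eq_of_lt (hcolor _ (by simp))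
        · rw [hne 3 (by omega)]
          simp (disch := omega) [hseg₂]
        · rw [hne 9 (by omega)]
          simp (disch := omega) [hseg₂]

end

section

/-! ### Moving and pushing vertices -/

/-- Give the vertices of a list the level `k` and static colors `f`. -/
def Layers.place (σ : Layers n) (L : List (Fin n)) (k : ℕ) (f : Fin n → ℕ) : Layers n :=
  { σ with
    level := fun x => if x ∈ L then k else σ.level x
    base := fun x => if x ∈ L then f x else σ.base x
    recent := fun x => if x ∈ L then [] else σ.recent x }

/-- Give a vertex the level `k` and the static color `b`. -/
def Layers.put (σ : Layers n) (x : Fin n) (k b : ℕ) : Layers n :=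
  { σ with
    level := Function.update σ.level x k
    base := Function.update σ.base x b
    recent := Function.update σ.recent x [] }

theorem Layers.place_nil (σ : Layers n) (k : ℕ) (f : Fin n → ℕ) : σ.place [] k f = σ := by
  simp [Layers.place]

theorem Layers.place_append (σ : Layers n) (L : List (Fin n)) (x : Fin n) (k : ℕ)
    (f : Fin n → ℕ) : σ.place (L ++ [x]) k f = (σ.place L k f).put x k (f x) := by
  simp only [Layers.place, Layers.put, Layers.mk.injEq, and_true]
  refine ⟨?_, ?_, ?_⟩ <;> funext y <;> by_cases hy : y = x <;> simp [hy]

variable {M : Machine n} {G : SimpleGraph (Fin n)} {C K fuel : ℕ}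

theorem Core.put {σ : Layers n} {μ : Store} (h : Core C K σ μ) (x : Fin n) (k b : ℕ) :
    Core C K (σ.put x k b) (((μ.set 1 x k).set 2 x b).set 4 x 0) := by
  have hx : ∀ v : Fin n, (v : ℕ) = x ↔ v = x := fun v => Fin.ext_iff.symm
  constructor
  · simp [h.n_eq]
  · simp [h.C_eq]
  · simp [h.K_eq]
  · simp [h.Z_eq]
  · simp [h.I_eq]
  · simp [h.P_eq]
  · simp [h.top_eq, Layers.put]
  · intro v
    simp [Layers.put, Function.update_apply, hx, h.level_eq]
  · intro v
    simp [Layers.put, Function.update_apply, hx, h.base_eq]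
  · intro v
    by_cases hv : v = x
    · simp [Layers.put, hv]
    · simp [Layers.put, hx, hv, h.count_eq]
  · intro v i hi
    by_cases hv : v = x
    · simp [Layers.put, hv] at hi
    · have hi' : i < (σ.recent v).length := by simpa [Layers.put, hv] using hi
      simp [Layers.put, hv, h.recent_eq v i hi']
  · intro i hi
    have hi' : i < σ.stack.length := hi
    simp [Layers.put, h.stack_eq i hi']
  · intro j hj
    simp [Layers.put, h.start_eq j hj]
  · intro v
    by_cases hv : v = x
    · simp [Layers.put, hv]
    · simpa [Layers.put, hv] using h.recent_le v
  · exact h.stack_le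

/-- Move the vertices to the chosen level. -/
def commitCode : Prog :=
  .lit 13 ::= .lit 0 ;;
  .loop (less (reg 13) (reg 15))
    (.lit 16 ::= item 6 (reg 18 + reg 13) ;;
      slot 1 (reg 16) ::= reg 11 ;;
      slot 2 (reg 16) ::= item 8 (reg 13) ;;
      slot 4 (reg 16) ::= .lit 0 ;;
      .lit 13 ::= reg 13 + .lit 1) ;;
  .lit 13 ::= reg 11 + .lit 1 ;;
  .loop (less (reg 13) (reg 8 + .lit 1))
    (slot 7 (reg 13) ::= reg 10 ;; .lit 13 ::= reg 13 + .lit 1)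

theorem commitCode_spec (hF : Fits M K fuel) {σ : Layers n} {k : ℕ} {L : List (Fin n)}
    {f : Fin n → ℕ} {μ : Store} {D : List (Update n)} (hr : Ready C K σ k L f μ) :
    Triple M G fuel (segLen n K) commitCode μ D
      (100 * L.length + 100 * (Nat.log 2 n - k) + 100) fun μ' D' =>
        Core C K (σ.move k f) μ' ∧ μ' 3 = μ 3 ∧ μ' 9 = μ 9 ∧ D' = D := by
  have hZ := segLen_ge n K
  have hW := hF.le_W
  have hfuel := hF.le_fuel
  have hlog : Nat.log 2 n ≤ n := (Nat.log_lt_self 2 (by have := hF.two_le; omega)).le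
  have htop := hr.stack_le
  have hlen := hr.length_eq
  have hk := hr.le_log
  refine Triple.assign_seq (100 * L.length + 100 * (Nat.log 2 n - k) + 80) 0 13 0 (by omega)
    (by simp (disch := omega) [Nat.mod_eq_of_lt]) (by simp) (by simp; omega) ?_
  refine Triple.seq_of (80 * L.length + 20) (60 * (Nat.log 2 n - k) + 50)
    (R := fun μ' D' => Core C K (σ.place L k f) μ' ∧ μ' 0 11 = k ∧ μ' 3 = μ 3 ∧ μ' 9 = μ 9 ∧
      D' = D) ?_ ?_ (by omega)
  · refine Triple.weaken (Triple.loop_const (fun j μ' D' => Core C K (σ.place (L.take j) k f) μ' ∧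
      μ' 0 11 = k ∧ μ' 0 13 = j ∧ μ' 0 15 = L.length ∧ μ' 0 18 = σ.start k ∧ μ' 8 = μ 8 ∧
      μ' 3 = μ 3 ∧ μ' 9 = μ 9 ∧ D' = D) L.length 70 ?_ ?_ ?_) ?_
    · refine ⟨?_, ?_, ?_, ?_, ?_, ?_, ?_, ?_, rfl⟩
      · rw [List.take_zero, Layers.place_nil]
        exact hr.toCore.set _ (by omega)
      · simp [hr.level_var]
      · simp
      · simp [hr.length_var]
      · simp [hr.start_var]
      · simp
      · simp
      · simp
    · omega
    · rintro j hj μ' D' ⟨hc, h11, h13, h15, h18, h8, h3, h9, rfl⟩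
      have hval : value M (segLen n K) D' μ' (less (reg 13) (reg 15)) =
          if j < L.length then 1 else 0 := by
        simp (disch := omega) [Nat.mod_eq_of_lt, h13, h15]
      rw [hval]
      split_ifs with hjL
      · refine ⟨fun h => absurd h (by simp), fun _ => ⟨hjL, ?_⟩⟩
        have hst : μ' 6 (σ.start k + j) = L[j] := by
          have := hc.stack_eq (σ.start k + j) (by show _ < σ.stack.length; omega)
          rw [this]
          simp [← hr.part_eq, Layers.part, Layers.place]
        have hxn := (L[j]).isLt
        have hcol := hr.color_eq j hjL
        rw [← h8] at hcol
        refine Triple.assign_seq 55 0 16 (L[j] : Fin n) (by omega)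
          (by simp (disch := omega) [Nat.mod_eq_of_lt])
          (by simp (disch := omega) [Nat.mod_eq_of_lt, hc.Z_eq, h18, h13, hst]) (by simp) ?_
        refine Triple.assign_seq 40 1 (L[j] : Fin n) k (by omega)
          (by simp (disch := omega) [Nat.mod_eq_of_lt, hc.Z_eq])
          (by simp (disch := omega) [Nat.mod_eq_of_lt, h11]) (by simp) ?_
        refine Triple.assign_seq 20 2 (L[j] : Fin n) (f L[j]) (by omega)
          (by simp (disch := omega) [Nat.mod_eq_of_lt, hc.Z_eq])
          (by simp (disch := omega) [Nat.mod_eq_of_lt, hc.Z_eq, h13, hcol]) (by simp) ?_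
        refine Triple.assign_seq 10 4 (L[j] : Fin n) 0 (by omega)
          (by simp (disch := omega) [Nat.mod_eq_of_lt, hc.Z_eq])
          (by simp) (by simp) ?_
        refine Triple.weaken (Triple.assign 0 13 (j + 1) (by omega)
          (by simp (disch := omega) [Nat.mod_eq_of_lt])
          (by simp (disch := omega) [Nat.mod_eq_of_lt, h13]) ?_) (by simp)
        refine ⟨?_, ?_, ?_, ?_, ?_, ?_, ?_, ?_, rfl⟩
        · rw [List.take_succ_eq_append_getElem hjL, Layers.place_append]
          exact ((hc.set _ (by omega)).put _ _ _).set _ (by omega)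
        · simp [h11]
        · simp
        · simp [h15]
        · simp [h18]
        · simp [h8]
        · simp [h3]
        · simp [h9]
      · refine ⟨fun _ => ⟨?_, h11, h3, h9, rfl⟩, fun h => absurd rfl h⟩
        rwa [List.take_of_length_le (by omega)] at hc
    · simp
      omega
  · rintro μ₁ D₁ ⟨hc₁, h11, h3, h9, rfl⟩
    refine Triple.assign_seq (60 * (Nat.log 2 n - k) + 20) 0 13 (k + 1) (by omega)
      (by simp (disch := omega) [Nat.mod_eq_of_lt])
      (by simp (disch := omega) [Nat.mod_eq_of_lt, h11]) (by simp; omega) ?_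
    refine Triple.weaken (Triple.loop_const (fun j μ' D' => Core C K { σ.place L k f with
      start := fun i => if k < i ∧ i < k + 1 + j then σ.stack.length else σ.start i } μ' ∧
      μ' 0 13 = k + 1 + j ∧ μ' 3 = μ 3 ∧ μ' 9 = μ 9 ∧ D' = D₁) (Nat.log 2 n - k) 30 ?_ ?_ ?_) ?_
    · refine ⟨?_, by simp, by simp [h3], by simp [h9], rfl⟩
      have hs : (fun i => if k < i ∧ i < k + 1 + 0 then σ.stack.length else σ.start i) =
          (σ.place L k f).start := by
        funext i
        rw [if_neg (by omega)]
        rfl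
      rw [hs]
      exact hc₁.set _ (by omega)
    · omega
    · rintro j hj μ' D' ⟨hc, h13, h3', h9', rfl⟩
      have hval : value M (segLen n K) D' μ' (less (reg 13) (reg 8 + .lit 1)) =
          if j < Nat.log 2 n - k then 1 else 0 := by
        simp (disch := omega) [Nat.mod_eq_of_lt, h13, hc.I_eq]
        congr 1
        simp only [eq_iff_iff]
        omega
      have hst : μ' 0 10 = σ.stack.length := hc.top_eq
      rw [hval]
      split_ifs with hjL
      · refine ⟨fun h => absurd h (by simp), fun _ => ⟨hjL, ?_⟩⟩
        refine Triple.assign_seq 10 7 (k + 1 + j) σ.stack.length (by omega)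
          (by simp (disch := omega) [Nat.mod_eq_of_lt, hc.Z_eq, h13])
          (by simp (disch := omega) [Nat.mod_eq_of_lt, hst]) (by simp) ?_
        refine Triple.weaken (Triple.assign 0 13 (k + 1 + (j + 1)) (by omega)
          (by simp (disch := omega) [Nat.mod_eq_of_lt])
          (by simp (disch := omega) [Nat.mod_eq_of_lt, h13, add_assoc]) ?_) (by simp)
        refine ⟨Core.set ?_ _ (by omega), by simp, by simp [h3'], by simp [h9'], rfl⟩
        constructor
        · simp [hc.n_eq]
        · simp [hc.C_eq]
        · simp [hc.K_eq]
        · simp [hc.Z_eq]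
        · simp [hc.I_eq]
        · simp [hc.P_eq]
        · simp [hst, Layers.place]
        · simpa using hc.level_eq
        · simpa using hc.base_eq
        · simpa using hc.count_eq
        · simpa using hc.recent_eq
        · simpa using hc.stack_eq
        · intro i hi
          have := hc.start_eq i hi
          simp only [Store.set_same, Function.update_apply, this]
          split_ifs <;> first | rfl | omega
        · exact hc.recent_le
        · exact hc.stack_le
      · refine ⟨fun _ => ⟨?_, h3', h9', rfl⟩, fun h => absurd rfl h⟩
        have hm : σ.move k f = { σ.place L k f with
            start := fun i => if k < i then σ.stack.length else σ.start i } := by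
          simp [Layers.move, Layers.place, hr.part_eq]
        rw [hm]
        refine { hc with start_eq := fun i hi => ?_ }
        rw [hc.start_eq i hi]
        simp only
        split_ifs <;> first | rfl | omega
    · simp
      omega

/-- Enter the partner, in variable `b`, into the list of recent insertions of the vertex in variable
`a`. -/
def noteCode (a b : ℕ) : Prog :=
  slot 5 (reg a * reg 5 + item 4 (reg a)) ::= reg b ;;
  slot 4 (reg a) ::= item 4 (reg a) + .lit 1

theorem noteCode_spec (hF : Fits M K fuel) {σ : Layers n} {μ : Store} {D : List (Update n)}
    (hc : Core C K σ μ) {a b : ℕ} {u v : Fin n} (ha : a < 3) (hb : b < 3) (hu : μ 0 a = u)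
    (hv : μ 0 b = v) (hK : (σ.recent u).length < K) :
    Triple M G fuel (segLen n K) (noteCode a b) μ D 50 fun μ' D' =>
      Core C K { σ with recent := Function.update σ.recent u (σ.recent u ++ [v]) } μ' ∧
        μ' 0 = μ 0 ∧ μ' 3 = μ 3 ∧ μ' 9 = μ 9 ∧ D' = D := by
  have hZ := segLen_ge n K
  have hW := hF.le_W
  have hidx := pair_lt_segLen u hK
  have hu' := u.isLt
  have hcu := hc.count_eq u
  refine Triple.assign_seq 25 5 (u * K + (σ.recent u).length) v hidx
    (by simp (disch := omega) [Nat.mod_eq_of_lt, hc.Z_eq, hu, hc.K_eq, hcu])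
    (by simp (disch := omega) [Nat.mod_eq_of_lt, hv]) (by simp) ?_
  refine Triple.weaken (Triple.assign 4 u ((σ.recent u).length + 1) (by omega)
    (by simp (disch := omega) [Nat.mod_eq_of_lt, hc.Z_eq, hu])
    (by simp (disch := omega) [Nat.mod_eq_of_lt, hc.Z_eq, hu, hcu]) ?_) (by simp)
  refine ⟨?_, by simp, by simp, by simp, rfl⟩
  have hx : ∀ w : Fin n, (w : ℕ) = u ↔ w = u := fun w => Fin.ext_iff.symm
  constructor
  · simp [hc.n_eq]
  · simp [hc.C_eq]
  · simp [hc.K_eq]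
  · simp [hc.Z_eq]
  · simp [hc.I_eq]
  · simp [hc.P_eq]
  · simp [hc.top_eq]
  · simpa using hc.level_eq
  · simpa using hc.base_eq
  · intro w
    by_cases hw : w = u
    · simp [hw]
    · simp [hx, hw, hc.count_eq]
  · intro w i hi
    by_cases hw : w = u
    · subst hw
      simp only [Function.update_self, List.length_append, List.length_singleton] at hi
      by_cases hi' : i = (σ.recent w).length
      · simp [hi']
      · have hi'' : i < (σ.recent w).length := by omega
        simp (disch := omega) [hc.recent_eq w i hi'', List.getElem_append_left hi'']
    · simp only [Function.update_of_ne hw] at hi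
      have hne : (w : ℕ) * K + i ≠ u * K + (σ.recent u).length := by
        intro h
        have hiK := lt_of_lt_of_le hi (hc.recent_le w)
        have h1 := congrArg (· / K) h
        simp only [mul_comm _ K, Nat.mul_add_div hF.K_pos, Nat.div_eq_of_lt hiK,
          Nat.div_eq_of_lt hK, add_zero] at h1
        exact hw (Fin.ext h1)
      simp [Function.update_of_ne hw, hne, hc.recent_eq w i hi]
  · simpa using hc.stack_eq
  · simpa using hc.start_eq
  · intro w
    by_cases hw : w = u
    · simp [hw]; omega
    · simpa [hw] using hc.recent_le w
  · exact hc.stack_le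

/-- Push the vertex in variable `a` when it has `K` recent insertions. -/
def pushCode (a : ℕ) : Prog :=
  .ite (less (item 4 (reg a)) (reg 5)) .skip
    (slot 6 (reg 10) ::= reg a ;; .lit 10 ::= reg 10 + .lit 1)

theorem pushCode_spec (hF : Fits M K fuel) {σ : Layers n} {μ : Store} {D : List (Update n)}
    (hc : Core C K σ μ) {a : ℕ} {u : Fin n} (ha : a < 3) (hu : μ 0 a = u)
    (hlen : (σ.push K u).stack.length ≤ n * n + 2) :
    Triple M G fuel (segLen n K) (pushCode a) μ D 50 fun μ' D' => Core C K (σ.push K u) μ' ∧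
      (∀ x, x ≠ 10 → μ' 0 x = μ 0 x) ∧ μ' 3 = μ 3 ∧ μ' 9 = μ 9 ∧ D' = D := by
  have hZ := segLen_ge n K
  have hW := hF.le_W
  have hu' := u.isLt
  have hcu := hc.count_eq u
  have hru := hc.recent_le u
  have hval : value M (segLen n K) D μ (less (item 4 (reg a)) (reg 5)) =
      if (σ.recent u).length < K then 1 else 0 := by
    simp (disch := omega) [Nat.mod_eq_of_lt, hc.Z_eq, hu, hc.K_eq, hcu]
  refine Triple.weaken (Triple.ite (c := 30) ?_ ?_) (by simp)
  · intro h
    rw [hval] at h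
    have hK : K ≤ (σ.recent u).length := by
      by_contra hK
      rw [if_pos (by omega)] at h
      omega
    rw [Layers.push_stack, if_pos hK, List.length_append, List.length_singleton] at hlen
    refine Triple.assign_seq 10 6 σ.stack.length u (by omega)
      (by simp (disch := omega) [Nat.mod_eq_of_lt, hc.Z_eq, hc.top_eq])
      (by simp (disch := omega) [Nat.mod_eq_of_lt, hu]) (by simp) ?_
    refine Triple.weaken (Triple.assign 0 10 (σ.stack.length + 1) (by omega)
      (by simp (disch := omega) [Nat.mod_eq_of_lt])
      (by simp (disch := omega) [Nat.mod_eq_of_lt, hc.top_eq]) ?_) (by simp)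
    refine ⟨?_, fun x hx => by simp [hx], by simp, by simp, rfl⟩
    rw [Layers.push, if_pos hK]
    constructor
    · simp [hc.n_eq]
    · simp [hc.C_eq]
    · simp [hc.K_eq]
    · simp [hc.Z_eq]
    · simp [hc.I_eq]
    · simp [hc.P_eq]
    · simp
    · simpa using hc.level_eq
    · simpa using hc.base_eq
    · simpa using hc.count_eq
    · simpa using hc.recent_eq
    · intro i hi
      by_cases hi' : i = σ.stack.length
      · simp [hi']
      · have hi'' : i < σ.stack.length := by
          simp only [List.length_append, List.length_singleton] at hi
          omega
        simp (disch := omega) [hc.stack_eq i hi'', List.getElem_append_left hi'']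
    · simpa using hc.start_eq
    · exact hc.recent_le
    · simpa using hlen
  · intro h
    rw [hval] at h
    refine Triple.weaken (Triple.skip ?_) (by norm_num)
    have hK : ¬ K ≤ (σ.recent u).length := by
      intro hK
      rw [if_neg (by omega)] at h
      exact h rfl
    rw [Layers.push, if_neg hK]
    exact ⟨hc, fun _ _ => rfl, rfl, rfl, rfl⟩

end

section

/-! ### Means of functions of the random colors -/

/-- The numbers in segment `3`, which holds the random colors of the vertices. -/
def palette (Z : ℕ) (s : State n) (v : Fin n) : ℕ := s.mem (Z * 3 + v)

/-- Started in the store `μ`, the mean of `g`, as a function of the random colors, is at most `ε`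
in the end. -/
def MeanLE (M : Machine n) (G : SimpleGraph (Fin n)) (fuel Z : ℕ) (p : Prog) (μ : Store)
    (D : List (Update n)) (g : (Fin n → ℕ) → ℝ≥0∞) (ε : ℝ≥0∞) : Prop :=
  ∀ t r, mean (p.exec M G fuel (mkState Z μ D t r)) (fun s => g (palette Z s)) ≤ ε

namespace MeanLE

variable {M : Machine n} {G : SimpleGraph (Fin n)} {fuel Z : ℕ} {p q : Prog} {μ : Store}
  {D : List (Update n)} {c : ℕ} {R : Store → List (Update n) → Prop}
  {g g' : (Fin n → ℕ) → ℝ≥0∞} {ε : ℝ≥0∞}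

theorem palette_mkState (hZ : n ≤ Z) (μ : Store) (D : List (Update n)) (t r : ℕ) :
    palette Z (mkState Z μ D t r) = fun v : Fin n => μ 3 v := by
  funext v
  exact flat_at μ 3 (v.isLt.trans_le hZ)

theorem of_triple (hZ : n ≤ Z) (h : Triple M G fuel Z p μ D c R)
    (hg : ∀ μ' D', R μ' D' → g (fun v => μ' 3 v) ≤ ε) : MeanLE M G fuel Z p μ D g ε := by
  intro t r
  refine mean_le ((h t r).mono ?_)
  rintro s ⟨μ', D', t', rfl, -, hR⟩
  rw [palette_mkState hZ]
  exact hg μ' D' hR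

theorem seq_triple (h : Triple M G fuel Z p μ D c R)
    (hq : ∀ μ' D', R μ' D' → MeanLE M G fuel Z q μ' D' g ε) :
    MeanLE M G fuel Z (.seq p q) μ D g ε := by
  intro t r
  rw [Prog.exec, mean_andThen (h t r)]
  refine mean_le ((h t r).mono ?_)
  rintro s ⟨μ', D', t', rfl, -, hR⟩
  exact hq μ' D' hR t' r

theorem seq (hZ : n ≤ Z) (h : Triple M G fuel Z p μ D c R) (hp : MeanLE M G fuel Z p μ D g' ε)
    (hq : ∀ μ' D', R μ' D' → MeanLE M G fuel Z q μ' D' g (g' fun v => μ' 3 v)) :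
    MeanLE M G fuel Z (.seq p q) μ D g ε := by
  intro t r
  rw [Prog.exec, mean_andThen (h t r)]
  refine le_trans (mean_mono ((h t r).mono ?_)) (hp t r)
  rintro s ⟨μ', D', t', rfl, -, hR⟩
  rw [palette_mkState hZ]
  exact hq μ' D' hR t' r

theorem ite {b : Expr} (h0 : value M Z D μ b = 0 → MeanLE M G fuel Z q μ D g ε)
    (h1 : value M Z D μ b ≠ 0 → MeanLE M G fuel Z p μ D g ε) :
    MeanLE M G fuel Z (.ite b p q) μ D g ε := fun t r => by
  rw [Prog.exec, eval_mkState, Triple.mkState_tick]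
  split_ifs with hb
  · exact h0 hb _ r
  · exact h1 hb _ r

theorem random {a k : Expr} (hZ : n ≤ Z) (i x N : ℕ) (hx : x < Z)
    (ha : value M Z D μ a = Z * i + x) (hk : value M Z D μ k = N)
    (h : (∑ y : Fin (N + 1), g fun v => (μ.set i x y) 3 v) / (N + 1 : ℕ) ≤ ε) :
    MeanLE M G fuel Z (.random a k) μ D g ε := fun t r => by
  rw [exec_random (by rw [eval_mkState, hk]), eval_mkState, ha]
  have := mean_uniform (fun y : Fin (N + 1) => ((mkState Z μ D t r).write (Z * i + x) y).tick
    (a.size + k.size + 1)) (fun s => g (palette Z s))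
  rw [this]
  refine le_trans (le_of_eq ?_) h
  congr 1
  refine Finset.sum_congr rfl fun y _ => ?_
  rw [← palette_mkState hZ (μ.set i x y) D (t + (a.size + k.size + 1)) r]
  simp only [State.write, State.tick, mkState, update_flat _ _ _ hx]

end MeanLE

/-! ### The common parts of the algorithms -/

/-- Compute the length of segments and the number of levels, fill the stack with all vertices and
let all levels start above them. -/
def setupCode : Prog :=
  .lit 7 ::= (reg 3 + reg 5 + .lit 16) * (reg 3 + reg 5 + .lit 16) ;;
  .lit 9 ::= .lit 1 ;;
  .loop (less (reg 9 + reg 9) (reg 3 + .lit 1))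
    (.lit 9 ::= reg 9 + reg 9 ;; .lit 8 ::= reg 8 + .lit 1) ;;
  .loop (less (reg 13) (reg 3)) (slot 6 (reg 13) ::= reg 13 ;; .lit 13 ::= reg 13 + .lit 1) ;;
  .lit 10 ::= reg 3 ;;
  .lit 14 ::= .lit 1 ;;
  .loop (less (reg 14) (reg 8 + .lit 1))
    (slot 7 (reg 14) ::= reg 3 ;; .lit 14 ::= reg 14 + .lit 1)

/-- Note an insertion for both endpoints. -/
def recordCode : Prog := noteCode 1 2 ;; noteCode 2 1

/-- Push the endpoints of an insertion, and keep the old height of the stack in variable `16`. -/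
def fillCode : Prog := .lit 16 ::= reg 10 ;; pushCode 1 ;; pushCode 2

/-- Handle an update; `onInsert`, `onDelete` and `onMove` care for the coloring of the recent
edges. -/
def updateCode (onInsert onDelete onMove : Prog) : Prog :=
  .ite (reg 0)
    (recordCode ;; onInsert ;; fillCode ;;
      .ite (less (reg 16) (reg 10)) (prepareCode ;; onMove ;; commitCode) .skip)
    onDelete

variable {M : Machine n} {G : SimpleGraph (Fin n)} {C K fuel : ℕ}

theorem recordCode_spec (hF : Fits M K fuel) {σ : Layers n} {μ : Store} {D : List (Update n)}
    (hc : Core C K σ μ) {u v : Fin n} (huv : u ≠ v) (hu : μ 0 1 = u) (hv : μ 0 2 = v)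
    (hK : ∀ x, (σ.recent x).length < K) :
    Triple M G fuel (segLen n K) recordCode μ D 100 fun μ' D' => Core C K (σ.record u v) μ' ∧
      μ' 0 = μ 0 ∧ μ' 3 = μ 3 ∧ μ' 9 = μ 9 ∧ D' = D := by
  refine Triple.seq_of 50 50 (noteCode_spec hF hc (by norm_num) (by norm_num) hu hv (hK u)) ?_
    (by norm_num)
  rintro μ₁ D₁ ⟨hc₁, h0, h3, h9, rfl⟩
  refine (noteCode_spec hF hc₁ (by norm_num) (by norm_num) (by rw [h0, hv]) (by rw [h0, hu])
    ?_).mono le_rfl ?_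
  · simpa [huv.symm] using hK v
  · rintro μ₂ D₂ ⟨hc₂, h0', h3', h9', rfl⟩
    refine ⟨?_, h0'.trans h0, h3'.trans h3, h9'.trans h9, rfl⟩
    convert hc₂ using 1
    simp only [Layers.record, Layers.mk.injEq, true_and, and_true]
    funext x
    by_cases h1 : x = u
    · subst h1; simp [huv]
    · by_cases h2 : x = v
      · subst h2; simp [h1]
      · simp [h1, h2]

theorem Layers.Valid.start_le_mul {σ : Layers n} (h : σ.Valid K) (j : ℕ) :
    σ.start j ≤ j * n := by
  induction j with
  | zero => simp [h.start_zero]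
  | succ j ih =>
    have := h.start_succ j
    rw [add_mul]
    omega

theorem Layers.Valid.stack_le {σ : Layers n} (hn : 2 ≤ n) (h : σ.Valid K) :
    σ.stack.length ≤ n * n + 2 := by
  have h1 := h.start_le_mul (Nat.log 2 n + 1)
  have h2 : (Nat.log 2 n + 1) * n ≤ n * n :=
    Nat.mul_le_mul_right _ (Nat.log_lt_self 2 (by omega))
  have h3 := h.length_stack
  omega

theorem fillCode_spec (hF : Fits M K fuel) {σ : Layers n} (hs : σ.Settled K) {μ : Store}
    {D : List (Update n)} {u v : Fin n} (hc : Core C K (σ.record u v) μ) (huv : u ≠ v)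
    (hu : μ 0 1 = u) (hv : μ 0 2 = v) :
    Triple M G fuel (segLen n K) fillCode μ D 110 fun μ' D' => Core C K (σ.pushed K u v) μ' ∧
      μ' 0 16 = σ.stack.length ∧ μ' 3 = μ 3 ∧ μ' 9 = μ 9 ∧ D' = D := by
  have hZ := segLen_ge n K
  have hW := hF.le_W
  have htop := hc.stack_le
  have hlen := (hs.valid_pushed huv).stack_le hF.two_le
  have hlen' : ((σ.record u v).push K u).stack.length ≤ n * n + 2 := by
    refine le_trans ?_ hlen
    rw [Layers.pushed, Layers.push_stack K _ v]
    split_ifs <;> simp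
  refine Triple.assign_seq 100 0 16 σ.stack.length (by omega)
    (by simp (disch := omega) [Nat.mod_eq_of_lt])
    (by simp (disch := omega) [Nat.mod_eq_of_lt, hc.top_eq]) (by simp) ?_
  refine Triple.seq_of 50 50 (pushCode_spec hF (hc.set _ (by omega)) (by norm_num) (u := u)
    (by simp [hu]) hlen') ?_ (by norm_num)
  rintro μ₁ D₁ ⟨hc₁, h0, h3, h9, rfl⟩
  refine (pushCode_spec hF hc₁ (by norm_num) (u := v) ?_ hlen).mono le_rfl ?_
  · rw [h0 _ (by norm_num)]; simp [hv]
  · rintro μ₂ D₂ ⟨hc₂, h0', h3', h9', rfl⟩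
    refine ⟨hc₂, ?_, ?_, ?_, rfl⟩
    · rw [h0' _ (by norm_num), h0 _ (by norm_num)]; simp
    · rw [h3', h3]; simp
    · rw [h9', h9]; simp

theorem value_full (hF : Fits M K fuel) {σ : Layers n} {μ : Store} {D : List (Update n)}
    {u v : Fin n} (hc : Core C K (σ.pushed K u v) μ) (h16 : μ 0 16 = σ.stack.length) :
    value M (segLen n K) D μ (less (reg 16) (reg 10)) = if σ.Full K u v then 1 else 0 := by
  have hZ := segLen_ge n K
  have hW := hF.le_W
  have h1 : value M (segLen n K) D μ (less (reg 16) (reg 10)) =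
      if σ.stack.length < (σ.pushed K u v).stack.length then 1 else 0 := by
    simp (disch := omega) [Nat.mod_eq_of_lt, hc.top_eq, h16]
  rw [h1]
  rfl

/-- A bound for the number of steps of an update besides those for the coloring of recent edges. -/
def stepCost (T : ℕ → ℕ) (K : ℕ) (σ : Layers n) (x : Update n) : ℕ :=
  500 + 1000 * σ.weight K (fun k => T (n / 2 ^ k)) x

theorem Layers.length_moving_le_cost {T : ℕ → ℕ} (hT : Monotone T) (hT' : ∀ m, m ≤ T m)
    {σ : Layers n} (h : σ.Valid K) (hn : 2 ≤ n) :
    σ.moving.length ≤ T (n / 2 ^ σ.target) ∧ T σ.moving.length ≤ T (n / 2 ^ σ.target) ∧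
      Nat.log 2 n - σ.target + 1 ≤ T (n / 2 ^ σ.target) := by
  have h1 := h.length_moving
  refine ⟨h1.trans (hT' _), hT h1, le_trans ?_ (hT' _)⟩
  have h2 := σ.target_le
  rw [Nat.le_div_iff_mul_le (by positivity)]
  calc (Nat.log 2 n - σ.target + 1) * 2 ^ σ.target
      ≤ 2 ^ (Nat.log 2 n - σ.target) * 2 ^ σ.target :=
        Nat.mul_le_mul_right _ (Nat.lt_two_pow_self)
    _ = 2 ^ Nat.log 2 n := by rw [← pow_add, Nat.sub_add_cancel h2]
    _ ≤ n := Nat.pow_log_le_self 2 (by omega)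

/-- The total cost and the effect of an insertion. The condition `X` describes the colors of recent
edges before a rebuild, and `Y` describes them after it. -/
theorem updateCode_insert (hF : Fits M K fuel) (hT : Monotone M.T) (hT' : ∀ m, m ≤ M.T m)
    (hlt : ∀ S v, v ∈ S → M.static G S v < M.W) {σ : Layers n} (hs : σ.Settled K) {μ : Store}
    {D : List (Update n)} (hc : Core C K σ μ) {u v : Fin n} (huv : u ≠ v) (h0 : μ 0 0 = 1)
    (hu : μ 0 1 = u) (hv : μ 0 2 = v) {onInsert onDelete onMove : Prog} {cI cM : ℕ}
    (X Y : (ℕ → ℕ) → (ℕ → ℕ) → List (Update n) → Prop)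
    (hI : ∀ μ' : Store, Core C K (σ.record u v) μ' → μ' 0 = μ 0 → μ' 3 = μ 3 → μ' 9 = μ 9 →
      Triple M G fuel (segLen n K) onInsert μ' D cI fun μ'' D'' =>
        Core C K (σ.record u v) μ'' ∧ μ'' 0 1 = u ∧ μ'' 0 2 = v ∧ X (μ'' 3) (μ'' 9) D'')
    (hM : ∀ (τ : Layers n) (L : List (Fin n)) (k : ℕ) (f : Fin n → ℕ) (μ' : Store)
      (D' : List (Update n)), L = (σ.pushed K u v).moving → τ.recent = (σ.pushed K u v).recent →
      Ready C K τ k L f μ' → X (μ' 3) (μ' 9) D' →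
      Triple M G fuel (segLen n K) onMove μ' D' cM fun μ'' D'' =>
        (Ready C K τ k L f μ'' ∨ Ready C K (τ.forget L) k L f μ'') ∧ Y (μ'' 3) (μ'' 9) D'') :
    Triple M G fuel (segLen n K) (updateCode onInsert onDelete onMove) μ D
      (stepCost M.T K σ (.insert u v) + cI + if σ.Full K u v then cM else 0) fun μ' D' =>
        Core C K (σ.step M.static K G (.insert u v)) μ' ∧
          if σ.Full K u v then Y (μ' 3) (μ' 9) D' else X (μ' 3) (μ' 9) D' := by
  have hZ := segLen_ge n K
  have hW := hF.le_W
  obtain ⟨hcost₁, hcost₂, hcost₃⟩ :=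
    Layers.length_moving_le_cost hT hT' (hs.valid_pushed huv) hF.two_le
  have hvp := hs.valid_pushed huv
  obtain ⟨w, hw⟩ : ∃ w, w = M.T (n / 2 ^ (σ.pushed K u v).target) := ⟨_, rfl⟩
  rw [← hw] at hcost₁ hcost₂ hcost₃
  refine Triple.weaken (Triple.ite (c := 450 + cI +
    if σ.Full K u v then cM + 1000 * w else 0) ?_ ?_) ?_
  · intro h
    simp (disch := omega) [Nat.mod_eq_of_lt, h0] at h
  · intro _
    refine Triple.seq_of 100 (350 + cI + if σ.Full K u v then cM + 1000 * w else 0)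
      (recordCode_spec hF hc huv hu hv hs.length_recent_lt) ?_ (by omega)
    rintro μ₁ D₁ ⟨hc₁, h0₁, h3₁, h9₁, rfl⟩
    refine Triple.seq_of cI (350 + if σ.Full K u v then cM + 1000 * w else 0)
      (hI μ₁ hc₁ h0₁ h3₁ h9₁) ?_ (by omega)
    rintro μ₂ D₂ ⟨hc₂, hu₂, hv₂, hX⟩
    refine Triple.seq_of 110 (240 + if σ.Full K u v then cM + 1000 * w else 0)
      (fillCode_spec hF hs hc₂ huv hu₂ hv₂) ?_ (by omega)
    rintro μ₃ D₃ ⟨hc₃, h16₃, h3₃, h9₃, rfl⟩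
    rw [← h3₃, ← h9₃] at hX
    refine Triple.weaken (Triple.ite (c := 230 + if σ.Full K u v then cM + 1000 * w else 0)
      ?_ ?_) (by simp; omega)
    · intro h
      rw [value_full hF hc₃ h16₃] at h
      have hf : ¬ σ.Full K u v := by
        intro hf
        simp [hf] at h
      refine Triple.weaken (Triple.skip ?_) (by omega)
      rw [Layers.step, if_neg hf, if_neg hf]
      exact ⟨hc₃, hX⟩
    · intro h
      rw [value_full hF hc₃ h16₃] at h
      have hf : σ.Full K u v := by
        by_contra hf
        simp [hf] at h
      simp only [if_pos hf, Layers.step]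
      refine Triple.seq_of (100 + 200 * w) (130 + (cM + 800 * w))
        ((prepareCode_spec hF hc₃ hvp hlt).weaken (by omega)) ?_ (by omega)
      rintro μ₄ D₄ ⟨hr₄, h3₄, h9₄, rfl⟩
      rw [← h3₄, ← h9₄] at hX
      refine Triple.seq_of cM (130 + 800 * w) (hM _ _ _ _ μ₄ D₄ rfl (by simp) hr₄ hX) ?_ (by omega)
      rintro μ₅ D₅ ⟨hr₅ | hr₅, hY⟩
      · refine (commitCode_spec hF hr₅).mono (by omega) ?_
        rintro μ₆ D₆ ⟨hc₆, h3₆, h9₆, rfl⟩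
        rw [h3₆, h9₆]
        exact ⟨hc₆, hY⟩
      · refine (commitCode_spec hF hr₅).mono (by omega) ?_
        rintro μ₆ D₆ ⟨hc₆, h3₆, h9₆, rfl⟩
        rw [h3₆, h9₆]
        refine ⟨?_, hY⟩
        convert hc₆ using 1
        simp only [Layers.rebuild, Layers.move, Layers.forget, Layers.part, Layers.mk.injEq,
          and_true]
        refine ⟨rfl, rfl, ?_⟩
        funext x
        show _ = if x ∈ (σ.pushed K u v).moving then _ else _
        have hm : ((σ.pushed K u v).restrict (σ.pushed K u v).target).stack.drop
          (((σ.pushed K u v).restrict (σ.pushed K u v).target).start (σ.pushed K u v).target) =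
            (σ.pushed K u v).moving := rfl
        simp only [hm]
        split_ifs <;> rfl
  · simp only [stepCost, Layers.weight]
    split_ifs <;> simp <;> omega

/-- The mean effect of an insertion on a function `g` of the random colors: `g'` is a bound for its
mean after a rebuild. -/
theorem updateCode_insert_mean (hF : Fits M K fuel)
    (hlt : ∀ S v, v ∈ S → M.static G S v < M.W) {σ : Layers n} (hs : σ.Settled K) {μ : Store}
    {D : List (Update n)} (hc : Core C K σ μ) {u v : Fin n} (huv : u ≠ v) (h0 : μ 0 0 = 1)
    (hu : μ 0 1 = u) (hv : μ 0 2 = v) {onInsert onDelete onMove : Prog} {cI cM : ℕ}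
    (g g' : (Fin n → ℕ) → ℝ≥0∞) (ε : ℝ≥0∞)
    (hI : ∀ μ' : Store, Core C K (σ.record u v) μ' → μ' 0 = μ 0 → μ' 3 = μ 3 → μ' 9 = μ 9 →
      (Triple M G fuel (segLen n K) onInsert μ' D cI fun μ'' _ =>
        Core C K (σ.record u v) μ'' ∧ μ'' 0 1 = u ∧ μ'' 0 2 = v) ∧
      MeanLE M G fuel (segLen n K) onInsert μ' D (if σ.Full K u v then g' else g) ε)
    (hM : ∀ (τ : Layers n) (L : List (Fin n)) (k : ℕ) (f : Fin n → ℕ) (μ' : Store)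
      (D' : List (Update n)), L = (σ.pushed K u v).moving → Ready C K τ k L f μ' →
      (Triple M G fuel (segLen n K) onMove μ' D' cM fun μ'' _ => Ready C K τ k L f μ'') ∧
      MeanLE M G fuel (segLen n K) onMove μ' D' g (g' fun v => μ' 3 v)) :
    MeanLE M G fuel (segLen n K) (updateCode onInsert onDelete onMove) μ D g ε := by
  have hZ := segLen_ge n K
  have hW := hF.le_W
  have hn : n ≤ segLen n K := by omega
  have hvp := hs.valid_pushed huv
  refine MeanLE.ite ?_ ?_
  · intro h
    simp (disch := omega) [Nat.mod_eq_of_lt, h0] at h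
  · intro _
    refine MeanLE.seq_triple (recordCode_spec hF hc huv hu hv hs.length_recent_lt) ?_
    rintro μ₁ D₁ ⟨hc₁, h0₁, h3₁, h9₁, rfl⟩
    obtain ⟨hI₁, hI₂⟩ := hI μ₁ hc₁ h0₁ h3₁ h9₁
    refine MeanLE.seq hn hI₁ hI₂ ?_
    rintro μ₂ D₂ ⟨hc₂, hu₂, hv₂⟩
    refine MeanLE.seq_triple (fillCode_spec hF hs hc₂ huv hu₂ hv₂) ?_
    rintro μ₃ D₃ ⟨hc₃, h16₃, h3₃, h9₃, rfl⟩
    rw [← h3₃]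
    refine MeanLE.ite ?_ ?_
    · intro h
      rw [value_full hF hc₃ h16₃] at h
      have hf : ¬ σ.Full K u v := by
        intro hf
        simp [hf] at h
      rw [if_neg hf]
      exact MeanLE.of_triple hn (Triple.skip (Q := fun μ' D' => μ' 3 = μ₃ 3) rfl)
        fun μ' D' h => by rw [h]
    · intro h
      rw [value_full hF hc₃ h16₃] at h
      have hf : σ.Full K u v := by
        by_contra hf
        simp [hf] at h
      rw [if_pos hf]
      refine MeanLE.seq_triple (prepareCode_spec hF hc₃ hvp hlt) ?_
      rintro μ₄ D₄ ⟨hr₄, h3₄, h9₄, rfl⟩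
      rw [← h3₄]
      obtain ⟨hM₁, hM₂⟩ := hM _ _ _ _ μ₄ D₄ rfl hr₄
      refine MeanLE.seq hn hM₁ hM₂ ?_
      intro μ₅ D₅ hr₅
      refine MeanLE.of_triple hn (commitCode_spec hF hr₅) ?_
      rintro μ₆ D₆ ⟨hc₆, h3₆, h9₆, rfl⟩
      rw [h3₆]

theorem updateCode_delete {μ : Store} {D : List (Update n)} (hF : Fits M K fuel) (h0 : μ 0 0 = 0)
    {onInsert onDelete onMove : Prog} {c : ℕ} {Q : Store → List (Update n) → Prop}
    (h : Triple M G fuel (segLen n K) onDelete μ D c Q) :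
    Triple M G fuel (segLen n K) (updateCode onInsert onDelete onMove) μ D (c + 3) Q := by
  have hZ := segLen_ge n K
  have hW := hF.le_W
  refine Triple.weaken (Triple.ite (c := c) (fun _ => h) fun h => ?_) (by simp; omega)
  simp (disch := omega) [Nat.mod_eq_of_lt, h0] at h

/-- The store in which the algorithms start. -/
def startStore (n C K Δ : ℕ) : Store := unflat (segLen n K) (State.start n [n, C, K, Δ]).mem

set_option maxHeartbeats 1000000 in
theorem setupCode_spec (hF : Fits M K fuel) (Δ : ℕ) :
    Triple M G fuel (segLen n K) setupCode (startStore n C K Δ) [] (200 * n) fun μ D =>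
      Core C K (Layers.initial n) μ ∧ (∀ x, μ 9 x = 0) ∧ D = [] := by
  have hZ := segLen_ge n K
  have hW := hF.le_W
  have hfuel := hF.le_fuel
  have hn := hF.two_le
  have hlog : Nat.log 2 n < n := Nat.log_lt_self 2 (by omega)
  have hlog' : 2 ^ Nat.log 2 n ≤ n := Nat.pow_log_le_self 2 (by omega)
  have hstart : ∀ i x, i ≠ 0 ∨ 7 ≤ x → startStore n C K Δ i x = 0 := by
    intro i x hix
    have h7 : 7 ≤ segLen n K * i + x := by
      rcases hix with hi | hx
      · have := Nat.le_mul_of_pos_right (segLen n K) (Nat.pos_of_ne_zero hi)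
        omega
      · omega
    simp only [startStore, unflat, State.start]
    rw [if_neg (by omega)]
    exact List.getD_eq_default _ _ (by simp; omega)
  have h3 : startStore n C K Δ 0 3 = n := by simp [startStore, unflat, State.start]
  have h4 : startStore n C K Δ 0 4 = C := by simp [startStore, unflat, State.start]
  have h5 : startStore n C K Δ 0 5 = K := by simp [startStore, unflat, State.start]
  have hz : (n + K + 16) * (n + K + 16) = segLen n K := rfl
  have hz' : n + K + 16 < M.W := by omega
  generalize startStore n C K Δ = μ₀ at *
  refine Triple.assign_seq (180 * n) 0 7 (segLen n K) (by omega)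
    (by simp (disch := omega) [Nat.mod_eq_of_lt])
    (by simp (disch := omega) [Nat.mod_eq_of_lt, h3, h5, hz]) (by simp; omega) ?_
  refine Triple.assign_seq (175 * n) 0 9 1 (by omega)
    (by simp (disch := omega) [Nat.mod_eq_of_lt])
    (by simp (disch := omega) [Nat.mod_eq_of_lt]) (by simp; omega) ?_
  let Base : Store → Prop := fun μ => μ 0 3 = n ∧ μ 0 4 = C ∧ μ 0 5 = K ∧ μ 0 7 = segLen n K
  -- Variable `9` is doubled while it stays at most `n`, which takes `⌊log n⌋` rounds.
  refine Triple.seq_of (50 * n) (125 * n) (R := fun μ D => Base μ ∧ μ 0 8 = Nat.log 2 n ∧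
    μ 0 9 = 2 ^ Nat.log 2 n ∧ μ 0 13 = 0 ∧ (∀ i ≠ 0, μ i = μ₀ i) ∧ D = []) ?_ ?_ (by omega)
  · refine Triple.weaken (Triple.loop_const (fun j μ D => Base μ ∧ j ≤ Nat.log 2 n ∧ μ 0 8 = j ∧
      μ 0 9 = 2 ^ j ∧ μ 0 13 = 0 ∧ (∀ i ≠ 0, μ i = μ₀ i) ∧ D = []) (Nat.log 2 n) 20 ?_ ?_ ?_) ?_
    · refine ⟨⟨?_, ?_, ?_, ?_⟩, ?_, ?_, ?_, ?_, ?_, rfl⟩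
      · simp [h3]
      · simp [h4]
      · simp [h5]
      · simp
      · omega
      · simp [hstart]
      · simp
      · simp [hstart]
      · intro i hi
        simp (disch := omega)
    · omega
    · rintro j hj μ D ⟨⟨e3, e4, e5, e7⟩, hj', e8, e9, e13, hseg, rfl⟩
      have hpj : 2 ^ j ≤ n := (Nat.pow_le_pow_right (by norm_num) hj).trans hlog'
      have hval : value M (segLen n K) [] μ (less (reg 9 + reg 9) (reg 3 + .lit 1)) =
          if j < Nat.log 2 n then 1 else 0 := by
        simp (disch := omega) [Nat.mod_eq_of_lt, e9, e3]
        congr 1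
        rw [eq_iff_iff, ← two_mul, ← pow_succ',
          ← Nat.le_log_iff_pow_le (by norm_num) (by omega)]
        omega
      rw [hval]
      split_ifs with hjl
      · refine ⟨fun h => absurd h (by simp), fun _ => ⟨hjl, ?_⟩⟩
        refine Triple.assign_seq 8 0 9 (2 ^ (j + 1)) (by omega)
          (by simp (disch := omega) [Nat.mod_eq_of_lt])
          (by simp (disch := omega) [Nat.mod_eq_of_lt, e9]; ring) (by simp) ?_
        refine Triple.weaken (Triple.assign 0 8 (j + 1) (by omega)
          (by simp (disch := omega) [Nat.mod_eq_of_lt])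
          (by simp (disch := omega) [Nat.mod_eq_of_lt, e8]) ?_) (by simp)
        refine ⟨⟨by simp [e3], by simp [e4], by simp [e5], by simp [e7]⟩, hjl, by simp, by simp,
          by simp [e13], fun i hi => by simp (disch := omega) [hseg], rfl⟩
      · obtain rfl : j = Nat.log 2 n := by omega
        exact ⟨fun _ => ⟨⟨e3, e4, e5, e7⟩, e8, e9, e13, hseg, rfl⟩, fun h => absurd rfl h⟩
    · simp
      omega
  rintro μ₁ D₁ ⟨⟨e3, e4, e5, e7⟩, e8, e9, e13, hseg, rfl⟩
  refine Triple.seq_of (50 * n) (75 * n) (R := fun μ D => Base μ ∧ μ 0 8 = Nat.log 2 n ∧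
    μ 0 9 = 2 ^ Nat.log 2 n ∧ (∀ i < n, μ 6 i = i) ∧ (∀ i ≠ 0, i ≠ 6 → μ i = μ₀ i) ∧ D = [])
    ?_ ?_ (by omega)
  · refine Triple.weaken (Triple.loop_const (fun j μ D => Base μ ∧ μ 0 8 = Nat.log 2 n ∧
      μ 0 9 = 2 ^ Nat.log 2 n ∧ μ 0 13 = j ∧ (∀ i < j, μ 6 i = i) ∧
      (∀ i ≠ 0, i ≠ 6 → μ i = μ₀ i) ∧ D = []) n 25 ?_ ?_ ?_) ?_
    · exact ⟨⟨e3, e4, e5, e7⟩, e8, e9, e13, by simp, fun i hi _ => hseg i hi, rfl⟩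
    · omega
    · rintro j hj μ D ⟨⟨e3, e4, e5, e7⟩, e8, e9, e13, h6, hseg, rfl⟩
      have hval : value M (segLen n K) [] μ (less (reg 13) (reg 3)) = if j < n then 1 else 0 := by
        simp (disch := omega) [Nat.mod_eq_of_lt, e13, e3]
      rw [hval]
      split_ifs with hjl
      · refine ⟨fun h => absurd h (by simp), fun _ => ⟨hjl, ?_⟩⟩
        refine Triple.assign_seq 10 6 j j (by omega)
          (by simp (disch := omega) [Nat.mod_eq_of_lt, e7, e13])
          (by simp (disch := omega) [Nat.mod_eq_of_lt, e13]) (by simp) ?_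
        refine Triple.weaken (Triple.assign 0 13 (j + 1) (by omega)
          (by simp (disch := omega) [Nat.mod_eq_of_lt])
          (by simp (disch := omega) [Nat.mod_eq_of_lt, e13]) ?_) (by simp)
        refine ⟨⟨by simp [e3], by simp [e4], by simp [e5], by simp [e7]⟩, by simp [e8],
          by simp [e9], by simp, fun i hi => ?_, fun i hi hi' => by
            simp (disch := omega) [hseg], rfl⟩
        by_cases hij : i = j
        · simp [hij]
        · simp [hij, h6 i (by omega)]
      · obtain rfl : j = n := by omega
        exact ⟨fun _ => ⟨⟨e3, e4, e5, e7⟩, e8, e9, h6, hseg, rfl⟩, fun h => absurd rfl h⟩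
    · simp
      omega
  rintro μ₂ D₂ ⟨⟨e3, e4, e5, e7⟩, e8, e9, h6, hseg, rfl⟩
  refine Triple.assign_seq (70 * n) 0 10 n (by omega)
    (by simp (disch := omega) [Nat.mod_eq_of_lt])
    (by simp (disch := omega) [Nat.mod_eq_of_lt, e3]) (by simp; omega) ?_
  refine Triple.assign_seq (60 * n) 0 14 1 (by omega)
    (by simp (disch := omega) [Nat.mod_eq_of_lt])
    (by simp (disch := omega) [Nat.mod_eq_of_lt]) (by simp; omega) ?_
  · refine Triple.weaken (Triple.loop_const (fun j μ D => Base μ ∧ μ 0 8 = Nat.log 2 n ∧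
      μ 0 9 = 2 ^ Nat.log 2 n ∧ μ 0 10 = n ∧ (∀ i < n, μ 6 i = i) ∧ μ 0 14 = j + 1 ∧
      μ 7 0 = 0 ∧ (∀ i, i ≠ 0 → i < j + 1 → μ 7 i = n) ∧
      (∀ i ≠ 0, i ≠ 6 → i ≠ 7 → μ i = μ₀ i) ∧ D = []) (Nat.log 2 n) 25 ?_ ?_ ?_) ?_
    · refine ⟨⟨by simp [e3], by simp [e4], by simp [e5], by simp [e7]⟩, by simp [e8], by simp [e9],
        by simp, fun i hi => by simp [h6 i hi], by simp, ?_, fun i hi hi' => absurd hi' (by omega),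
        fun i hi hi' _ => by simp (disch := omega) [hseg], rfl⟩
      simp [hseg, hstart]
    · omega
    · rintro j hj μ D ⟨⟨e3, e4, e5, e7⟩, e8, e9, e10, h6, e14, h70, h7, hseg, rfl⟩
      have hval : value M (segLen n K) [] μ (less (reg 14) (reg 8 + .lit 1)) =
          if j < Nat.log 2 n then 1 else 0 := by
        simp (disch := omega) [Nat.mod_eq_of_lt, e14, e8]
      rw [hval]
      split_ifs with hjl
      · refine ⟨fun h => absurd h (by simp), fun _ => ⟨hjl, ?_⟩⟩
        refine Triple.assign_seq 10 7 (j + 1) n (by omega)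
          (by simp (disch := omega) [Nat.mod_eq_of_lt, e7, e14])
          (by simp (disch := omega) [Nat.mod_eq_of_lt, e3]) (by simp) ?_
        refine Triple.weaken (Triple.assign 0 14 (j + 1 + 1) (by omega)
          (by simp (disch := omega) [Nat.mod_eq_of_lt])
          (by simp (disch := omega) [Nat.mod_eq_of_lt, e14]) ?_) (by simp)
        refine ⟨⟨by simp [e3], by simp [e4], by simp [e5], by simp [e7]⟩, by simp [e8],
          by simp [e9], by simp [e10], fun i hi => by simp [h6 i hi], by simp, by simp [h70],
          fun i hi hi' => ?_, fun i hi hi' hi'' => by simp (disch := omega) [hseg], rfl⟩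
        by_cases hij : i = j + 1
        · simp [hij]
        · simp [hij, h7 i hi (by omega)]
      · obtain rfl : j = Nat.log 2 n := by omega
        refine ⟨fun _ => ⟨?_, fun x => ?_, rfl⟩, fun h => absurd rfl h⟩
        · constructor
          · exact e3
          · exact e4
          · exact e5
          · exact e7
          · exact e8
          · exact e9
          · simp [Layers.initial, e10]
          · intro v
            rw [hseg 1 (by omega) (by omega) (by omega)]
            exact hstart _ _ (by omega)
          · intro v
            rw [hseg 2 (by omega) (by omega) (by omega)]
            exact hstart _ _ (by omega)
          · intro v
            rw [hseg 4 (by omega) (by omega) (by omega)]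
            exact hstart _ _ (by omega)
          · intro v i hi
            simp [Layers.initial] at hi
          · intro i hi
            have hi' : i < n := by simpa [Layers.initial] using hi
            simp [Layers.initial, h6 i hi']
          · intro i hi
            by_cases hi0 : i = 0
            · simp [Layers.initial, hi0, h70]
            · simp [Layers.initial, hi0, h7 i hi0 (by omega)]
          · intro v
            simp [Layers.initial]
          · simp only [Layers.initial, List.length_finRange]
            nlinarith
        · rw [hseg 9 (by omega) (by omega) (by omega)]
          exact hstart _ _ (by omega)
    · simp
      omega

end

section

/-! ### Holding the graph of recent edges in the dynamic black box -/

/-- The history `D` of the dynamic black box leads to the graph of all edges of `G` that both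
endpoints have among their recent insertions `ρ`, and the numbers `m` flag the edges of this
graph. -/
structure Held (Δ : ℕ) (G : SimpleGraph (Fin n)) (ρ : Fin n → List (Fin n)) (m : ℕ → ℕ)
    (D : List (Update n)) : Prop where
  legal : IsHistory (MaxDegreeLE Δ) D
  flag : ∀ u v : Fin n, m (u * n + v) ≠ 0 ↔ (graphOf D).Adj u v
  adj : ∀ u v, (graphOf D).Adj u v ↔ G.Adj u v ∧ v ∈ ρ u ∧ u ∈ ρ v

theorem edge_index_inj {u v a b : Fin n} : (u : ℕ) * n + v = a * n + b ↔ u = a ∧ v = b := by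
  constructor
  · intro h
    have hn : 0 < n := u.pos
    have h1 := congrArg (· / n) h
    have h2 := congrArg (· % n) h
    simp only [mul_comm _ n, Nat.mul_add_div hn, Nat.mul_add_mod, Nat.div_eq_of_lt v.isLt,
      Nat.div_eq_of_lt b.isLt, Nat.mod_eq_of_lt v.isLt, Nat.mod_eq_of_lt b.isLt, add_zero] at h1 h2
    exact ⟨Fin.ext h1, Fin.ext h2⟩
  · rintro ⟨rfl, rfl⟩
    rfl

/-- A graph whose edges lead to recent partners has small degrees. -/
theorem MaxDegreeLE.of_recent {Δ : ℕ} {H : SimpleGraph (Fin n)} {ρ : Fin n → List (Fin n)}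
    (hρ : ∀ v, (ρ v).length ≤ Δ) (h : ∀ u v, H.Adj u v → v ∈ ρ u) : MaxDegreeLE Δ H := by
  intro v
  refine le_trans ?_ ((List.toFinset_card_le (ρ v)).trans (hρ v))
  rw [← Set.ncard_coe_finset]
  refine Set.ncard_le_ncard (fun w hw => ?_) (Finset.finite_toSet _)
  simpa using h v w hw

theorem MaxDegreeLE.mono {Δ : ℕ} {H H' : SimpleGraph (Fin n)} (h : MaxDegreeLE Δ H)
    (hH : H' ≤ H) : MaxDegreeLE Δ H' := fun v =>
  (Set.ncard_le_ncard (fun _ hw => hH hw) (Set.toFinite _)).trans (h v)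

variable {M : Machine n} {G : SimpleGraph (Fin n)} {C K fuel Δ : ℕ}

/-- Remove the edge between the vertices in variables `a` and `b` from the graph of the dynamic
black box, if it is there. -/
def dropCode (a b : ℕ) : Prog :=
  .ite (item 9 (reg a * reg 3 + reg b))
    (slot 9 (reg a * reg 3 + reg b) ::= .lit 0 ;; slot 9 (reg b * reg 3 + reg a) ::= .lit 0 ;;
      .callDelete (reg a) (reg b))
    .skip

/-- Since the edge is deleted only when its flag is set, all deletions are legal. -/
theorem dropCode_spec (hF : Fits M K fuel) {a b : ℕ} (ha : a < 32) (hb : b < 32) {u v : Fin n}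
    {μ : Store} {D : List (Update n)} (h3 : μ 0 3 = n) (h7 : μ 0 7 = segLen n K) (hu : μ 0 a = u)
    (hv : μ 0 b = v) (hD : IsHistory (MaxDegreeLE Δ) D)
    (hflag : ∀ u v : Fin n, μ 9 (u * n + v) ≠ 0 ↔ (graphOf D).Adj u v) :
    Triple M G fuel (segLen n K) (dropCode a b) μ D 60 fun μ' D' =>
      (∀ i, i ≠ 9 → μ' i = μ i) ∧ IsHistory (MaxDegreeLE Δ) D' ∧
      (∀ u v : Fin n, μ' 9 (u * n + v) ≠ 0 ↔ (graphOf D').Adj u v) ∧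
      graphOf D' = graphOf D \ SimpleGraph.edge u v ∧ (∃ l, D' = l ++ D) ∧
      D'.length ≤ D.length + 1 := by
  have hZ := segLen_ge n K
  have hW := hF.le_W
  have huv := edge_lt_segLen (K := K) u v
  have hvu := edge_lt_segLen (K := K) v u
  have hval : value M (segLen n K) D μ (item 9 (reg a * reg 3 + reg b)) = μ 9 (u * n + v) := by
    simp (disch := omega) [Nat.mod_eq_of_lt, hu, hv, h3, h7]
  refine Triple.weaken (Triple.ite (c := 40) ?_ ?_) (by simp)
  · intro h
    rw [hval] at h
    have hadj : ¬ (graphOf D).Adj u v := fun hadj => (hflag u v).2 hadj h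
    refine Triple.weaken (Triple.skip ?_) (by norm_num)
    refine ⟨fun _ _ => rfl, hD, hflag, ?_, ⟨[], rfl⟩, by omega⟩
    ext x y
    simp only [SimpleGraph.sdiff_adj, SimpleGraph.edge_adj]
    refine ⟨fun hxy => ⟨hxy, ?_⟩, fun hxy => hxy.1⟩
    rintro ⟨⟨rfl, rfl⟩ | ⟨rfl, rfl⟩, -⟩
    · exact hadj hxy
    · exact hadj hxy.symm
  · intro h
    rw [hval] at h
    have hadj : (graphOf D).Adj u v := (hflag u v).1 h
    refine Triple.assign_seq 25 9 (u * n + v) 0 huv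
      (by simp (disch := omega) [Nat.mod_eq_of_lt, hu, hv, h3, h7]) (by simp) (by simp) ?_
    refine Triple.assign_seq 10 9 (v * n + u) 0 hvu
      (by simp (disch := omega) [Nat.mod_eq_of_lt, hu, hv, h3, h7]) (by simp) (by simp) ?_
    refine Triple.weaken (Triple.callDelete (u := u) (v := v)
      (by simp (disch := omega) [Nat.mod_eq_of_lt, hu])
      (by simp (disch := omega) [Nat.mod_eq_of_lt, hv]) ?_) (by simp)
    refine ⟨fun i hi => by simp (disch := omega), ⟨hadj, ?_, hD⟩, ?_, rfl, ⟨[_], rfl⟩, by simp⟩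
    · have : MaxDegreeLE Δ (graphOf D) := by cases D <;> [exact hD; exact hD.2.1]
      exact this.mono sdiff_le
    · intro x y
      simp only [graphOf, Update.apply, SimpleGraph.sdiff_adj, SimpleGraph.edge_adj, ← hflag x y,
        Store.set_same, Function.update_apply, edge_index_inj]
      by_cases h1 : x = v ∧ y = u
      · obtain ⟨rfl, rfl⟩ := h1
        simp [hadj.ne']
      · by_cases h2 : x = u ∧ y = v
        · obtain ⟨rfl, rfl⟩ := h2
          simp [hadj.ne]
        · simp [h1, h2]

/-- Insert the new edge into the graph of the dynamic black box. -/
def detInsert : Prog :=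
  slot 9 (reg 1 * reg 3 + reg 2) ::= .lit 1 ;;
  slot 9 (reg 2 * reg 3 + reg 1) ::= .lit 1 ;;
  .callInsert (reg 1) (reg 2)

theorem detInsert_spec (hF : Fits M K fuel) {σ : Layers n} (hs : σ.Settled K) (hKΔ : K ≤ Δ)
    {u v : Fin n} {μ : Store} {D : List (Update n)} (hc : Core C K (σ.record u v) μ)
    (huv : u ≠ v) (hnew : ¬ G.Adj u v)
    (hu : μ 0 1 = u) (hv : μ 0 2 = v) (hH : Held Δ G σ.recent (μ 9) D)
    {G' : SimpleGraph (Fin n)} :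
    Triple M G' fuel (segLen n K) detInsert μ D 60 fun μ' D' => Core C K (σ.record u v) μ' ∧
      μ' 0 = μ 0 ∧ Held Δ (G ⊔ SimpleGraph.edge u v) (σ.record u v).recent (μ' 9) D' ∧
      D' = .insert u v :: D := by
  have hZ := segLen_ge n K
  have hW := hF.le_W
  have h1 := edge_lt_segLen (K := K) u v
  have h2 := edge_lt_segLen (K := K) v u
  refine Triple.assign_seq 30 9 (u * n + v) 1 h1
    (by simp (disch := omega) [Nat.mod_eq_of_lt, hu, hv, hc.n_eq, hc.Z_eq])
    (by simp (disch := omega) [Nat.mod_eq_of_lt]) (by simp) ?_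
  refine Triple.assign_seq 10 9 (v * n + u) 1 h2
    (by simp (disch := omega) [Nat.mod_eq_of_lt, hu, hv, hc.n_eq, hc.Z_eq])
    (by simp (disch := omega) [Nat.mod_eq_of_lt]) (by simp) ?_
  refine Triple.weaken (Triple.callInsert (u := u) (v := v)
    (by simp (disch := omega) [Nat.mod_eq_of_lt, hu])
    (by simp (disch := omega) [Nat.mod_eq_of_lt, hv]) ?_) (by simp)
  have hadj : ∀ a b, (graphOf (.insert u v :: D)).Adj a b ↔ (G ⊔ SimpleGraph.edge u v).Adj a b ∧
      b ∈ (σ.record u v).recent a ∧ a ∈ (σ.record u v).recent b := by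
    intro a b
    simp only [graphOf, Update.apply, SimpleGraph.sup_adj, SimpleGraph.edge_adj, hH.adj a b,
      Layers.mem_record_recent σ huv]
    have hnew' : ¬ G.Adj v u := fun h => hnew h.symm
    by_cases hab : (a = u ∧ b = v) ∨ (a = v ∧ b = u)
    · rcases hab with ⟨rfl, rfl⟩ | ⟨rfl, rfl⟩ <;> simp [huv, huv.symm]
    · obtain ⟨h1, h2⟩ := not_or.1 hab
      have h3 : ¬ (b = u ∧ a = v) := fun h => h2 h.symm
      have h4 : ¬ (b = v ∧ a = u) := fun h => h1 h.symm
      simp [h1, h2, h3, h4]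
  refine ⟨(hc.set _ (by omega)).set _ (by omega), by simp, ⟨⟨⟨huv, ?_⟩, ?_, hH.legal⟩, ?_, hadj⟩,
    rfl⟩
  · rw [hH.adj]
    exact fun h => hnew h.1
  · exact MaxDegreeLE.of_recent (fun w => ((hs.valid_record huv).length_recent w).trans hKΔ)
      fun a b hab => ((hadj a b).1 hab).2.1
  · intro a b
    simp only [graphOf, Update.apply, SimpleGraph.sup_adj, SimpleGraph.edge_adj, ← hH.flag a b,
      Store.set_same, Function.update_apply, edge_index_inj]
    by_cases h1 : a = v ∧ b = u
    · obtain ⟨rfl, rfl⟩ := h1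
      simp [huv.symm]
    · by_cases h2 : a = u ∧ b = v
      · obtain ⟨rfl, rfl⟩ := h2
        simp [huv]
      · simp [h1, h2]

/-- The lists of recent insertions are kept when an edge is deleted. -/
theorem detDelete_spec (hF : Fits M K fuel) {σ : Layers n} {u v : Fin n} {μ : Store}
    {D : List (Update n)} (hc : Core C K σ μ) (hu : μ 0 1 = u) (hv : μ 0 2 = v)
    (hH : Held Δ G σ.recent (μ 9) D) {G' : SimpleGraph (Fin n)} :
    Triple M G' fuel (segLen n K) (dropCode 1 2) μ D 60 fun μ' D' => Core C K σ μ' ∧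
      Held Δ (G \ SimpleGraph.edge u v) σ.recent (μ' 9) D' ∧ (∃ l, D' = l ++ D) ∧
      D'.length ≤ D.length + 1 := by
  refine (dropCode_spec hF (by norm_num) (by norm_num) hc.n_eq hc.Z_eq hu hv hH.legal
    hH.flag).mono le_rfl ?_
  rintro μ' D' ⟨hseg, hD, hflag, hgr, hl, hlen⟩
  refine ⟨?_, ⟨hD, hflag, fun a b => ?_⟩, hl, hlen⟩
  · obtain ⟨e0, e1, e2, e4, e5, e6, e7⟩ : μ' 0 = μ 0 ∧ μ' 1 = μ 1 ∧ μ' 2 = μ 2 ∧ μ' 4 = μ 4 ∧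
      μ' 5 = μ 5 ∧ μ' 6 = μ 6 ∧ μ' 7 = μ 7 := by
      refine ⟨?_, ?_, ?_, ?_, ?_, ?_, ?_⟩ <;> exact hseg _ (by norm_num)
    constructor <;> try simp only [e0, e1, e2, e4, e5, e6, e7]
    exacts [hc.n_eq, hc.C_eq, hc.K_eq, hc.Z_eq, hc.I_eq, hc.P_eq, hc.top_eq, hc.level_eq,
      hc.base_eq, hc.count_eq, hc.recent_eq, hc.stack_eq, hc.start_eq, hc.recent_le, hc.stack_le]
  · rw [hgr]
    simp only [SimpleGraph.sdiff_adj, hH.adj a b]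
    tauto

/-- Before the vertices are moved, remove the edges at these vertices from the graph of the dynamic
black box, and clear their lists of recent insertions. -/
def detMove : Prog :=
  .lit 13 ::= .lit 0 ;;
  .loop (less (reg 13) (reg 15))
    (.lit 16 ::= item 6 (reg 18 + reg 13) ;;
      .lit 14 ::= .lit 0 ;;
      .loop (less (reg 14) (item 4 (reg 16)))
        (.lit 17 ::= item 5 (reg 16 * reg 5 + reg 14) ;; dropCode 16 17 ;;
          .lit 14 ::= reg 14 + .lit 1) ;;
      slot 4 (reg 16) ::= .lit 0 ;;
      .lit 13 ::= reg 13 + .lit 1)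

theorem Ready.congr {σ : Layers n} {k : ℕ} {L : List (Fin n)} {f : Fin n → ℕ} {μ μ' : Store}
    (h : Ready C K σ k L f μ) (hseg : ∀ i, i ≠ 9 → μ' i = μ i) : Ready C K σ k L f μ' := by
  obtain ⟨e0, e1, e2, e4, e5, e6, e7, e8⟩ : μ' 0 = μ 0 ∧ μ' 1 = μ 1 ∧ μ' 2 = μ 2 ∧ μ' 4 = μ 4 ∧
      μ' 5 = μ 5 ∧ μ' 6 = μ 6 ∧ μ' 7 = μ 7 ∧ μ' 8 = μ 8 := by
    refine ⟨?_, ?_, ?_, ?_, ?_, ?_, ?_, ?_⟩ <;> exact hseg _ (by norm_num)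
  constructor
  · constructor <;> try simp only [e0, e1, e2, e4, e5, e6, e7]
    exacts [h.n_eq, h.C_eq, h.K_eq, h.Z_eq, h.I_eq, h.P_eq, h.top_eq, h.level_eq,
      h.base_eq, h.count_eq, h.recent_eq, h.stack_eq, h.start_eq, h.recent_le, h.stack_le]
  all_goals try simp only [e0, e8]
  exacts [h.part_eq, h.le_log, h.start_le, h.level_var, h.length_var, h.start_var, h.color_eq]

theorem Layers.forget_append (σ : Layers n) (L : List (Fin n)) (x : Fin n) :
    σ.forget (L ++ [x]) = (σ.forget L).forget [x] := by
  simp only [Layers.forget, Layers.mk.injEq, true_and, and_true]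
  funext y
  by_cases hy : y = x <;> by_cases hL : y ∈ L <;> simp [hy, hL]

theorem Ready.forget {σ : Layers n} {k : ℕ} {L : List (Fin n)} {f : Fin n → ℕ} {μ : Store}
    (h : Ready C K σ k L f μ) (x : Fin n) : Ready C K (σ.forget [x]) k L f (μ.set 4 x 0) := by
  have hx : ∀ v : Fin n, (v : ℕ) = x ↔ v = x := fun v => Fin.ext_iff.symm
  constructor
  · constructor
    · simp [h.n_eq]
    · simp [h.C_eq]
    · simp [h.K_eq]
    · simp [h.Z_eq]
    · simp [h.I_eq]
    · simp [h.P_eq]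
    · simp [h.top_eq, Layers.forget]
    · simpa [Layers.forget] using h.level_eq
    · simpa [Layers.forget] using h.base_eq
    · intro v
      by_cases hv : v = x
      · simp [Layers.forget, hv]
      · simp [Layers.forget, hx, hv, h.count_eq]
    · intro v i hi
      by_cases hv : v = x
      · simp [Layers.forget, hv] at hi
      · have hi' : i < (σ.recent v).length := by simpa [Layers.forget, hv] using hi
        simp [Layers.forget, hv, h.recent_eq v i hi']
    · intro i hi
      have hi' : i < σ.stack.length := hi
      simp [Layers.forget, h.stack_eq i hi']
    · intro j hj
      simp [Layers.forget, h.start_eq j hj]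
    · intro v
      by_cases hv : v = x
      · simp [Layers.forget, hv]
      · simpa [Layers.forget, hv] using h.recent_le v
    · exact h.stack_le
  · exact h.part_eq
  · exact h.le_log
  · exact h.start_le
  · simp [h.level_var]
  · simp [h.length_var]
  · simp [h.start_var, Layers.forget]
  · simpa using h.color_eq

/-- Removing, one after the other, the edges at `x` to its recent partners. -/
theorem detMove_inner (hF : Fits M K fuel) {σ : Layers n} {k : ℕ} {L : List (Fin n)}
    {f : Fin n → ℕ} {x : Fin n} {μ : Store} {D : List (Update n)} (hr : Ready C K σ k L f μ)
    (h16 : μ 0 16 = x) (h14 : μ 0 14 = 0) (hH : Held Δ G σ.recent (μ 9) D)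
    {G' : SimpleGraph (Fin n)} :
    Triple M G' fuel (segLen n K) (.loop (less (reg 14) (item 4 (reg 16)))
        (.lit 17 ::= item 5 (reg 16 * reg 5 + reg 14) ;; dropCode 16 17 ;;
          .lit 14 ::= reg 14 + .lit 1)) μ D (120 * (σ.recent x).length + 20) fun μ' D' =>
      Ready C K σ k L f μ' ∧ μ' 0 16 = x ∧ μ' 0 13 = μ 0 13 ∧
        Held Δ G (σ.forget [x]).recent (μ' 9) D' ∧ (∃ l, D' = l ++ D) ∧
        D'.length ≤ D.length + (σ.recent x).length := by
  have hZ := segLen_ge n K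
  have hW := hF.le_W
  have hfuel := hF.le_fuel
  have hrec := hr.recent_le x
  refine Triple.weaken (Triple.loop_const (fun j μ' D' => Ready C K σ k L f μ' ∧ μ' 0 16 = x ∧
    μ' 0 13 = μ 0 13 ∧ μ' 0 14 = j ∧ IsHistory (MaxDegreeLE Δ) D' ∧
    (∀ u v : Fin n, μ' 9 (u * n + v) ≠ 0 ↔ (graphOf D').Adj u v) ∧
    (∀ a b, (graphOf D').Adj a b ↔ (graphOf D).Adj a b ∧ ¬ (a = x ∧ b ∈ (σ.recent x).take j) ∧
      ¬ (b = x ∧ a ∈ (σ.recent x).take j)) ∧ (∃ l, D' = l ++ D) ∧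
    D'.length ≤ D.length + j) (σ.recent x).length 100 ?_ ?_ ?_) ?_
  · exact ⟨hr, h16, rfl, h14, hH.legal, hH.flag, by simp, ⟨[], rfl⟩, le_rfl⟩
  · omega
  · rintro j hj μ' D' ⟨hr', h16', h13', h14', hD', hflag, hadj, ⟨l, rfl⟩, hlen⟩
    have hcnt := hr'.count_eq x
    have hval : value M (segLen n K) (l ++ D) μ' (less (reg 14) (item 4 (reg 16))) =
        if j < (σ.recent x).length then 1 else 0 := by
      have := x.isLt
      simp (disch := omega) [Nat.mod_eq_of_lt, hr'.Z_eq, h16', h14', hcnt]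
    rw [hval]
    split_ifs with hjl
    · refine ⟨fun h => absurd h (by simp), fun _ => ⟨hjl, ?_⟩⟩
      have hidx := pair_lt_segLen (K := K) x (i := j) (by omega)
      have hxj := hr'.recent_eq x j hjl
      refine Triple.assign_seq 80 0 17 ((σ.recent x)[j] : Fin n) (by omega)
        (by simp (disch := omega) [Nat.mod_eq_of_lt])
        (by simp (disch := omega) [Nat.mod_eq_of_lt, hr'.Z_eq, hr'.K_eq, h16', h14', hxj])
        (by simp) ?_
      refine Triple.seq_of 60 20 (dropCode_spec hF (by norm_num) (by norm_num)
        (by simp [hr'.n_eq]) (by simp [hr'.Z_eq]) (u := x) (v := (σ.recent x)[j]) (by simp [h16'])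
        (by simp) hD' (by simpa using hflag)) ?_ (by norm_num)
      rintro μ₁ D₁ ⟨hseg, hD₁, hflag₁, hgr, ⟨l', rfl⟩, hlen₁⟩
      have hseg0 := hseg 0 (by norm_num)
      refine Triple.weaken (Triple.assign 0 14 (j + 1) (by omega)
        (by simp (disch := omega) [Nat.mod_eq_of_lt])
        (by simp (disch := omega) [Nat.mod_eq_of_lt, hseg0, h14']) ?_) (by simp)
      refine ⟨((hr'.set (i := 0) (x := 17) ((σ.recent x)[j] : Fin n) (by omega)).congr
        hseg).set _ (by omega), by simp [hseg0, h16'], by simp [hseg0, h13'], by simp, hD₁,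
        by simpa using hflag₁, ?_, ⟨l' ++ l, by simp⟩, by omega⟩
      intro a b
      rw [hgr, SimpleGraph.sdiff_adj, hadj, SimpleGraph.edge_adj,
        List.take_succ_eq_append_getElem hjl]
      by_cases hne : (graphOf D).Adj a b
      · have hab := hne.ne
        simp only [hne, List.mem_append, List.mem_singleton, true_and]
        tauto
      · simp [hne]
    · obtain rfl : j = (σ.recent x).length := by omega
      refine ⟨fun _ => ⟨hr', h16', h13', ⟨hD', hflag, fun a b => ?_⟩, ⟨l, rfl⟩, hlen⟩,
        fun h => absurd rfl h⟩
      rw [hadj, hH.adj, List.take_length]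
      simp only [Layers.forget, List.mem_singleton]
      by_cases ha : a = x
      · subst ha
        simp
        tauto
      · by_cases hb : b = x
        · subst hb
          simp [ha]
        · simp [ha, hb]
  · simp
    omega

/-- The work and the updates of the dynamic black box are paid for by the recent insertions that are
forgotten. -/
theorem detMove_spec (hF : Fits M K fuel) {σ : Layers n} {k : ℕ} {L : List (Fin n)}
    {f : Fin n → ℕ} {μ : Store} {D : List (Update n)} (hr : Ready C K σ k L f μ)
    (hH : Held Δ G σ.recent (μ 9) D) {G' : SimpleGraph (Fin n)} :
    Triple M G' fuel (segLen n K) detMove μ D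
      (100 * L.length + 120 * (σ.pending - (σ.forget L).pending) + 20) fun μ' D' =>
      Ready C K (σ.forget L) k L f μ' ∧ Held Δ G (σ.forget L).recent (μ' 9) D' ∧
        (∃ l, D' = l ++ D) ∧ D'.length + (σ.forget L).pending ≤ D.length + σ.pending := by
  have hZ := segLen_ge n K
  have hW := hF.le_W
  have hfuel := hF.le_fuel
  have hlen := hr.length_eq
  have hstk := hr.stack_le
  have htel : ∀ j ≤ L.length, ∑ i ∈ Finset.range j, (if h : i < L.length then
      ((σ.forget (L.take i)).recent L[i]).length else 0) + (σ.forget (L.take j)).pending =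
        σ.pending := by
    intro j
    induction j with
    | zero => simp [Layers.forget, Layers.pending]
    | succ j ih =>
      intro hj
      rw [Finset.sum_range_succ, dif_pos (by omega), ← ih (by omega),
        List.take_succ_eq_append_getElem (by omega), ← Layers.pending_forget_append σ (L.take j)]
      ring
  refine Triple.assign_seq (100 * L.length + 120 * (σ.pending - (σ.forget L).pending) + 15) 0 13 0
    (by omega) (by simp (disch := omega) [Nat.mod_eq_of_lt]) (by simp) (by simp; omega) ?_
  refine Triple.weaken (Triple.loop (fun j μ' D' => Ready C K (σ.forget (L.take j)) k L f μ' ∧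
    Held Δ G (σ.forget (L.take j)).recent (μ' 9) D' ∧ μ' 0 13 = j ∧ (∃ l, D' = l ++ D) ∧
    D'.length + (σ.forget (L.take j)).pending ≤ D.length + σ.pending) L.length
    (fun i => 80 + 120 * (if h : i < L.length then
      ((σ.forget (L.take i)).recent L[i]).length else 0)) ?_ ?_ ?_) ?_
  · have h0 : σ.forget [] = σ := by simp [Layers.forget]
    rw [List.take_zero, h0]
    exact ⟨hr.set _ (by omega), by simpa using hH, by simp, ⟨[], rfl⟩, le_rfl⟩
  · omega
  · rintro j hj μ' D' ⟨hr', hH', h13, ⟨l, rfl⟩, hpen⟩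
    have hval : value M (segLen n K) (l ++ D) μ' (less (reg 13) (reg 15)) =
        if j < L.length then 1 else 0 := by
      simp (disch := omega) [Nat.mod_eq_of_lt, hr'.length_var, h13]
    rw [hval]
    split_ifs with hjl
    · refine ⟨fun h => absurd h (by simp), fun _ => ⟨hjl, ?_⟩⟩
      have hst := hr'.stack_at hjl
      have h18 : μ' 0 18 = σ.start k := hr'.start_var
      change μ' 6 (σ.start k + j) = _ at hst
      have hlt := (L[j]).isLt
      obtain ⟨c, hc⟩ : ∃ c, c = ((σ.forget (L.take j)).recent L[j]).length := ⟨_, rfl⟩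
      rw [← hc]
      refine Triple.assign_seq (65 + 120 * c) 0 16 (L[j] : Fin n) (by omega)
        (by simp (disch := omega) [Nat.mod_eq_of_lt])
        (by simp (disch := omega) [Nat.mod_eq_of_lt, hr'.Z_eq, h18, h13, hst])
        (by simp; omega) ?_
      refine Triple.assign_seq (60 + 120 * c) 0 14 0 (by omega)
        (by simp (disch := omega) [Nat.mod_eq_of_lt]) (by simp) (by simp; omega) ?_
      refine Triple.seq_of (120 * c + 20) 40 (hc ▸ detMove_inner hF (x := L[j])
        ((hr'.set (i := 0) (x := 16) _ (by omega)).set (i := 0) (x := 14) _ (by omega))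
        (by simp) (by simp) (by simpa using hH')) ?_ (by omega)
      rintro μ₁ D₁ ⟨hr₁, h16, h13₁, hH₁, ⟨l', rfl⟩, hlen₁⟩
      refine Triple.assign_seq 20 4 (L[j] : Fin n) 0 (by omega)
        (by simp (disch := omega) [Nat.mod_eq_of_lt, hr₁.Z_eq, h16]) (by simp) (by simp) ?_
      refine Triple.weaken (Triple.assign 0 13 (j + 1) (by omega)
        (by simp (disch := omega) [Nat.mod_eq_of_lt])
        (by simp (disch := omega) [Nat.mod_eq_of_lt, h13₁, h13]) ?_) (by simp)
      have hp := Layers.pending_forget_append σ (L.take j) L[j]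
      rw [List.take_succ_eq_append_getElem hjl]
      refine ⟨?_, ?_, by simp, ⟨l' ++ l, by simp⟩, by omega⟩
      · rw [Layers.forget_append]
        exact (hr₁.forget _).set _ (by omega)
      · rw [Layers.forget_append]
        simpa using hH₁
    · obtain rfl : j = L.length := by omega
      rw [List.take_length] at *
      exact ⟨fun _ => ⟨hr', hH', ⟨l, rfl⟩, hpen⟩, fun h => absurd rfl h⟩
  · have h1 := htel L.length le_rfl
    rw [List.take_length] at h1
    simp only [Finset.sum_add_distrib, ← Finset.mul_sum, Finset.sum_const, Finset.card_range,
      smul_eq_mul]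
    simp
    omega

end

section

/-! ### Runs of algorithms -/

/-- An invariant that holds after the preprocessing and is preserved by all updates surely holds
after every legal history. -/
theorem run_surely {P : Algorithm} {M : Machine n} {ps : List ℕ} {fuel : ℕ}
    {𝒬 : SimpleGraph (Fin n) → Prop} (Inv : List (Update n) → State n → Prop)
    (h0 : Surely (P.prepare M ps fuel) fun s => Inv [] { s with time := 0 })
    (hstep : ∀ x h s, IsHistory 𝒬 (x :: h) → Inv h s →
      Surely (P.update.exec M (graphOf (x :: h)) fuel (s.announce x)) fun s' => Inv (x :: h)
        { s' with recolorings := s.recolorings + changes (P.coloring M s) (P.coloring M s') }) :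
    ∀ h, IsHistory 𝒬 h → Surely (P.run M ps fuel h) (Inv h) := by
  intro h
  induction h with
  | nil => exact fun _ => Surely.map h0
  | cons x h ih =>
    intro hh
    refine Surely.andThen ((ih hh.2.2).mono fun s hs => ?_)
    exact Surely.map (f := fun s' : State n => { s' with
      recolorings := s.recolorings + changes (P.coloring M s) (P.coloring M s') })
        (hstep x h s hh hs)

/-- The store in which an update is announced. -/
def announced (μ : Store) : Update n → Store
  | .insert u v => ((μ.set 0 0 1).set 0 1 u).set 0 2 v
  | .delete u v => ((μ.set 0 0 0).set 0 1 u).set 0 2 v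

theorem announce_mkState {Z : ℕ} (hZ : 2 < Z) (μ : Store) (D : List (Update n)) (t r : ℕ)
    (x : Update n) : (mkState Z μ D t r).announce x = mkState Z (announced μ x) D t r := by
  have h : ∀ (μ : Store) (i y : ℕ), i < 3 → Function.update (flat Z μ) i y =
      flat Z (μ.set 0 i y) := fun μ i y hi => by
    simpa using update_flat μ 0 (x := i) y (by omega)
  cases x <;> simp [State.announce, mkState, State.write, announced, h]

theorem Core.announced {C K : ℕ} {σ : Layers n} {μ : Store} (h : Core C K σ μ) (x : Update n) :
    Core C K σ (announced μ x) := by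
  cases x <;>
    exact ((h.set _ (by omega)).set _ (by omega)).set _ (by omega)

theorem announced_seg (μ : Store) (x : Update n) {i : ℕ} (hi : i ≠ 0) : announced μ x i = μ i := by
  cases x <;> simp (disch := omega) [announced]

theorem start_eq_mkState (n C K Δ : ℕ) : State.start n [n, C, K, Δ] =
    mkState (segLen n K) (startStore n C K Δ) [] 0 0 := by
  simp only [mkState, startStore, flat_unflat]
  rfl

theorem coloring_mkState {Z : ℕ} (hZ : 2 < Z) (P : Algorithm) (M : Machine n) (μ : Store)
    (D : List (Update n)) (t r : ℕ) (v : Fin n) :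
    P.coloring M (mkState Z μ D t r) v = value M Z D (μ.set 0 0 v) P.color := by
  have h := update_flat μ 0 (x := 0) (v : ℕ) (by omega : 0 < Z)
  rw [mul_zero, zero_add] at h
  rw [← eval_mkState M Z D (μ.set 0 0 v) t r]
  simp only [Algorithm.coloring, State.write, mkState, h]

/-! ### Color changes -/

theorem changes_self (f : Fin n → ℕ) : changes f f = 0 := by simp [changes]

theorem changes_triangle (f g h : Fin n → ℕ) : changes f h ≤ changes f g + changes g h := by
  rw [changes, changes, changes, ← Finset.card_union_add_card_inter]
  refine le_trans (Finset.card_le_card fun v hv => ?_) (Nat.le_add_right _ _)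
  simp only [Finset.mem_union, Finset.mem_filter, Finset.mem_univ, true_and] at hv ⊢
  by_contra hne
  push Not at hne
  exact hv (hne.1.trans hne.2)

/-- A coloring that is determined by another coloring and by data that only change on a set `S`
changes at most `#S` times more often. -/
theorem changes_le_add_card {f g f' g' : Fin n → ℕ} (S : Finset (Fin n))
    (h : ∀ v ∉ S, f' v = g' v → f v = g v) : changes f g ≤ changes f' g' + S.card := by
  rw [changes, changes]
  refine le_trans (Finset.card_le_card fun v hv => ?_) (Finset.card_union_le _ _)
  simp only [Finset.mem_union, Finset.mem_filter, Finset.mem_univ, true_and] at hv ⊢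
  by_contra hne
  push Not at hne
  exact hv (h v hne.2 hne.1)

theorem DynamicAlgorithm.changes_append (A : DynamicAlgorithm n) (l D : List (Update n)) :
    changes (A.color D) (A.color (l ++ D)) + A.totalRecolorings D ≤
      A.totalRecolorings (l ++ D) := by
  induction l with
  | nil => simp [changes_self]
  | cons x l ih =>
    have := changes_triangle (A.color D) (A.color (l ++ D)) (A.color (x :: l ++ D))
    simp only [List.cons_append, DynamicAlgorithm.totalRecolorings] at this ⊢
    omega

theorem Layers.pending_congr {σ τ : Layers n} (h : σ.recent = τ.recent) :
    σ.pending = τ.pending := by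
  rw [pending, pending, h]

/-- The color of a vertex with respect to its level and its static color. -/
def layerColor : Expr := item 1 (reg 0) * reg 4 + item 2 (reg 0)

/-- The number that encodes the level and the static color of a vertex. -/
def Layers.code (C : ℕ) (σ : Layers n) (v : Fin n) : ℕ := σ.level v * C + σ.base v

theorem mul_add_lt_mul {a b c d : ℕ} (ha : a < c) (hb : b < d) : a * d + b < c * d := by
  calc a * d + b < a * d + d := by omega
    _ = (a + 1) * d := by ring
    _ ≤ c * d := Nat.mul_le_mul_right _ ha

theorem eq_of_mul_add_eq {a b c d m : ℕ} (hb : b < m) (hd : d < m)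
    (h : a * m + b = c * m + d) : a = c ∧ b = d := by
  have hm : 0 < m := by omega
  have h1 := congrArg (· / m) h
  have h2 := congrArg (· % m) h
  simp only [mul_comm _ m, Nat.mul_add_div hm, Nat.mul_add_mod, Nat.div_eq_of_lt hb,
    Nat.div_eq_of_lt hd, Nat.mod_eq_of_lt hb, Nat.mod_eq_of_lt hd, add_zero] at h1 h2
  exact ⟨h1, h2⟩

variable {M : Machine n} {G : SimpleGraph (Fin n)} {C K fuel Δ : ℕ}

theorem Layers.code_lt {σ : Layers n} (hv : σ.Valid K) (hs : σ.Sound C G) (v : Fin n) :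
    σ.code C v < (Nat.log 2 n + 1) * C :=
  mul_add_lt_mul (Nat.lt_succ_of_le (hv.level_le v)) (hs.base_lt v)

theorem value_layerColor (hF : Fits M K fuel) {σ : Layers n} {μ : Store} {D : List (Update n)}
    (hc : Core C K σ μ) (hv : σ.Valid K) (hs : σ.Sound C G)
    (hW' : (Nat.log 2 n + 1) * C ≤ M.W) (v : Fin n) :
    value M (segLen n K) D (μ.set 0 0 v) layerColor = σ.code C v := by
  have hZ := segLen_ge n K
  have hW := hF.le_W
  have hlt := Layers.code_lt hv hs v
  have hvn := v.isLt
  simp only [Layers.code] at hlt ⊢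
  have h1 := flat_at (μ.set 0 0 v) 1 (by omega : (v : ℕ) < segLen n K)
  rw [Store.set_ne _ _ _ (by norm_num), hc.level_eq, mul_one] at h1
  simp (disch := omega) [layerColor, Nat.mod_eq_of_lt, hc.Z_eq, hc.C_eq, h1, hc.base_eq v]

/-- A rebuild only changes the codes of the vertices that move. -/
theorem Layers.code_step {σ : Layers n} {A : StaticAlgorithm n} {x : Update n} {v : Fin n}
    (h : ∀ a b, x = .insert a b → σ.Full K a b → v ∉ (σ.pushed K a b).moving) :
    (σ.step A K G x).code C v = σ.code C v := by
  cases x with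
  | delete a b => rfl
  | insert a b =>
    rw [Layers.step]
    split_ifs with hf
    · have := h a b rfl hf
      simp only [Layers.code, Layers.rebuild_level, Layers.rebuild_base, if_neg this]
      simp
    · simp [Layers.code]

/-- The vertices that an update moves. -/
def Layers.moved (K : ℕ) (σ : Layers n) : Update n → Finset (Fin n)
  | .insert u v => if σ.Full K u v then (σ.pushed K u v).moving.toFinset else ∅
  | .delete _ _ => ∅

theorem Layers.code_step_of_notMem {σ : Layers n} {A : StaticAlgorithm n} {x : Update n}
    {v : Fin n} (h : v ∉ σ.moved K x) : (σ.step A K G x).code C v = σ.code C v := by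
  refine Layers.code_step fun a b hx hf => ?_
  subst hx
  simpa [Layers.moved, hf] using h

theorem Layers.Settled.card_moved_le {σ : Layers n} (hs : σ.Settled K) {x : Update n}
    (hx : x.Legal G) : (σ.moved K x).card ≤ σ.weight K (fun k => n / 2 ^ k) x := by
  cases x with
  | delete u v => simp [Layers.moved]
  | insert u v =>
    simp only [Layers.moved, Layers.weight]
    split_ifs
    · exact (List.toFinset_card_le _).trans (hs.valid_pushed hx.1).length_moving
    · simp

/-! ### The deterministic algorithm -/

/-- The deterministic algorithm: the color of a vertex consists of its level, its static color and
its color in the dynamic black box, which holds the graph of recent edges. -/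
def detAlgorithm : Algorithm where
  preprocess := setupCode
  update := updateCode detInsert (dropCode 1 2) detMove
  color := .dynColor (reg 0) * ((reg 8 + .lit 1) * reg 4) + layerColor

theorem detAlgorithm_deterministic : detAlgorithm.Deterministic := by
  simp [Algorithm.Deterministic, detAlgorithm, setupCode, updateCode, recordCode, noteCode,
    fillCode, pushCode, detInsert, dropCode, detMove, prepareCode, seekCode, commitCode,
    Prog.NoRandom]

/-- One update of the deterministic algorithm. Every recent insertion carries a potential of `200` steps
and of one update of the dynamic black box; an insertion creates two of them. -/
theorem detUpdate_spec (hF : Fits M K fuel) (hT : Monotone M.T) (hT' : ∀ m, m ≤ M.T m)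
    (hlt : ∀ S v, v ∈ S → M.static G S v < M.W) (hKΔ : K ≤ Δ) {σ : Layers n} (hs : σ.Settled K)
    {μ : Store} {D : List (Update n)} (hc : Core C K σ μ) {G₀ : SimpleGraph (Fin n)}
    {x : Update n} (hx : x.Legal G₀) (hG : G = x.apply G₀) (hH : Held Δ G₀ σ.recent (μ 9) D) :
    ∃ c, c + 200 * (σ.step M.static K G x).pending ≤ 200 * σ.pending + 2000 +
        2000 * σ.weight K (fun k => M.T (n / 2 ^ k)) x ∧
      Triple M G fuel (segLen n K) detAlgorithm.update (announced μ x) D c fun μ' D' =>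
        Core C K (σ.step M.static K G x) μ' ∧
        Held Δ G (σ.step M.static K G x).recent (μ' 9) D' ∧ (∃ l, D' = l ++ D) ∧
        D'.length + (σ.step M.static K G x).pending ≤ D.length + σ.pending + 3 := by
  have hc' := hc.announced x
  have h9 := announced_seg μ x (i := 9) (by norm_num)
  cases x with
  | delete u v =>
    refine ⟨63, by simp [Layers.step, Layers.weight]; omega, ?_⟩
    refine updateCode_delete hF (by simp [announced]) ?_
    refine (detDelete_spec hF hc' (u := u) (v := v) (by simp [announced]) (by simp [announced])
      (by rw [h9]; exact hH)).mono le_rfl ?_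
    rintro μ' D' ⟨hc₁, hH₁, hl, hlen⟩
    subst hG
    exact ⟨hc₁, hH₁, hl, by simp only [Layers.step]; omega⟩
  | insert u v =>
    have huv : u ≠ v := hx.1
    have hpush : (σ.pushed K u v).pending = σ.pending + 2 := by
      rw [← Layers.pending_record σ huv]
      exact Layers.pending_congr (by simp)
    have hforget := Layers.pending_forget_le (σ.pushed K u v) (σ.pushed K u v).moving
    obtain ⟨hcost, -, -⟩ := Layers.length_moving_le_cost hT hT' (hs.valid_pushed huv) hF.two_le
    have key := updateCode_insert (onInsert := detInsert) (onDelete := dropCode 1 2)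
      (onMove := detMove) (cI := 60) (cM := 100 * (σ.pushed K u v).moving.length + 120 *
        ((σ.pushed K u v).pending - ((σ.pushed K u v).forget (σ.pushed K u v).moving).pending) + 20)
      hF hT hT' hlt hs hc' huv (by simp [announced]) (by simp [announced]) (by simp [announced])
      (fun _ m D' => D' = .insert u v :: D ∧ Held Δ G (σ.record u v).recent m D')
      (fun _ m D' => Held Δ G ((σ.pushed K u v).forget (σ.pushed K u v).moving).recent m D' ∧
        (∃ l, D' = l ++ D) ∧
        D'.length + ((σ.pushed K u v).forget (σ.pushed K u v).moving).pending ≤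
          D.length + 1 + (σ.pushed K u v).pending) (D := D) ?_ ?_
    · refine ⟨_, ?_, key.mono le_rfl ?_⟩
      · simp only [Layers.step, stepCost, Layers.weight]
        split_ifs with hf
        · rw [Layers.pending_rebuild]
          omega
        · omega
      · rintro μ' D' ⟨hc₁, h₁⟩
        refine ⟨hc₁, ?_⟩
        simp only [Layers.step]
        split_ifs at h₁ ⊢ with hf
        · obtain ⟨hH₁, hl, hlen⟩ := h₁
          refine ⟨?_, hl, ?_⟩
          · have hrec : ((σ.pushed K u v).rebuild M.static G).recent =
                ((σ.pushed K u v).forget (σ.pushed K u v).moving).recent := by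
              funext y
              rw [Layers.rebuild_recent]
              rfl
            rwa [hrec]
          · rw [Layers.pending_rebuild]
            omega
        · obtain ⟨rfl, hH₁⟩ := h₁
          refine ⟨by simpa using hH₁, ⟨[_], rfl⟩, ?_⟩
          simp only [List.length_cons]
          omega
    · intro μ' hc₁ h0₁ _ h9₁
      refine (detInsert_spec hF hs hKΔ hc₁ huv hx.2 (by rw [h0₁]; simp [announced])
        (by rw [h0₁]; simp [announced]) (by rw [h9₁, h9]; exact hH)).mono le_rfl ?_
      rintro μ'' D'' ⟨hc₂, h0₂, hH₂, rfl⟩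
      subst hG
      exact ⟨hc₂, by rw [h0₂, h0₁]; simp [announced], by rw [h0₂, h0₁]; simp [announced], rfl, hH₂⟩
    · rintro τ L k f μ' D' rfl hτ hr ⟨rfl, hH₁⟩
      have hpτ : τ.pending = (σ.pushed K u v).pending := Layers.pending_congr hτ
      have hfτ : (τ.forget (σ.pushed K u v).moving).recent =
          ((σ.pushed K u v).forget (σ.pushed K u v).moving).recent := by
        simp only [Layers.forget, hτ]
      have hpf := Layers.pending_congr hfτ
      have hrec : τ.recent = (σ.record u v).recent := by rw [hτ]; simp
      refine (detMove_spec hF hr (G := G) (by rw [hrec]; exact hH₁)).mono (by rw [hpτ, hpf]) ?_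
      rintro μ'' D'' ⟨hr₂, hH₂, ⟨l, rfl⟩, hlen⟩
      refine ⟨Or.inr hr₂, by rw [← hfτ]; exact hH₂, ⟨l ++ [.insert u v], by simp⟩, ?_⟩
      rw [← hpf, ← hpτ]
      simp only [List.length_append, List.length_cons] at hlen ⊢
      omega

/-- The invariant of the deterministic algorithm: the representation of the layers and of the graph of
recent edges, and amortized bounds for the updates of the dynamic black box, the time `t` and the
number `r` of recolorings. -/
structure DetInv (M : Machine n) (C K Δ : ℕ) (h : List (Update n)) (μ : Store)
    (D : List (Update n)) (t r : ℕ) : Prop where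
  core : Core C K (Layers.after M.static K h) μ
  held : Held Δ (graphOf h) (Layers.after M.static K h).recent (μ 9) D
  length_le : D.length + (Layers.after M.static K h).pending ≤ 3 * h.length
  time_le : t + 200 * (Layers.after M.static K h).pending ≤
    2000 * (h.length + Layers.rebuildCost M.static K (fun k => M.T (n / 2 ^ k)) h) +
      M.dyn.totalTime D
  recolorings_le : r ≤ Layers.rebuildCost M.static K (fun k => n / 2 ^ k) h +
    M.dyn.totalRecolorings D

theorem value_dynColor (M : Machine n) (Z : ℕ) (D : List (Update n)) (μ : Store) {e : Expr}
    {v : Fin n} (he : value M Z D μ e = v) :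
    value M Z D μ (.dynColor e) = M.dyn.color D v % M.W := by
  have h : value M Z D μ (.dynColor e) = if h : value M Z D μ e < n then
      M.dyn.color D ⟨value M Z D μ e, h⟩ % M.W else 0 := rfl
  rw [h, dif_pos (by rw [he]; exact v.isLt)]
  congr 3

theorem detAlgorithm_coloring (hF : Fits M K fuel) {σ : Layers n} {μ : Store}
    {D : List (Update n)} (hc : Core C K σ μ) (hv : σ.Valid K) (hs : σ.Sound C G) {k : ℕ}
    (hW' : k * ((Nat.log 2 n + 1) * C) < M.W) (t r : ℕ) (v : Fin n)
    (hk : M.dyn.color D v < k) :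
    detAlgorithm.coloring M (mkState (segLen n K) μ D t r) v =
      M.dyn.color D v * ((Nat.log 2 n + 1) * C) + σ.code C v := by
  have hZ := segLen_ge n K
  have hW := hF.le_W
  have hlt := Layers.code_lt hv hs v
  have hlt' := mul_add_lt_mul hk hlt
  have hlog1 : 1 ≤ Nat.log 2 n := Nat.log_pos (by norm_num) hF.two_le
  have hlog : Nat.log 2 n ≤ n := (Nat.log_lt_self 2 (by have := hF.two_le; omega)).le
  have h1 : (Nat.log 2 n + 1) * C < M.W :=
    (Nat.le_mul_of_pos_left _ (by omega)).trans_lt hW'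
  have h2 : M.dyn.color D v < M.W :=
    hk.trans_le ((Nat.le_mul_of_pos_right _ (by omega)).trans hW'.le)
  have h3 : C < M.W := (Nat.le_mul_of_pos_left _ (by omega)).trans_lt h1
  have h4 : M.dyn.color D v * ((Nat.log 2 n + 1) * C) < M.W := by omega
  have hvn := v.isLt
  rw [coloring_mkState (by omega)]
  show value M (segLen n K) D (μ.set 0 0 v) (.dynColor (reg 0) * ((reg 8 + .lit 1) * reg 4) +
    layerColor) = _
  have hdyn := value_dynColor M (segLen n K) D (μ.set 0 0 v) (e := reg 0) (v := v)
    (by simp (disch := omega) [Nat.mod_eq_of_lt])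
  rw [value_add, value_mul, hdyn, value_layerColor hF hc hv hs h1.le]
  simp (disch := omega) [Nat.mod_eq_of_lt, hc.I_eq, hc.C_eq]

/-- The hypotheses on the machine on which the deterministic algorithm runs. -/
structure DetSetting (M : Machine n) (𝒢 : Set (SimpleGraph (Fin n))) (C K Δ k fuel : ℕ) :
    Prop where
  fits : Fits M K fuel
  T_mono : Monotone M.T
  le_T : ∀ m, m ≤ M.T m
  static_colors : M.static.Colors 𝒢 C
  dyn_colors : M.dyn.Colors Δ k
  K_le : K ≤ Δ
  C_pos : 0 < C
  C_le : C ≤ M.W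
  colors_lt : k * ((Nat.log 2 n + 1) * C) < M.W

theorem DetInv.coloring_eq {𝒢 : Set (SimpleGraph (Fin n))} {k : ℕ}
    (hS : DetSetting M 𝒢 C K Δ k fuel) {h : List (Update n)} {μ : Store} {D : List (Update n)}
    {t r : ℕ} (hI : DetInv M C K Δ h μ D t r) (hh : IsHistory (fun G => G ∈ 𝒢) h)
    (t' r' : ℕ) (v : Fin n) :
    detAlgorithm.coloring M (mkState (segLen n K) μ D t' r') v =
      M.dyn.color D v * ((Nat.log 2 n + 1) * C) + (Layers.after M.static K h).code C v :=
  detAlgorithm_coloring hS.fits hI.core (Layers.settled_after hS.fits.K_pos _ hh).toValid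
    (Layers.sound_after hS.fits.K_pos hS.C_pos hS.static_colors hh) hS.colors_lt t' r' v
    ((hS.dyn_colors D hI.held.legal).2 v)

theorem DetInv.proper {𝒢 : Set (SimpleGraph (Fin n))} {k : ℕ}
    (hS : DetSetting M 𝒢 C K Δ k fuel) {h : List (Update n)} {μ : Store} {D : List (Update n)}
    {t r : ℕ} (hI : DetInv M C K Δ h μ D t r) (hh : IsHistory (fun G => G ∈ 𝒢) h) (t' r' : ℕ) :
    Proper (graphOf h) (detAlgorithm.coloring M (mkState (segLen n K) μ D t' r')) ∧
      ∀ v, detAlgorithm.coloring M (mkState (segLen n K) μ D t' r') v <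
        k * ((Nat.log 2 n + 1) * C) := by
  have hv := (Layers.settled_after hS.fits.K_pos M.static hh).toValid
  have hs := Layers.sound_after hS.fits.K_pos hS.C_pos hS.static_colors hh
  obtain ⟨hp, hk⟩ := hS.dyn_colors D hI.held.legal
  refine ⟨fun u v huv => ?_, fun v => ?_⟩
  · rw [hI.coloring_eq hS hh, hI.coloring_eq hS hh]
    intro heq
    obtain ⟨h1, h2⟩ := eq_of_mul_add_eq (Layers.code_lt hv hs u) (Layers.code_lt hv hs v) heq
    obtain ⟨h3, h4⟩ := eq_of_mul_add_eq (hs.base_lt u) (hs.base_lt v) h2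
    rcases hs.base_ne u v huv h3 with h5 | h5
    · exact h5 h4
    · exact hp u v ((hI.held.adj u v).2 ⟨huv, h5⟩) h1
  · rw [hI.coloring_eq hS hh]
    exact mul_add_lt_mul (hk v) (Layers.code_lt hv hs v)

theorem DetSetting.prepare {𝒢 : Set (SimpleGraph (Fin n))} {k : ℕ}
    (hS : DetSetting M 𝒢 C K Δ k fuel) :
    Surely (detAlgorithm.prepare M [n, C, K, Δ] fuel) fun s => s.time ≤ 1000 * n ∧
      ∃ μ D t r, { s with time := 0 } = mkState (segLen n K) μ D t r ∧
        DetInv M C K Δ [] μ D t r := by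
  have hn := hS.fits.two_le
  have key := setupCode_spec (G := ⊥) (C := C) hS.fits Δ
  rw [Algorithm.prepare, start_eq_mkState]
  refine (key 0 0).mono ?_
  rintro s ⟨μ, D, t, rfl, ht, hc, h9, rfl⟩
  refine ⟨?_, μ, [], 0, 0, rfl, hc, ⟨?_, fun u v => ?_, fun u v => ?_⟩, ?_, ?_, ?_⟩
  · show t ≤ 1000 * n
    simp only [DynamicAlgorithm.totalTime] at ht
    omega
  · intro v
    simp [SimpleGraph.neighborSet]
  · rw [h9]
    simp [graphOf]
  · simp [graphOf]
  · simp [Layers.after, Layers.initial, Layers.pending]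
  · simp [Layers.after, Layers.initial, Layers.pending]
  · simp

theorem DetSetting.run {𝒢 : Set (SimpleGraph (Fin n))} {k : ℕ}
    (hS : DetSetting M 𝒢 C K Δ k fuel) (h : List (Update n))
    (hh : IsHistory (fun G => G ∈ 𝒢) h) :
    Surely (detAlgorithm.run M [n, C, K, Δ] fuel h) fun s => ∃ μ D t r,
      s = mkState (segLen n K) μ D t r ∧ DetInv M C K Δ h μ D t r := by
  have hZ := segLen_ge n K
  have hK := hS.fits.K_pos
  refine run_surely (𝒬 := fun G => G ∈ 𝒢) (fun h s => ∃ μ D t r,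
    s = mkState (segLen n K) μ D t r ∧ DetInv M C K Δ h μ D t r)
    (hS.prepare.mono fun s hs => hs.2) ?_ h hh
  rintro x h s hh ⟨μ, D, t, r, rfl, hI⟩
  have hs := Layers.settled_after hK M.static hh.2.2
  obtain ⟨c, hc, htr⟩ := detUpdate_spec (G := graphOf (x :: h)) hS.fits hS.T_mono hS.le_T
    (fun S v hv => ((hS.static_colors _ hh.2.1 S).1 v hv).trans_le hS.C_le) hS.K_le hs hI.core
    hh.1 rfl hI.held
  rw [announce_mkState (by omega)]
  refine (htr t r).mono ?_
  rintro s ⟨μ', D', t', rfl, ht', hc', hH', ⟨l, rfl⟩, hlen⟩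
  have hI' : ∀ r', r' ≤ Layers.rebuildCost M.static K (fun k => n / 2 ^ k) (x :: h) +
      M.dyn.totalRecolorings (l ++ D) → DetInv M C K Δ (x :: h) μ' (l ++ D) t' r' := by
    intro r' hr'
    refine ⟨hc', hH', ?_, ?_, hr'⟩
    · have := hI.length_le
      simp only [Layers.after, List.length_cons]
      omega
    · have := hI.time_le
      simp only [Layers.after, List.length_cons, Layers.rebuildCost]
      omega
  refine ⟨μ', l ++ D, t', _, rfl, hI' _ ?_⟩
  have hcol : changes (detAlgorithm.coloring M (mkState (segLen n K) μ D t r))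
      (detAlgorithm.coloring M (mkState (segLen n K) μ' (l ++ D) t' r)) ≤
        changes (M.dyn.color D) (M.dyn.color (l ++ D)) +
          ((Layers.after M.static K h).moved K x).card := by
    refine changes_le_add_card _ fun v hv hdyn => ?_
    rw [hI.coloring_eq hS hh.2.2, (hI' 0 (Nat.zero_le _)).coloring_eq hS hh, hdyn, Layers.after,
      Layers.code_step_of_notMem hv]
  have h1 := hs.card_moved_le hh.1
  have h2 := M.dyn.changes_append l D
  have h3 := hI.recolorings_le
  show r + changes _ _ ≤ _
  simp only [Layers.rebuildCost]
  omega

end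

section

variable {M : Machine n} {G : SimpleGraph (Fin n)} {C K fuel : ℕ}

/-! ### Random colors for the vertices -/

/-- A counting loop in which `φ j` bounds the mean of the final value of `g` before round `j`. -/
theorem MeanLE.loop {Z : ℕ} {p : Prog} {μ : Store} {D : List (Update n)}
    {g : (Fin n → ℕ) → ℝ≥0∞} (hZ : n ≤ Z) {b : Expr} (Inv : ℕ → Store → List (Update n) → Prop)
    (N c : ℕ) (φ : ℕ → (Fin n → ℕ) → ℝ≥0∞) (h0 : Inv 0 μ D) (hN : N < fuel)
    (hstep : ∀ j ≤ N, ∀ μ D, Inv j μ D →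
      (value M Z D μ b = 0 → g (fun v => μ 3 v) ≤ φ j fun v => μ 3 v) ∧
      (value M Z D μ b ≠ 0 → j < N ∧ Triple M G fuel Z p μ D c (Inv (j + 1)) ∧
        MeanLE M G fuel Z p μ D (φ (j + 1)) (φ j fun v => μ 3 v))) :
    MeanLE M G fuel Z (.loop b p) μ D g (φ 0 fun v => μ 3 v) := by
  have key : ∀ (k fuel' j : ℕ), N - j = k → j ≤ N → k < fuel' → ∀ μ D, Inv j μ D → ∀ t r,
      mean (whileLoop M b (p.exec M G fuel) fuel' (mkState Z μ D t r))
        (fun s => g (palette Z s)) ≤ φ j fun v => μ 3 v := by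
    intro k
    induction k with
    | zero =>
      intro fuel' j hk hj hf μ D hI t r
      obtain ⟨fuel', rfl⟩ : ∃ m, fuel' = m + 1 := ⟨fuel' - 1, by omega⟩
      obtain ⟨hz, hnz⟩ := hstep j hj μ D hI
      have hb : value M Z D μ b = 0 := by
        by_contra hb
        have := (hnz hb).1
        omega
      rw [whileLoop, eval_mkState, if_pos hb, Triple.mkState_tick, mean_pure, palette_mkState hZ]
      exact hz hb
    | succ k ih =>
      intro fuel' j hk hj hf μ D hI t r
      obtain ⟨fuel', rfl⟩ : ∃ m, fuel' = m + 1 := ⟨fuel' - 1, by omega⟩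
      obtain ⟨hz, hnz⟩ := hstep j hj μ D hI
      rw [whileLoop, eval_mkState, Triple.mkState_tick]
      split_ifs with hb
      · rw [mean_pure, palette_mkState hZ]
        exact hz hb
      · obtain ⟨hjN, htr, hmean⟩ := hnz hb
        rw [mean_andThen (htr _ r)]
        refine le_trans (mean_mono ((htr _ r).mono ?_)) (hmean _ r)
        rintro s ⟨μ', D', t', rfl, -, hI'⟩
        rw [palette_mkState hZ]
        exact ih fuel' (j + 1) (by omega) (by omega) (by omega) μ' D' hI' t' r
  intro t r
  exact key N fuel 0 (by omega) (by omega) hN μ D h0 t r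

/-- The indicator of the event that `u` and `v` have the same random color. -/
noncomputable def clash (u v : Fin n) (c : Fin n → ℕ) : ℝ≥0∞ := if c u = c v then 1 else 0

/-- Give new random colors to the vertices that are to be moved. -/
def resampleCode : Prog :=
  .lit 13 ::= .lit 0 ;;
  .loop (less (reg 13) (reg 15))
    (.random (slot 3 (item 6 (reg 18 + reg 13))) (.lit 5 * reg 5 - .lit 1) ;;
      .lit 13 ::= reg 13 + .lit 1)

/-- The invariant of the loop of `resampleCode`. -/
def Resampled (C K : ℕ) (σ : Layers n) (k : ℕ) (L : List (Fin n)) (f : Fin n → ℕ) (μ : Store)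
    (D : List (Update n)) (j : ℕ) (μ' : Store) (D' : List (Update n)) : Prop :=
  Ready C K σ k L f μ' ∧ μ' 0 13 = j ∧ (∀ x : Fin n, x ∈ L.take j → μ' 3 x < 5 * K) ∧
    (∀ x : Fin n, x ∉ L.take j → μ' 3 x = μ 3 x) ∧ D' = D

section resample

variable {σ : Layers n} {k : ℕ} {L : List (Fin n)} {f : Fin n → ℕ} {μ : Store}
  {D : List (Update n)}

theorem Resampled.value_test (hF : Fits M K fuel) {j : ℕ} {μ' : Store}
    {D' : List (Update n)} (h : Resampled C K σ k L f μ D j μ' D') :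
    value M (segLen n K) D' μ' (less (reg 13) (reg 15)) = if j < L.length then 1 else 0 := by
  have hZ := segLen_ge n K
  have hW := hF.le_W
  have h1 := h.1.length_eq
  have h2 := h.1.stack_le
  simp (disch := omega) [Nat.mod_eq_of_lt, h.1.length_var, h.2.1]

theorem Resampled.value_slot (hF : Fits M K fuel) {j : ℕ} (hj : j < L.length) {μ' : Store}
    {D' : List (Update n)} (h : Resampled C K σ k L f μ D j μ' D') :
    value M (segLen n K) D' μ' (slot 3 (item 6 (reg 18 + reg 13))) = segLen n K * 3 + L[j] := by
  have hZ := segLen_ge n K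
  have hW := hF.le_W
  have h1 := h.1.length_eq
  have h2 := h.1.stack_le
  have h3 := (L[j]).isLt
  have h4 := h.1.stack_at hj
  simp (disch := omega) [Nat.mod_eq_of_lt, h.1.Z_eq, h.1.start_var, h.2.1, h4]

theorem value_last_color (hF : Fits M K fuel) {μ : Store} {D : List (Update n)} (h : μ 0 5 = K) :
    value M (segLen n K) D μ (.lit 5 * reg 5 - .lit 1) = 5 * K - 1 := by
  have hZ := segLen_ge n K
  have hW := hF.le_W
  simp (disch := omega) [Nat.mod_eq_of_lt, h]

theorem Resampled.step (hF : Fits M K fuel) {j : ℕ} (hj : j < L.length) {μ' : Store}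
    {D' : List (Update n)} (h : Resampled C K σ k L f μ D j μ' D') {y : ℕ} (hy : y ≤ 5 * K - 1) :
    Triple M G fuel (segLen n K) (.lit 13 ::= reg 13 + .lit 1) (μ'.set 3 (L[j] : Fin n) y) D' 10
      fun μ'' D'' => Resampled C K σ k L f μ D (j + 1) μ'' D'' ∧
        μ'' 3 = (μ'.set 3 (L[j] : Fin n) y) 3 := by
  have hZ := segLen_ge n K
  have hW := hF.le_W
  have hK := hF.K_pos
  have h1 := h.1.length_eq
  have h2 := h.1.stack_le
  obtain ⟨hr, h13, hlt, hne, rfl⟩ := h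
  refine Triple.weaken (Triple.assign 0 13 (j + 1) (by omega)
    (by simp (disch := omega) [Nat.mod_eq_of_lt])
    (by simp (disch := omega) [Nat.mod_eq_of_lt, h13]) ?_) (by simp)
  have hx : ∀ v w : Fin n, (v : ℕ) = w ↔ v = w := fun v w => Fin.ext_iff.symm
  refine ⟨⟨(hr.set _ (by omega)).set _ (by omega), by simp, fun x hxL => ?_, fun x hxL => ?_,
    rfl⟩, by simp⟩
  · rw [List.take_succ_eq_append_getElem hj, List.mem_append, List.mem_singleton] at hxL
    simp only [ne_eq, OfNat.ofNat_ne_zero, not_false_eq_true, Store.set_ne, Store.set_same,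
      Function.update_apply, hx]
    split_ifs with hxj
    · omega
    · exact hlt x (hxL.resolve_right hxj)
  · rw [List.take_succ_eq_append_getElem hj, List.mem_append, List.mem_singleton, not_or] at hxL
    simp [hx, hxL.2, hne x hxL.1]

theorem resampleCode_spec (hF : Fits M K fuel) (hr : Ready C K σ k L f μ) :
    Triple M G fuel (segLen n K) resampleCode μ D (60 * L.length + 20) fun μ' D' =>
      Ready C K σ k L f μ' ∧ (∀ x : Fin n, x ∈ L → μ' 3 x < 5 * K) ∧
        (∀ x : Fin n, x ∉ L → μ' 3 x = μ 3 x) ∧ D' = D := by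
  have hZ := segLen_ge n K
  have hW := hF.le_W
  have hfuel := hF.le_fuel
  have h1 := hr.length_eq
  have h2 := hr.stack_le
  refine Triple.assign_seq (60 * L.length + 15) 0 13 0 (by omega)
    (by simp (disch := omega) [Nat.mod_eq_of_lt]) (by simp) (by simp; omega) ?_
  refine Triple.weaken (Triple.loop_const (Resampled C K σ k L f μ D) L.length 40 ?_ ?_ ?_) ?_
  · exact ⟨hr.set _ (by omega), by simp, by simp, by simp, rfl⟩
  · omega
  · intro j hj μ' D' h
    rw [h.value_test hF]
    split_ifs with hjl
    · refine ⟨fun h => absurd h (by simp), fun _ => ⟨hjl, ?_⟩⟩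
      have hn := (L[j]).isLt
      refine Triple.seq_of 25 10 (Triple.weaken (Triple.random 3 (L[j] : Fin n) (5 * K - 1)
        (Q := fun μ₁ D₁ => ∃ y ≤ 5 * K - 1, μ₁ = μ'.set 3 (L[j] : Fin n) y ∧ D₁ = D')
        (by omega) (h.value_slot hF hjl) (value_last_color hF h.1.K_eq)
        fun y hy => ⟨y, hy, rfl, rfl⟩) (by simp)) ?_ (by norm_num)
      rintro μ₁ D₁ ⟨y, hy, rfl, rfl⟩
      exact (h.step hF hjl hy).mono le_rfl fun _ _ h => h.1
    · obtain rfl : j = L.length := by omega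
      obtain ⟨hr', -, hlt, hne, rfl⟩ := h
      rw [List.take_length] at hlt hne
      exact ⟨fun _ => ⟨hr', hlt, hne, rfl⟩, fun h => absurd rfl h⟩
  · simp
    omega

/-- The probability that a random number hits a given number. -/
theorem sum_ite_div_le {N : ℕ} (p : Fin (N + 1) → Prop) [DecidablePred p]
    (hp : ∀ y z, p y → p z → y = z) :
    (∑ y, if p y then (1 : ℝ≥0∞) else 0) / (N + 1 : ℕ) ≤ 1 / (N + 1 : ℕ) := by
  gcongr
  rw [Finset.sum_ite, Finset.sum_const_zero, add_zero, Finset.sum_const, nsmul_one]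
  have h : (Finset.univ.filter p).card ≤ 1 := Finset.card_le_one.2 fun a ha b hb =>
    hp a b (Finset.mem_filter.1 ha).2 (Finset.mem_filter.1 hb).2
  exact_mod_cast h

theorem sum_const_div_le {N : ℕ} (ε : ℝ≥0∞) :
    (∑ _y : Fin (N + 1), ε) / (N + 1 : ℕ) = ε := by
  rw [Finset.sum_const, Finset.card_univ, Fintype.card_fin, nsmul_eq_mul, mul_comm]
  exact ENNReal.mul_div_cancel_right (by simp) (ENNReal.natCast_ne_top _)

/-- After `resampleCode`, two vertices of which at least one got a new random color have the same
random color with probability at most `1 / (5 * K)`. -/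
theorem resampleCode_mean (hF : Fits M K fuel) (hr : Ready C K σ k L f μ) {u v : Fin n}
    (huv : u ≠ v) : MeanLE M G fuel (segLen n K) resampleCode μ D (clash u v)
      (if u ∈ L ∨ v ∈ L then 1 / (5 * K : ℕ) else clash u v fun x => μ 3 x) := by
  have hZ := segLen_ge n K
  have hW := hF.le_W
  have hK := hF.K_pos
  have hn : n ≤ segLen n K := by omega
  have hfuel := hF.le_fuel
  have h1 := hr.length_eq
  have h2 := hr.stack_le
  have h5 : 5 * K - 1 + 1 = 5 * K := by omega
  refine MeanLE.seq_triple (R := fun μ₁ D₁ => μ₁ = μ.set 0 13 0 ∧ D₁ = D) (Triple.assign 0 13 0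
    (by omega) (by simp (disch := omega) [Nat.mod_eq_of_lt]) (by simp) ⟨rfl, rfl⟩) ?_
  rintro μ₁ D₁ ⟨rfl, rfl⟩
  have key := MeanLE.loop (M := M) (G := G) (fuel := fuel) (b := less (reg 13) (reg 15))
    (p := .random (slot 3 (item 6 (reg 18 + reg 13))) (.lit 5 * reg 5 - .lit 1) ;;
      .lit 13 ::= reg 13 + .lit 1) (μ := μ.set 0 13 0) (g := clash u v) hn
    (Resampled C K σ k L f μ D₁) L.length 40
    (fun j c => if u ∈ L.drop j ∨ v ∈ L.drop j then 1 / (5 * K : ℕ) else clash u v c)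
    ⟨hr.set _ (by omega), by simp, by simp, by simp, rfl⟩ (by omega) ?_
  · simpa using key
  · intro j hj μ' D' h
    rw [h.value_test hF]
    by_cases hjl : j < L.length
    · rw [if_pos hjl]
      refine ⟨fun h => absurd h (by simp), fun _ => ⟨hjl, ?_, ?_⟩⟩
      · have hn := (L[j]).isLt
        refine Triple.seq_of 25 10 (Triple.weaken (Triple.random 3 (L[j] : Fin n) (5 * K - 1)
          (Q := fun μ₁ D₁ => ∃ y ≤ 5 * K - 1, μ₁ = μ'.set 3 (L[j] : Fin n) y ∧ D₁ = D')
          (by omega) (h.value_slot hF hjl) (value_last_color hF h.1.K_eq)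
          fun y hy => ⟨y, hy, rfl, rfl⟩) (by simp)) ?_ (by norm_num)
        rintro μ₁ D₁ ⟨y, hy, rfl, rfl⟩
        exact (h.step hF hjl hy).mono le_rfl fun _ _ h => h.1
      · have hxn := (L[j]).isLt
        refine MeanLE.seq hn (R := fun μ₁ D₁ => ∃ y ≤ 5 * K - 1,
          μ₁ = μ'.set 3 (L[j] : Fin n) y ∧ D₁ = D') (g' := fun c =>
            if u ∈ L.drop (j + 1) ∨ v ∈ L.drop (j + 1) then 1 / (5 * K : ℕ) else clash u v c)
          (Triple.random 3 (L[j] : Fin n) (5 * K - 1)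
            (by omega) (h.value_slot hF hjl) (value_last_color hF h.1.K_eq)
            fun y hy => ⟨y, hy, rfl, rfl⟩)
          (MeanLE.random hn 3 (L[j] : Fin n) (5 * K - 1) (by omega) (h.value_slot hF hjl)
            (value_last_color hF h.1.K_eq) ?_) ?_
        · have hx : ∀ v w : Fin n, (v : ℕ) = w ↔ v = w := fun v w => Fin.ext_iff.symm
          rw [List.drop_eq_getElem_cons hjl]
          simp only [List.mem_cons]
          by_cases hin : u ∈ L.drop (j + 1) ∨ v ∈ L.drop (j + 1)
          · simp only [if_pos hin, sum_const_div_le]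
            rw [if_pos (by tauto)]
          · simp only [if_neg hin, clash, Store.set_same, Function.update_apply, hx]
            by_cases hu : u = L[j]
            · have hv : v ≠ L[j] := fun hv => huv (hu.trans hv.symm)
              simp only [if_pos hu, if_neg hv]
              rw [if_pos (Or.inl (Or.inl hu))]
              refine (sum_ite_div_le (fun y : Fin (5 * K - 1 + 1) => (y : ℕ) = μ' 3 v)
                fun y z hy hz => Fin.ext (hy.trans hz.symm)).trans ?_
              rw [h5]
            · by_cases hv : v = L[j]
              · simp only [if_pos hv, if_neg hu]
                rw [if_pos (Or.inr (Or.inl hv))]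
                refine (sum_ite_div_le (fun y : Fin (5 * K - 1 + 1) => μ' 3 u = (y : ℕ))
                  fun y z hy hz => Fin.ext (hy.symm.trans hz)).trans ?_
                rw [h5]
              · have hin' : ¬ ((u = L[j] ∨ u ∈ L.drop (j + 1)) ∨
                    (v = L[j] ∨ v ∈ L.drop (j + 1))) := by tauto
                simp only [if_neg hv, if_neg hu, sum_const_div_le, if_neg hin', le_refl]
        · rintro μ₁ D₁ ⟨y, hy, rfl, rfl⟩
          refine MeanLE.of_triple hn (h.step hF hjl hy) ?_
          rintro μ₂ D₂ ⟨-, h3⟩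
          rw [h3]
    · rw [if_neg hjl]
      obtain rfl : j = L.length := by omega
      simp only [List.drop_length, List.not_mem_nil, or_self, if_false]
      exact ⟨fun _ => le_rfl, fun h => absurd rfl h⟩

end resample

end

section

variable {M : Machine n} {G : SimpleGraph (Fin n)} {C K fuel : ℕ}

/-! ### Recoloring an endpoint of a monochromatic edge -/

/-- List in segment `10` the colors that no recent partner of the vertex in variable `1` has, and
put their number into variable `17`; segment `9` marks the colors in use. -/
def freeCode : Prog :=
  .lit 13 ::= .lit 0 ;;
  .loop (less (reg 13) (.lit 5 * reg 5))
    (slot 9 (reg 13) ::= .lit 0 ;; .lit 13 ::= reg 13 + .lit 1) ;;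
  .lit 13 ::= .lit 0 ;;
  .loop (less (reg 13) (item 4 (reg 1)))
    (slot 9 (item 3 (item 5 (reg 1 * reg 5 + reg 13))) ::= .lit 1 ;;
      .lit 13 ::= reg 13 + .lit 1) ;;
  .lit 17 ::= .lit 0 ;;
  .lit 13 ::= .lit 0 ;;
  .loop (less (reg 13) (.lit 5 * reg 5))
    (.ite (item 9 (reg 13)) .skip
      (slot 10 (reg 17) ::= reg 13 ;; .lit 17 ::= reg 17 + .lit 1) ;;
      .lit 13 ::= reg 13 + .lit 1)

/-- The colors of a palette of `5 * K` colors that no vertex of a list has. -/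
def freeColors (K : ℕ) (c : Fin n → ℕ) (ρ : List (Fin n)) : List ℕ :=
  (List.range (5 * K)).filter fun y => decide (y ∉ ρ.map c)

theorem freeColors_nodup (c : Fin n → ℕ) (ρ : List (Fin n)) : (freeColors K c ρ).Nodup :=
  List.nodup_range.filter _

theorem length_freeColors_le (c : Fin n → ℕ) (ρ : List (Fin n)) :
    (freeColors K c ρ).length ≤ 5 * K :=
  (List.length_filter_le _ _).trans_eq List.length_range

theorem le_length_freeColors (c : Fin n → ℕ) {ρ : List (Fin n)} (hρ : ρ.length ≤ K) :
    4 * K ≤ (freeColors K c ρ).length := by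
  have h1 := List.length_eq_length_filter_add (l := List.range (5 * K))
    (fun y => decide (y ∉ ρ.map c))
  have h2 : ((List.range (5 * K)).filter fun y => !decide (y ∉ ρ.map c)).length ≤ K := by
    refine le_trans (List.subperm_of_subset (l₂ := ρ.map c) (List.nodup_range.filter _)
      ?_).length_le (by simpa using hρ)
    intro y hy
    simpa using (List.mem_filter.1 hy).2
  simp only [List.length_range] at h1
  simp only [freeColors]
  omega

theorem mem_freeColors {c : Fin n → ℕ} {ρ : List (Fin n)} {y : ℕ} :
    y ∈ freeColors K c ρ ↔ y < 5 * K ∧ ∀ w ∈ ρ, c w ≠ y := by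
  simp [freeColors]

/-- The part of the state that `freeCode` does not change: `u` and `v` are the endpoints of the new
edge, and `c` holds the random colors. -/
structure Frame (C K : ℕ) (σ : Layers n) (u v : Fin n) (c : ℕ → ℕ) (D : List (Update n))
    (μ' : Store) (D' : List (Update n)) : Prop where
  core : Core C K σ μ'
  left : μ' 0 1 = u
  right : μ' 0 2 = v
  palette_eq : μ' 3 = c
  hist_eq : D' = D

theorem Frame.set {σ : Layers n} {u v : Fin n} {c : ℕ → ℕ} {D D' : List (Update n)} {μ' : Store}
    (h : Frame C K σ u v c D μ' D') {i x : ℕ} (y : ℕ) (hi : (i = 0 ∧ 10 < x) ∨ 7 < i) :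
    Frame C K σ u v c D (μ'.set i x y) D' where
  core := h.core.set y (by omega)
  left := by
    rcases hi with ⟨rfl, hx⟩ | hi
    · rw [Store.set_same, Function.update_of_ne (by omega), h.left]
    · rw [Store.set_ne _ _ _ (by omega), h.left]
  right := by
    rcases hi with ⟨rfl, hx⟩ | hi
    · rw [Store.set_same, Function.update_of_ne (by omega), h.right]
    · rw [Store.set_ne _ _ _ (by omega), h.right]
  palette_eq := by rw [Store.set_ne _ _ _ (by omega), h.palette_eq]
  hist_eq := h.hist_eq

theorem freeCode_spec (hF : Fits M K fuel) {σ : Layers n} {u v : Fin n} {c : ℕ → ℕ}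
    {μ : Store} {D : List (Update n)} (hf : Frame C K σ u v c D μ D)
    (hcol : ∀ w : Fin n, c w < 5 * K) :
    Triple M G fuel (segLen n K) freeCode μ D (600 * K + 100) fun μ' D' =>
      Frame C K σ u v c D μ' D' ∧
      μ' 0 17 = (freeColors K (fun w => c w) (σ.recent u)).length ∧
      ∀ i (h : i < (freeColors K (fun w => c w) (σ.recent u)).length), μ' 10 i =
        (freeColors K (fun w => c w) (σ.recent u))[i] := by
  have hZ := segLen_ge n K
  have hW := hF.le_W
  have hfuel := hF.le_fuel
  have hK := hF.K_pos
  have hrec := hf.core.recent_le u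
  have hval5 : ∀ j μ' D', j ≤ 5 * K → Frame C K σ u v c D μ' D' → μ' 0 13 = j →
      value M (segLen n K) D' μ' (less (reg 13) (.lit 5 * reg 5)) =
        if j < 5 * K then 1 else 0 := by
    intro j μ' D' hj hf' h13
    simp (disch := omega) [Nat.mod_eq_of_lt, h13, hf'.core.K_eq]
  refine Triple.assign_seq (600 * K + 90) 0 13 0 (by omega)
    (by simp (disch := omega) [Nat.mod_eq_of_lt]) (by simp) (by simp; omega) ?_
  refine Triple.seq_of (5 * K * 20 + (5 * K + 1) * 10) (360 * K + 80)
    (R := fun μ' D' => Frame C K σ u v c D μ' D' ∧ ∀ y < 5 * K, μ' 9 y = 0) ?_ ?_ (by omega)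
  · refine Triple.weaken (Triple.loop_const (fun j μ' D' => Frame C K σ u v c D μ' D' ∧
      μ' 0 13 = j ∧ ∀ y < j, μ' 9 y = 0) (5 * K) 20 ?_ ?_ ?_) (by simp)
    · exact ⟨hf.set _ (by omega), by simp, by simp⟩
    · omega
    · rintro j hj μ' D' ⟨hf', h13, h9⟩
      rw [hval5 j μ' D' hj hf' h13]
      split_ifs with hjl
      · refine ⟨fun h => absurd h (by simp), fun _ => ⟨hjl, ?_⟩⟩
        refine Triple.assign_seq 10 9 j 0 (by omega)
          (by simp (disch := omega) [Nat.mod_eq_of_lt, hf'.core.Z_eq, h13]) (by simp) (by simp) ?_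
        refine Triple.weaken (Triple.assign 0 13 (j + 1) (by omega)
          (by simp (disch := omega) [Nat.mod_eq_of_lt])
          (by simp (disch := omega) [Nat.mod_eq_of_lt, h13]) ?_) (by simp)
        refine ⟨(hf'.set _ (by omega)).set _ (by omega), by simp, fun y hy => ?_⟩
        by_cases hyj : y = j
        · simp [hyj]
        · simp [hyj, h9 y (by omega)]
      · obtain rfl : j = 5 * K := by omega
        exact ⟨fun _ => ⟨hf', h9⟩, fun h => absurd rfl h⟩
  rintro μ₁ D₁ ⟨hf₁, h9₁⟩
  refine Triple.assign_seq (360 * K + 70) 0 13 0 (by omega)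
    (by simp (disch := omega) [Nat.mod_eq_of_lt]) (by simp) (by simp; omega) ?_
  refine Triple.seq_of (K * 40 + (K + 1) * 12) (300 * K + 50)
    (R := fun μ' D' => Frame C K σ u v c D μ' D' ∧ ∀ y < 5 * K, μ' 9 y = 0 ↔
      y ∉ (σ.recent u).map fun w : Fin n => c w) ?_ ?_ (by omega)
  · refine Triple.weaken (Triple.loop_const (fun j μ' D' => Frame C K σ u v c D μ' D' ∧
      μ' 0 13 = j ∧ ∀ y < 5 * K, μ' 9 y = 0 ↔ y ∉ ((σ.recent u).take j).map fun w : Fin n => c w)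
      (σ.recent u).length 40 ?_ ?_ ?_) ?_
    · exact ⟨hf₁.set _ (by omega), by simp, by simpa using h9₁⟩
    · omega
    · rintro j hj μ' D' ⟨hf', h13, h9⟩
      have hcnt := hf'.core.count_eq u
      have hun := u.isLt
      have hval : value M (segLen n K) D' μ' (less (reg 13) (item 4 (reg 1))) =
          if j < (σ.recent u).length then 1 else 0 := by
        simp (disch := omega) [Nat.mod_eq_of_lt, h13, hf'.core.Z_eq, hf'.left, hcnt]
      rw [hval]
      split_ifs with hjl
      · refine ⟨fun h => absurd h (by simp), fun _ => ⟨hjl, ?_⟩⟩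
        have hidx := pair_lt_segLen (K := K) u (i := j) (by omega)
        have hrj := hf'.core.recent_eq u j hjl
        have hwn := ((σ.recent u)[j]).isLt
        have hcw := hcol (σ.recent u)[j]
        refine Triple.assign_seq 10 9 (c ((σ.recent u)[j] : Fin n)) 1 (by omega)
          (by simp (disch := omega) [Nat.mod_eq_of_lt, hf'.core.Z_eq, h13, hf'.left,
            hf'.core.K_eq, hrj, hf'.palette_eq])
          (by simp (disch := omega) [Nat.mod_eq_of_lt]) (by simp) ?_
        refine Triple.weaken (Triple.assign 0 13 (j + 1) (by omega)
          (by simp (disch := omega) [Nat.mod_eq_of_lt])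
          (by simp (disch := omega) [Nat.mod_eq_of_lt, h13]) ?_) (by simp)
        refine ⟨(hf'.set _ (by omega)).set _ (by omega), by simp, fun y hy => ?_⟩
        rw [List.take_succ_eq_append_getElem hjl, List.map_append, List.map_singleton,
          List.mem_append, List.mem_singleton, not_or, ← h9 y hy]
        by_cases hyj : y = c ((σ.recent u)[j] : Fin n)
        · simp [hyj]
        · simp [hyj]
      · obtain rfl : j = (σ.recent u).length := by omega
        rw [List.take_length] at h9
        exact ⟨fun _ => ⟨hf', h9⟩, fun h => absurd rfl h⟩
    · have h1 : (σ.recent u).length * 40 ≤ K * 40 := Nat.mul_le_mul_right _ hrec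
      simp
      omega
  rintro μ₂ D₂ ⟨hf₂, h9₂⟩
  refine Triple.assign_seq (300 * K + 40) 0 17 0 (by omega)
    (by simp (disch := omega) [Nat.mod_eq_of_lt]) (by simp) (by simp; omega) ?_
  refine Triple.assign_seq (300 * K + 30) 0 13 0 (by omega)
    (by simp (disch := omega) [Nat.mod_eq_of_lt]) (by simp) (by simp; omega) ?_
  let F : ℕ → List ℕ := fun j =>
    (List.range j).filter fun y => decide (y ∉ (σ.recent u).map fun w : Fin n => c w)
  have hFlen : ∀ j, (F j).length ≤ j := fun j =>
    (List.length_filter_le _ _).trans_eq List.length_range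
  have hFsucc : ∀ j, F (j + 1) = F j ++
      if j ∉ (σ.recent u).map fun w : Fin n => c w then [j] else [] := by
    intro j
    simp only [F, List.range_succ, List.filter_append, List.filter_singleton]
    split_ifs <;> simp_all
  refine Triple.weaken (Triple.loop_const (fun j μ' D' => Frame C K σ u v c D μ' D' ∧
    (∀ y < 5 * K, μ' 9 y = 0 ↔ y ∉ (σ.recent u).map fun w : Fin n => c w) ∧ μ' 0 13 = j ∧
    μ' 0 17 = (F j).length ∧ ∀ i (h : i < (F j).length), μ' 10 i = (F j)[i])
    (5 * K) 50 ?_ ?_ ?_) (by simp; omega)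
  · exact ⟨(hf₂.set _ (by omega)).set _ (by omega), by simpa using h9₂, by simp, by simp [F],
      by simp [F]⟩
  · omega
  · rintro j hj μ' D' ⟨hf', h9, h13, h17, h10⟩
    have hFj := hFlen j
    rw [hval5 j μ' D' hj hf' h13]
    split_ifs with hjl
    · refine ⟨fun h => absurd h (by simp), fun _ => ⟨hjl, ?_⟩⟩
      refine Triple.seq_of 40 10 (R := fun μ'' D'' => Frame C K σ u v c D μ'' D'' ∧
        (∀ y < 5 * K, μ'' 9 y = 0 ↔ y ∉ (σ.recent u).map fun w : Fin n => c w) ∧ μ'' 0 13 = j ∧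
        μ'' 0 17 = (F (j + 1)).length ∧ ∀ i (h : i < (F (j + 1)).length),
          μ'' 10 i = (F (j + 1))[i]) ?_ ?_ (by norm_num)
      · have hv9 : value M (segLen n K) D' μ' (item 9 (reg 13)) = μ' 9 j := by
          simp (disch := omega) [Nat.mod_eq_of_lt, h13, hf'.core.Z_eq]
        refine Triple.weaken (Triple.ite (c := 30) ?_ ?_) (by simp)
        · intro h0
          rw [hv9, h9 j hjl] at h0
          have hs : F (j + 1) = F j ++ [j] := by rw [hFsucc, if_pos h0]
          refine Triple.assign_seq 10 10 (F j).length j (by omega)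
            (by simp (disch := omega) [Nat.mod_eq_of_lt, hf'.core.Z_eq, h17])
            (by simp (disch := omega) [Nat.mod_eq_of_lt, h13]) (by simp) ?_
          refine Triple.weaken (Triple.assign 0 17 ((F j).length + 1) (by omega)
            (by simp (disch := omega) [Nat.mod_eq_of_lt])
            (by simp (disch := omega) [Nat.mod_eq_of_lt, h17]) ?_) (by simp)
          refine ⟨(hf'.set _ (by omega)).set _ (by omega), by simpa using h9, by simp [h13],
            by simp [hs], fun i hi => ?_⟩
          simp only [hs, List.length_append, List.length_singleton] at hi
          by_cases hij : i = (F j).length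
          · simp [hs, hij]
          · have hi' : i < (F j).length := by omega
            simp [hs, hij, h10 i hi', List.getElem_append_left hi']
        · intro h0
          rw [hv9, ne_eq, h9 j hjl] at h0
          have hs : F (j + 1) = F j := by rw [hFsucc, if_neg h0, List.append_nil]
          refine Triple.weaken (Triple.skip ?_) (by norm_num)
          simp only [hs]
          exact ⟨hf', h9, h13, h17, h10⟩
      · rintro μ'' D'' ⟨hf'', h9'', h13'', h17'', h10''⟩
        refine Triple.weaken (Triple.assign 0 13 (j + 1) (by omega)
          (by simp (disch := omega) [Nat.mod_eq_of_lt])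
          (by simp (disch := omega) [Nat.mod_eq_of_lt, h13'']) ?_) (by simp)
        exact ⟨hf''.set _ (by omega), by simpa using h9'', by simp, by simpa using h17'',
          by simpa using h10''⟩
    · obtain rfl : j = 5 * K := by omega
      exact ⟨fun _ => ⟨hf', h17, h10⟩, fun h => absurd rfl h⟩

/-- Give the vertex in variable `1` a random one of the colors listed in segment `10`. -/
def pickCode : Prog :=
  .random (slot 3 (reg 1)) (reg 17 - .lit 1) ;;
  slot 3 (reg 1) ::= item 10 (item 3 (reg 1))

section pick

variable {σ : Layers n} {u v : Fin n} {c : ℕ → ℕ} {μ : Store} {D : List (Update n)} {F : List ℕ}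

theorem pick_random_values (hF : Fits M K fuel) (hf : Frame C K σ u v c D μ D)
    (hpos : 0 < F.length) (hlen : F.length ≤ 5 * K) (h17 : μ 0 17 = F.length) :
    value M (segLen n K) D μ (slot 3 (reg 1)) = segLen n K * 3 + u ∧
      value M (segLen n K) D μ (reg 17 - .lit 1) = F.length - 1 := by
  have hZ := segLen_ge n K
  have hW := hF.le_W
  have hun := u.isLt
  constructor
  · simp (disch := omega) [Nat.mod_eq_of_lt, hf.core.Z_eq, hf.left]
  · simp (disch := omega) [Nat.mod_eq_of_lt, h17]

theorem pick_assign (hF : Fits M K fuel) (hf : Frame C K σ u v c D μ D)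
    (hlen : F.length ≤ 5 * K)
    (h10 : ∀ i (h : i < F.length), μ 10 i = F[i]) {y : ℕ} (hy : y < F.length) :
    Triple M G fuel (segLen n K) (slot 3 (reg 1) ::= item 10 (item 3 (reg 1))) (μ.set 3 u y) D 30
      fun μ' D' => Core C K σ μ' ∧ μ' 0 1 = u ∧ μ' 0 2 = v ∧
        μ' 3 = Function.update c u F[y] ∧ D' = D := by
  have hZ := segLen_ge n K
  have hW := hF.le_W
  have hun := u.isLt
  have h1 := h10 y hy
  refine Triple.weaken (Triple.assign 3 u F[y] (by omega)
    (by simp (disch := omega) [Nat.mod_eq_of_lt, hf.core.Z_eq, hf.left])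
    (by simp (disch := omega) [Nat.mod_eq_of_lt, hf.core.Z_eq, hf.left, h1]) ?_) (by simp)
  exact ⟨(hf.core.set _ (by omega)).set _ (by omega), by simp [hf.left], by simp [hf.right],
    by simp [hf.palette_eq], rfl⟩

theorem pickCode_spec (hF : Fits M K fuel) (hf : Frame C K σ u v c D μ D)
    (hpos : 0 < F.length) (hlen : F.length ≤ 5 * K)
    (h17 : μ 0 17 = F.length) (h10 : ∀ i (h : i < F.length), μ 10 i = F[i]) :
    Triple M G fuel (segLen n K) pickCode μ D 50 fun μ' D' => Core C K σ μ' ∧ μ' 0 1 = u ∧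
      μ' 0 2 = v ∧ (∃ y ∈ F, μ' 3 = Function.update c u y) ∧ D' = D := by
  have hZ := segLen_ge n K
  have hun := u.isLt
  obtain ⟨e1, e2⟩ := pick_random_values hF hf hpos hlen h17
  refine Triple.seq_of 20 30 (Triple.weaken (Triple.random 3 u (F.length - 1)
    (Q := fun μ₁ D₁ => ∃ y < F.length, μ₁ = μ.set 3 u y ∧ D₁ = D) (by omega) e1 e2
    fun y hy => ⟨y, by omega, rfl, rfl⟩) (by simp)) ?_ (by norm_num)
  rintro μ₁ D₁ ⟨y, hy, rfl, rfl⟩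
  refine (pick_assign hF hf hlen h10 hy).mono le_rfl ?_
  rintro μ₂ D₂ ⟨h1, h2, h3, h4, h5⟩
  exact ⟨h1, h2, h3, ⟨_, List.getElem_mem hy, h4⟩, h5⟩

/-- The random color is equal to any given color with probability at most `1 / #F`. -/
theorem pickCode_mean (hF : Fits M K fuel) (hf : Frame C K σ u v c D μ D)
    (hpos : 0 < F.length) (hlen : F.length ≤ 5 * K)
    (h17 : μ 0 17 = F.length) (h10 : ∀ i (h : i < F.length), μ 10 i = F[i]) (hnd : F.Nodup)
    {a b : Fin n} (hab : a ≠ b) (hu : a = u ∨ b = u) :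
    MeanLE M G fuel (segLen n K) pickCode μ D (clash a b) (1 / (F.length : ℕ)) := by
  have hZ := segLen_ge n K
  have hun := u.isLt
  have hn : n ≤ segLen n K := by omega
  have hx : ∀ v w : Fin n, (v : ℕ) = w ↔ v = w := fun v w => Fin.ext_iff.symm
  have hlen1 : F.length - 1 + 1 = F.length := by omega
  obtain ⟨e1, e2⟩ := pick_random_values hF hf hpos hlen h17
  refine MeanLE.seq hn (R := fun μ₁ D₁ => ∃ y < F.length, μ₁ = μ.set 3 u y ∧ D₁ = D)
    (g' := fun c' => clash a b fun w => if w = u then F.getD (c' u) 0 else c w)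
    (Triple.random 3 u (F.length - 1) (by omega) e1 e2 fun y hy => ⟨y, by omega, rfl, rfl⟩)
    (MeanLE.random hn 3 u (F.length - 1) (by omega) e1 e2 ?_) ?_
  · have hinj : ∀ y z : Fin (F.length - 1 + 1), F.getD y 0 = F.getD z 0 → y = z := by
      intro y z hyz
      rw [List.getD_eq_getElem _ _ (by omega), List.getD_eq_getElem _ _ (by omega)] at hyz
      exact Fin.ext ((hnd.getElem_inj_iff).1 hyz)
    simp only [clash, Store.set_same, Function.update_self]
    rcases hu with rfl | rfl
    · simp only [if_true, if_neg hab.symm]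
      refine (sum_ite_div_le (fun y : Fin (F.length - 1 + 1) => F.getD y 0 = c b)
        fun y z hy hz => hinj y z (hy.trans hz.symm)).trans ?_
      rw [hlen1]
    · simp only [if_true, if_neg hab]
      refine (sum_ite_div_le (fun y : Fin (F.length - 1 + 1) => c a = F.getD y 0)
        fun y z hy hz => hinj y z (hy.symm.trans hz)).trans ?_
      rw [hlen1]
  · rintro μ₁ D₁ ⟨y, hy, rfl, rfl⟩
    refine MeanLE.of_triple hn (pick_assign hF hf hlen h10 hy) ?_
    rintro μ₂ D₂ ⟨-, -, -, h4, -⟩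
    refine le_of_eq (congrArg (clash a b) ?_)
    funext w
    rw [h4]
    simp only [Function.update_apply, hx, Store.set_same, if_true]
    split_ifs
    · rw [List.getD_eq_getElem _ _ hy]
    · rfl

end pick

/-- When the endpoints of a new edge have the same random color, recolor the first of them. -/
def randInsert : Prog :=
  .ite ((item 3 (reg 1) - item 3 (reg 2)) + (item 3 (reg 2) - item 3 (reg 1))) .skip
    (freeCode ;; pickCode)

/-- As subtraction is truncated, the sum of both differences vanishes only for equal numbers. -/
theorem value_differ (hF : Fits M K fuel) {σ : Layers n} {u v : Fin n} {c : ℕ → ℕ}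
    {μ : Store} {D : List (Update n)} (hf : Frame C K σ u v c D μ D)
    (hcol : ∀ w : Fin n, c w < 5 * K) :
    value M (segLen n K) D μ
      ((item 3 (reg 1) - item 3 (reg 2)) + (item 3 (reg 2) - item 3 (reg 1))) = 0 ↔ c u = c v := by
  have hZ := segLen_ge n K
  have hW := hF.le_W
  have hun := u.isLt
  have hvn := v.isLt
  have h1 := hcol u
  have h2 := hcol v
  simp (disch := omega) [Nat.mod_eq_of_lt, hf.core.Z_eq, hf.left, hf.right, hf.palette_eq]
  omega

/-- Recoloring takes `O(K)` steps, which only happens when the new edge is monochromatic. -/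
theorem randInsert_spec (hF : Fits M K fuel) {σ : Layers n} {u v : Fin n} {c : ℕ → ℕ}
    {μ : Store} {D : List (Update n)} (hf : Frame C K σ u v c D μ D)
    (hcol : ∀ w : Fin n, c w < 5 * K) :
    Triple M G fuel (segLen n K) randInsert μ D (if c u = c v then 1000 * K else 50)
      fun μ' D' => Core C K σ μ' ∧ μ' 0 1 = u ∧ μ' 0 2 = v ∧ (c u ≠ c v ∧ μ' 3 = c ∨
        c u = c v ∧ ∃ y, y < 5 * K ∧ (∀ w ∈ σ.recent u, c w ≠ y) ∧
          μ' 3 = Function.update c u y) ∧ D' = D := by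
  have hK := hF.K_pos
  have hrec := hf.core.recent_le u
  refine Triple.weaken (Triple.ite (c := if c u = c v then 800 * K else 1) ?_ ?_) ?_
  · intro h
    rw [value_differ hF hf hcol] at h
    rw [if_pos h]
    have h4 := le_length_freeColors (fun w : Fin n => c w) hrec
    refine Triple.seq_of (600 * K + 100) 50 (freeCode_spec hF hf hcol) ?_ ?_
    · rintro μ₁ D₁ ⟨hf₁, h17, h10⟩
      obtain rfl := hf₁.hist_eq
      refine (pickCode_spec hF hf₁ (by omega) (length_freeColors_le _ _)
        h17 h10).mono le_rfl ?_
      rintro μ₂ D₂ ⟨hc, h1, h2, ⟨y, hy, h3⟩, hD⟩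
      obtain ⟨hy1, hy2⟩ := mem_freeColors.1 hy
      exact ⟨hc, h1, h2, Or.inr ⟨h, y, hy1, hy2, h3⟩, hD⟩
    · omega
  · intro h
    rw [ne_eq, value_differ hF hf hcol] at h
    rw [if_neg h]
    exact Triple.skip ⟨hf.core, hf.left, hf.right, Or.inl ⟨h, hf.palette_eq⟩, rfl⟩
  · split_ifs <;> simp
    omega

/-- An insertion creates a clash of `a` and `b` only if it recolors one of them, and then with
probability at most `1 / (4 * K)`. -/
theorem randInsert_mean (hF : Fits M K fuel) {σ : Layers n} {u v : Fin n} {c : ℕ → ℕ}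
    {μ : Store} {D : List (Update n)} (hf : Frame C K σ u v c D μ D)
    (hcol : ∀ w : Fin n, c w < 5 * K) {a b : Fin n} (hab : a ≠ b) :
    MeanLE M G fuel (segLen n K) randInsert μ D (clash a b) (clash a b (fun w => c w) +
      if a = u ∨ b = u then 1 / (4 * K : ℕ) * clash u v (fun w => c w) else 0) := by
  have hZ := segLen_ge n K
  have hn : n ≤ segLen n K := by omega
  have hrec := hf.core.recent_le u
  have hK := hF.K_pos
  by_cases hu : a = u ∨ b = u
  · rw [if_pos hu]
    refine MeanLE.ite ?_ ?_
    · intro h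
      rw [value_differ hF hf hcol] at h
      have h4 := le_length_freeColors (fun w : Fin n => c w) hrec
      refine MeanLE.seq_triple (freeCode_spec hF hf hcol) ?_
      rintro μ₁ D₁ ⟨hf₁, h17, h10⟩
      obtain rfl := hf₁.hist_eq
      intro t r
      refine (pickCode_mean hF hf₁ (by omega) (length_freeColors_le _ _)
        h17 h10 (freeColors_nodup _ _) hab hu t r).trans ?_
      refine le_trans ?_ le_add_self
      rw [clash, if_pos h, mul_one]
      gcongr
    · intro h
      refine MeanLE.of_triple hn (Triple.skip (Q := fun μ' _ => μ' 3 = c) hf.palette_eq) ?_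
      rintro μ' D' rfl
      exact le_self_add
  · rw [if_neg hu, add_zero]
    refine MeanLE.of_triple hn (randInsert_spec hF hf hcol) ?_
    rintro μ' D' ⟨-, -, -, ⟨-, h3⟩ | ⟨-, y, -, -, h3⟩, -⟩
    · rw [h3]
    · refine le_of_eq ?_
      have hx : ∀ v w : Fin n, (v : ℕ) = w ↔ v = w := fun v w => Fin.ext_iff.symm
      rw [not_or] at hu
      simp [clash, h3, hx, hu]

end

section

variable {M : Machine n} {G : SimpleGraph (Fin n)} {C K fuel : ℕ}

/-! ### The randomized algorithm -/

/-- The randomized algorithm: the color of a vertex consists of its level, its static color and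
its random color. -/
def randAlgorithm : Algorithm where
  preprocess := setupCode ;;
    .lit 11 ::= .lit 0 ;; .lit 18 ::= .lit 0 ;; .lit 15 ::= reg 3 ;; resampleCode
  update := updateCode randInsert .skip resampleCode
  color := item 3 (reg 0) * ((reg 8 + .lit 1) * reg 4) + layerColor

/-- The random colors are in range, and vertices that are recent partners of each other have
different ones. -/
structure Distinct (K : ℕ) (ρ : Fin n → List (Fin n)) (c : ℕ → ℕ) : Prop where
  lt : ∀ v : Fin n, c v < 5 * K
  ne : ∀ u v : Fin n, v ∈ ρ u → u ∈ ρ v → c u ≠ c v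

/-- The number of vertices that an update recolors because of a monochromatic edge. -/
def hits (c : Fin n → ℕ) : Update n → ℕ
  | .insert u v => if c u = c v then 1 else 0
  | .delete _ _ => 0

/-- The vertices whose color may be changed by an update. -/
def touched (K : ℕ) (σ : Layers n) (c : Fin n → ℕ) (x : Update n) : Finset (Fin n) :=
  σ.moved K x ∪ match x with
    | .insert u v => if c u = c v then {u} else ∅
    | .delete _ _ => ∅

theorem card_touched_le (σ : Layers n) (c : Fin n → ℕ) (x : Update n) :
    (touched K σ c x).card ≤ (σ.moved K x).card + hits c x := by
  refine (Finset.card_union_le _ _).trans ?_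
  cases x with
  | delete u v => simp
  | insert u v => simp only [hits]; split_ifs <;> simp

theorem hits_le_one (c : Fin n → ℕ) (x : Update n) : hits c x ≤ 1 := by
  cases x with
  | delete u v => simp [hits]
  | insert u v => simp only [hits]; split_ifs <;> simp

theorem Frame.of_record (σ : Layers n) {u v : Fin n} {μ μ' : Store} {D : List (Update n)}
    (hc : Core C K (σ.record u v) μ') (h0 : μ' 0 = announced μ (.insert u v) 0)
    (h3 : μ' 3 = announced μ (.insert u v) 3) : Frame C K (σ.record u v) u v (μ 3) D μ' D where
  core := hc
  left := by rw [h0]; simp [announced]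
  right := by rw [h0]; simp [announced]
  palette_eq := by rw [h3, announced_seg _ _ (by norm_num)]
  hist_eq := rfl

/-- The first endpoint gets a color that is different from those of all its recent partners, including
the second endpoint. -/
theorem Distinct.insert {σ : Layers n} (hs : σ.Valid K) {u v : Fin n} (huv : u ≠ v) {c c' : ℕ → ℕ}
    (hd : Distinct K σ.recent c) (h : c u ≠ c v ∧ c' = c ∨ c u = c v ∧ ∃ y, y < 5 * K ∧
      (∀ w ∈ (σ.record u v).recent u, c w ≠ y) ∧ c' = Function.update c u y) :
    Distinct K (σ.record u v).recent c' := by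
  have hx : ∀ v w : Fin n, (v : ℕ) = w ↔ v = w := fun v w => Fin.ext_iff.symm
  rcases h with ⟨hne, rfl⟩ | ⟨-, y, hy, hfree, rfl⟩
  · refine ⟨hd.lt, fun a b hab hba => ?_⟩
    rw [Layers.mem_record_recent σ huv] at hab hba
    rcases hab with hab | ⟨rfl, rfl⟩ | ⟨rfl, rfl⟩
    · rcases hba with hba | ⟨rfl, rfl⟩ | ⟨rfl, rfl⟩
      · exact hd.ne a b hab hba
      · exact hne.symm
      · exact hne
    · exact hne
    · exact hne.symm
  · refine ⟨fun w => ?_, fun a b hab hba => ?_⟩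
    · simp only [Function.update_apply, hx]
      split_ifs
      · exact hy
      · exact hd.lt w
    · simp only [Function.update_apply, hx]
      by_cases ha : a = u
      · subst ha
        have hb : b ≠ a := by
          rintro rfl
          rw [Layers.mem_record_recent σ huv] at hab
          rcases hab with hab | ⟨-, rfl⟩ | ⟨rfl, -⟩
          · exact hs.not_mem_recent _ hab
          · exact huv rfl
          · exact huv rfl
        rw [if_pos rfl, if_neg hb]
        exact (hfree b hab).symm
      · by_cases hb : b = u
        · subst hb
          rw [if_neg ha, if_pos rfl]
          exact hfree a hba
        · rw [if_neg ha, if_neg hb]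
          rw [Layers.mem_record_recent σ huv] at hab hba
          have hab' : b ∈ σ.recent a := by tauto
          have hba' : a ∈ σ.recent b := by tauto
          exact hd.ne a b hab' hba'

theorem randUpdate_spec (hF : Fits M K fuel) (hT : Monotone M.T) (hT' : ∀ m, m ≤ M.T m)
    (hlt : ∀ S v, v ∈ S → M.static G S v < M.W) {σ : Layers n} (hs : σ.Settled K)
    {μ : Store} {D : List (Update n)} (hc : Core C K σ μ) {G₀ : SimpleGraph (Fin n)}
    {x : Update n} (hx : x.Legal G₀) (hd : Distinct K σ.recent (μ 3)) :
    Triple M G fuel (segLen n K) randAlgorithm.update (announced μ x) D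
      (1000 + 2000 * σ.weight K (fun k => M.T (n / 2 ^ k)) x +
        1000 * K * hits (fun w => μ 3 w) x) fun μ' _ =>
        Core C K (σ.step M.static K G x) μ' ∧
        Distinct K (σ.step M.static K G x).recent (μ' 3) ∧
        ∀ w ∉ touched K σ (fun w => μ 3 w) x, μ' 3 w = μ 3 w := by
  have hc' := hc.announced x
  have h3 := announced_seg μ x (i := 3) (by norm_num)
  cases x with
  | delete u v =>
    refine (updateCode_delete (onDelete := .skip) (c := 1)
      (Q := fun μ' _ => μ' = announced μ (.delete u v)) hF (by simp [announced])
      (Triple.skip rfl)).mono (by simp [Layers.weight, hits]) ?_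
    rintro μ' D' rfl
    rw [h3]
    exact ⟨hc', hd, fun _ _ => rfl⟩
  | insert u v =>
    have huv : u ≠ v := hx.1
    obtain ⟨hcost, -, -⟩ := Layers.length_moving_le_cost hT hT' (hs.valid_pushed huv) hF.two_le
    have key := updateCode_insert (onInsert := randInsert) (onDelete := .skip)
      (onMove := resampleCode) (cI := if μ 3 u = μ 3 v then 1000 * K else 50)
      (cM := 60 * (σ.pushed K u v).moving.length + 20)
      hF hT hT' hlt hs hc' huv (by simp [announced]) (by simp [announced]) (by simp [announced])
      (fun c _ _ => Distinct K (σ.record u v).recent c ∧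
        ∀ w : Fin n, ¬ (μ 3 u = μ 3 v ∧ w = u) → c w = μ 3 w)
      (fun c _ _ => Distinct K ((σ.pushed K u v).forget (σ.pushed K u v).moving).recent c ∧
        ∀ w : Fin n, w ∉ (σ.pushed K u v).moving → ¬ (μ 3 u = μ 3 v ∧ w = u) → c w = μ 3 w)
      (D := D) ?_ ?_
    · refine key.mono ?_ ?_
      · simp only [stepCost, Layers.weight, hits]
        split_ifs <;> omega
      · rintro μ' D' ⟨hc₁, h₁⟩
        refine ⟨hc₁, ?_⟩
        have htouched : ∀ w, w ∉ touched K σ (fun w => μ 3 w) (.insert u v) →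
            ¬ (μ 3 u = μ 3 v ∧ w = u) := by
          rintro w hw ⟨h, rfl⟩
          simp [touched, h] at hw
        simp only [Layers.step]
        split_ifs at h₁ ⊢ with hf
        · obtain ⟨hd₁, hw₁⟩ := h₁
          refine ⟨?_, fun w hw => hw₁ w ?_ (htouched w hw)⟩
          · have hrec : ((σ.pushed K u v).rebuild M.static G).recent =
                ((σ.pushed K u v).forget (σ.pushed K u v).moving).recent := by
              funext y
              rw [Layers.rebuild_recent]
              rfl
            rwa [hrec]
          · intro hmem
            exact hw (Finset.mem_union_left _ (by simpa [Layers.moved, hf] using hmem))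
        · obtain ⟨hd₁, hw₁⟩ := h₁
          exact ⟨by simpa using hd₁, fun w hw => hw₁ w (htouched w hw)⟩
    · intro μ' hc₁ h0₁ h3₁ _
      refine (randInsert_spec hF (Frame.of_record σ hc₁ h0₁ h3₁) hd.lt).mono le_rfl ?_
      rintro μ'' D'' ⟨hc₂, hu₂, hv₂, h, rfl⟩
      refine ⟨hc₂, hu₂, hv₂, hd.insert hs.toValid huv h, fun w hw => ?_⟩
      rcases h with ⟨-, h⟩ | ⟨heq, y, -, -, h⟩
      · rw [h]
      · have hwu : (w : ℕ) ≠ u := fun h' => hw ⟨heq, Fin.ext h'⟩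
        rw [h, Function.update_of_ne hwu]
    · rintro τ L k f μ' D' rfl hτ hr ⟨hd₁, hw₁⟩
      refine (resampleCode_spec hF hr).mono le_rfl ?_
      rintro μ'' D'' ⟨hr₂, hin, hout, rfl⟩
      refine ⟨Or.inl hr₂, ⟨fun w => ?_, fun a b hab hba => ?_⟩, fun w hw hne => ?_⟩
      · by_cases hw : w ∈ (σ.pushed K u v).moving
        · exact hin w hw
        · rw [hout w hw]
          exact hd₁.lt w
      · simp only [Layers.forget] at hab hba
        split_ifs at hab with ha
        · simp at hab
        split_ifs at hba with hb
        · simp at hba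
        rw [hout a ha, hout b hb]
        exact hd₁.ne a b (by simpa using hab) (by simpa using hba)
      · rw [hout w hw, hw₁ w hne]

theorem clash_update_delete (hF : Fits M K fuel) {μ : Store} {D : List (Update n)}
    {u v a b : Fin n} :
    MeanLE M G fuel (segLen n K) randAlgorithm.update (announced μ (.delete u v)) D (clash a b)
      (clash a b fun w => μ 3 w) := by
  have hZ := segLen_ge n K
  refine MeanLE.of_triple (by omega) (updateCode_delete (onDelete := .skip) (c := 1)
    (Q := fun μ' _ => μ' 3 = μ 3) hF (by simp [announced])
    (Triple.skip (announced_seg μ _ (by norm_num)))) ?_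
  rintro μ' D' h
  rw [h]

/-- The probability of a clash of `a` and `b` after an insertion. -/
theorem clash_update_insert (hF : Fits M K fuel)
    (hlt : ∀ S v, v ∈ S → M.static G S v < M.W) {σ : Layers n} (hs : σ.Settled K)
    {μ : Store} {D : List (Update n)} (hc : Core C K σ μ) {u v : Fin n} (huv : u ≠ v)
    (hd : Distinct K σ.recent (μ 3)) {a b : Fin n} (hab : a ≠ b) :
    MeanLE M G fuel (segLen n K) randAlgorithm.update (announced μ (.insert u v)) D (clash a b)
      (if a ∈ σ.moved K (.insert u v) ∨ b ∈ σ.moved K (.insert u v) then 1 / (5 * K : ℕ) else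
        clash a b (fun w => μ 3 w) + if a = u ∨ b = u then
          1 / (4 * K : ℕ) * clash u v (fun w => μ 3 w) else 0) := by
  have hZ := segLen_ge n K
  have hn : n ≤ segLen n K := by omega
  refine updateCode_insert_mean (cI := if μ 3 u = μ 3 v then 1000 * K else 50)
    (cM := 60 * (σ.pushed K u v).moving.length + 20) hF hlt hs (hc.announced _) huv
    (by simp [announced]) (by simp [announced]) (by simp [announced]) (clash a b)
    (fun c => if a ∈ (σ.pushed K u v).moving ∨ b ∈ (σ.pushed K u v).moving then 1 / (5 * K : ℕ)
      else clash a b c) _ ?_ ?_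
  · intro μ' hc₁ h0₁ h3₁ _
    have hf : Frame C K (σ.record u v) u v (μ 3) D μ' D := Frame.of_record σ hc₁ h0₁ h3₁
    have hspec := randInsert_spec (G := G) hF hf hd.lt
    refine ⟨hspec.mono le_rfl fun μ'' D'' h => ⟨h.1, h.2.1, h.2.2.1⟩, ?_⟩
    by_cases hfull : σ.Full K u v
    · simp only [Layers.moved, if_pos hfull, List.mem_toFinset]
      by_cases hm : a ∈ (σ.pushed K u v).moving ∨ b ∈ (σ.pushed K u v).moving
      · simp only [if_pos hm]
        exact MeanLE.of_triple hn hspec fun _ _ _ => le_rfl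
      · simp only [if_neg hm]
        exact randInsert_mean hF hf hd.lt hab
    · simp only [Layers.moved, if_neg hfull, Finset.notMem_empty, or_self, if_false]
      exact randInsert_mean hF hf hd.lt hab
  · rintro τ L k f μ' D' rfl hr
    exact ⟨(resampleCode_spec hF hr).mono le_rfl fun _ _ h => h.1, resampleCode_mean hF hr hab⟩

/-- The hypotheses on the machine on which the randomized algorithm runs. -/
structure RandSetting (M : Machine n) (𝒢 : Set (SimpleGraph (Fin n))) (C K fuel : ℕ) : Prop where
  fits : Fits M K fuel
  T_mono : Monotone M.T
  le_T : ∀ m, m ≤ M.T m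
  static_colors : M.static.Colors 𝒢 C
  dyn_eq : M.dyn = DynamicAlgorithm.null n
  C_pos : 0 < C
  C_le : C ≤ M.W
  colors_lt : 5 * K * ((Nat.log 2 n + 1) * C) < M.W

theorem totalTime_null (D : List (Update n)) : (DynamicAlgorithm.null n).totalTime D = 0 := by
  induction D with
  | nil => rfl
  | cons x D ih => simp only [DynamicAlgorithm.totalTime, ih]; rfl

/-- The invariant of the randomized algorithm. -/
def RandInv (M : Machine n) (C K : ℕ) (h : List (Update n)) (s : State n) : Prop :=
  ∃ μ D t r, s = mkState (segLen n K) μ D t r ∧ Core C K (Layers.after M.static K h) μ ∧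
    Distinct K (Layers.after M.static K h).recent (μ 3) ∧
    r ≤ Layers.rebuildCost M.static K (fun k => n / 2 ^ k) h + h.length

section run

variable {𝒢 : Set (SimpleGraph (Fin n))} {h : List (Update n)}

theorem RandSetting.coloring_eq (hS : RandSetting M 𝒢 C K fuel)
    (hh : IsHistory (fun G => G ∈ 𝒢) h) {μ : Store} {D : List (Update n)}
    (hc : Core C K (Layers.after M.static K h) μ) (t r : ℕ) (v : Fin n) (hlt : μ 3 v < 5 * K) :
    randAlgorithm.coloring M (mkState (segLen n K) μ D t r) v =
      μ 3 v * ((Nat.log 2 n + 1) * C) + (Layers.after M.static K h).code C v := by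
  have hF := hS.fits
  have hZ := segLen_ge n K
  have hW := hF.le_W
  have hv := (Layers.settled_after hF.K_pos M.static hh).toValid
  have hs := Layers.sound_after hF.K_pos hS.C_pos hS.static_colors hh
  have hcode := Layers.code_lt hv hs v
  have hlt' := mul_add_lt_mul hlt hcode
  have hW' := hS.colors_lt
  have hlog : Nat.log 2 n ≤ n := (Nat.log_lt_self 2 (by have := hF.two_le; omega)).le
  have h1 : (Nat.log 2 n + 1) * C < M.W :=
    (Nat.le_mul_of_pos_left _ (by omega)).trans_lt hW'
  have h3 : C < M.W := (Nat.le_mul_of_pos_left _ (by omega)).trans_lt h1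
  have h4 : μ 3 v * ((Nat.log 2 n + 1) * C) < M.W := by omega
  have hvn := v.isLt
  rw [coloring_mkState (by omega)]
  show value M (segLen n K) D (μ.set 0 0 v) (item 3 (reg 0) * ((reg 8 + .lit 1) * reg 4) +
    layerColor) = _
  rw [value_add, value_layerColor hF hc hv hs h1.le]
  simp (disch := omega) [Nat.mod_eq_of_lt, hc.I_eq, hc.C_eq, hc.Z_eq]

theorem RandInv.proper (hS : RandSetting M 𝒢 C K fuel) (hh : IsHistory (fun G => G ∈ 𝒢) h)
    {s : State n} (hI : RandInv M C K h s) :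
    Proper (graphOf h) (randAlgorithm.coloring M s) ∧
      ∀ v, randAlgorithm.coloring M s v < 5 * K * ((Nat.log 2 n + 1) * C) := by
  obtain ⟨μ, D, t, r, rfl, hc, hd, -⟩ := hI
  have hv := (Layers.settled_after hS.fits.K_pos M.static hh).toValid
  have hs := Layers.sound_after hS.fits.K_pos hS.C_pos hS.static_colors hh
  refine ⟨fun u v huv => ?_, fun v => ?_⟩
  · rw [hS.coloring_eq hh hc _ _ _ (hd.lt u), hS.coloring_eq hh hc _ _ _ (hd.lt v)]
    intro heq
    obtain ⟨h1, h2⟩ := eq_of_mul_add_eq (Layers.code_lt hv hs u) (Layers.code_lt hv hs v) heq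
    obtain ⟨h3, h4⟩ := eq_of_mul_add_eq (hs.base_lt u) (hs.base_lt v) h2
    rcases hs.base_ne u v huv h3 with h5 | h5
    · exact h5 h4
    · exact hd.ne u v h5.1 h5.2 h1
  · rw [hS.coloring_eq hh hc _ _ _ (hd.lt v)]
    exact mul_add_lt_mul (hd.lt v) (Layers.code_lt hv hs v)

theorem RandSetting.ready_initial {μ : Store}
    (hc : Core C K (Layers.initial n) μ) :
    Ready C K (Layers.initial n) 0 (List.finRange n) (fun v => μ 8 v)
      (((μ.set 0 11 0).set 0 18 0).set 0 15 n) := by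
  refine { ((hc.set 0 (by omega)).set 0 (by omega)).set n (by omega) with
    part_eq := by simp [Layers.part, Layers.initial]
    le_log := Nat.zero_le _
    start_le := by simp [Layers.initial]
    level_var := by simp
    length_var := by simp
    start_var := by simp [Layers.initial]
    color_eq := by simp }

/-- The effect of the preprocessing before the colors are drawn. -/
theorem RandSetting.preprocess (hS : RandSetting M 𝒢 C K fuel) (Δ : ℕ) :
    Triple M ⊥ fuel (segLen n K) setupCode (startStore n C K Δ) [] (200 * n) fun μ D =>
      Triple M ⊥ fuel (segLen n K) (.lit 11 ::= .lit 0 ;; .lit 18 ::= .lit 0 ;;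
        .lit 15 ::= reg 3 ;; resampleCode) μ D (60 * n + 60)
        (fun μ' _ => Core C K (Layers.initial n) μ' ∧
          Distinct K (Layers.initial n).recent (μ' 3)) ∧
      ∀ a b, a ≠ b → MeanLE M ⊥ fuel (segLen n K) (.lit 11 ::= .lit 0 ;; .lit 18 ::= .lit 0 ;;
        .lit 15 ::= reg 3 ;; resampleCode) μ D (clash a b) (1 / (5 * K : ℕ)) := by
  have hF := hS.fits
  have hZ := segLen_ge n K
  have hW := hF.le_W
  refine (setupCode_spec hF Δ).mono le_rfl ?_
  rintro μ D ⟨hc, -, rfl⟩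
  have hr := RandSetting.ready_initial hc
  refine ⟨?_, fun a b hab => ?_⟩
  · refine Triple.assign_seq (60 * n + 45) 0 11 0 (by omega)
      (by simp (disch := omega) [Nat.mod_eq_of_lt]) (by simp) (by simp; omega) ?_
    refine Triple.assign_seq (60 * n + 30) 0 18 0 (by omega)
      (by simp (disch := omega) [Nat.mod_eq_of_lt]) (by simp) (by simp; omega) ?_
    refine Triple.assign_seq (60 * n + 20) 0 15 n (by omega)
      (by simp (disch := omega) [Nat.mod_eq_of_lt])
      (by simp (disch := omega) [Nat.mod_eq_of_lt, hc.n_eq]) (by simp; omega) ?_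
    refine (resampleCode_spec hF hr).mono (by simp) ?_
    rintro μ' D' ⟨hr', hin, -, -⟩
    exact ⟨hr'.toCore, fun v => hin v (List.mem_finRange v), fun u v huv => by
      simp [Layers.initial] at huv⟩
  · refine MeanLE.seq_triple (R := fun μ₁ D₁ => μ₁ = μ.set 0 11 0 ∧ D₁ = []) (Triple.assign 0 11 0
      (by omega) (by simp (disch := omega) [Nat.mod_eq_of_lt]) (by simp) ⟨rfl, rfl⟩) ?_
    rintro μ₁ D₁ ⟨rfl, rfl⟩
    refine MeanLE.seq_triple (R := fun μ₁ D₁ => μ₁ = (μ.set 0 11 0).set 0 18 0 ∧ D₁ = [])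
      (Triple.assign 0 18 0
      (by omega) (by simp (disch := omega) [Nat.mod_eq_of_lt]) (by simp) ⟨rfl, rfl⟩) ?_
    rintro μ₁ D₁ ⟨rfl, rfl⟩
    refine MeanLE.seq_triple (R := fun μ₁ D₁ =>
      μ₁ = ((μ.set 0 11 0).set 0 18 0).set 0 15 n ∧ D₁ = []) (Triple.assign 0 15 n
      (by omega) (by simp (disch := omega) [Nat.mod_eq_of_lt])
      (by simp (disch := omega) [Nat.mod_eq_of_lt, hc.n_eq]) ⟨rfl, rfl⟩) ?_
    rintro μ₁ D₁ ⟨rfl, rfl⟩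
    have key := resampleCode_mean (M := M) (G := ⊥) (D := []) hF hr hab
    rwa [if_pos (Or.inl (List.mem_finRange a))] at key

theorem RandSetting.prepare (hS : RandSetting M 𝒢 C K fuel) (Δ : ℕ) :
    Surely (randAlgorithm.prepare M [n, C, K, Δ] fuel) fun s => s.time ≤ 1000 * n ∧
      RandInv M C K [] { s with time := 0 } := by
  have hn := hS.fits.two_le
  have key := ((hS.preprocess Δ).mono le_rfl fun _ _ h => h.1).seq
  rw [Algorithm.prepare, start_eq_mkState]
  refine (key 0 0).mono ?_
  rintro s ⟨μ, D, t, rfl, ht, hc, hd⟩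
  refine ⟨?_, μ, D, 0, 0, rfl, hc, hd, Nat.zero_le _⟩
  show t ≤ 1000 * n
  rw [hS.dyn_eq, totalTime_null, totalTime_null] at ht
  omega

/-- One update surely preserves the invariant; the elapsed time depends on whether the new edge is
monochromatic. -/
theorem RandInv.step (hS : RandSetting M 𝒢 C K fuel) {x : Update n}
    (hh : IsHistory (fun G => G ∈ 𝒢) (x :: h)) {s : State n} (hI : RandInv M C K h s) :
    Surely (randAlgorithm.update.exec M (graphOf (x :: h)) fuel (s.announce x)) fun s' =>
      RandInv M C K (x :: h) { s' with
        recolorings := s.recolorings +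
          changes (randAlgorithm.coloring M s) (randAlgorithm.coloring M s') } ∧
      s'.time ≤ s.time + (1000 + 2000 *
        (Layers.after M.static K h).weight K (fun k => M.T (n / 2 ^ k)) x) +
          1000 * K * hits (palette (segLen n K) s) x := by
  obtain ⟨μ, D, t, r, rfl, hc, hd, hr⟩ := hI
  have hZ := segLen_ge n K
  have hF := hS.fits
  have hs := Layers.settled_after hF.K_pos M.static hh.2.2
  rw [announce_mkState (by omega)]
  refine ((randUpdate_spec (G := graphOf (x :: h)) (D := D) hF hS.T_mono hS.le_T (fun S v hv =>
    ((hS.static_colors _ hh.2.1 S).1 v hv).trans_le hS.C_le) hs hc hh.1 hd) t r).mono ?_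
  rintro s ⟨μ', D', t', rfl, ht', hc', hd', hsame⟩
  rw [hS.dyn_eq, totalTime_null, totalTime_null] at ht'
  refine ⟨⟨μ', D', t', _, rfl, hc', hd', ?_⟩, ?_⟩
  · have hcol : changes (randAlgorithm.coloring M (mkState (segLen n K) μ D t r))
        (randAlgorithm.coloring M (mkState (segLen n K) μ' D' t' r)) ≤
          (touched K (Layers.after M.static K h) (fun w => μ 3 w) x).card := by
      have := changes_le_add_card (f := randAlgorithm.coloring M (mkState (segLen n K) μ D t r))
        (g := randAlgorithm.coloring M (mkState (segLen n K) μ' D' t' r)) (f' := fun _ => 0)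
        (g' := fun _ => 0) (touched K (Layers.after M.static K h) (fun w => μ 3 w) x) ?_
      · simpa [changes_self] using this
      · intro v hv _
        have hv' : v ∉ (Layers.after M.static K h).moved K x := fun hm =>
          hv (Finset.mem_union_left _ hm)
        rw [hS.coloring_eq hh.2.2 hc _ _ _ (hd.lt v),
          hS.coloring_eq hh (h := x :: h) hc' _ _ _ (hd'.lt v), hsame v hv, Layers.after,
          Layers.code_step_of_notMem hv']
    have h1 := hs.card_moved_le hh.1
    have h2 := card_touched_le (K := K) (Layers.after M.static K h) (fun w => μ 3 w) x
    have h3 := hits_le_one (fun w : Fin n => μ 3 w) x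
    show r + changes _ _ ≤ _
    simp only [Layers.rebuildCost, List.length_cons]
    omega
  · rw [MeanLE.palette_mkState (by omega)]
    show t' ≤ t + _ + _
    omega

theorem RandSetting.run (hS : RandSetting M 𝒢 C K fuel) (Δ : ℕ)
    (hh : IsHistory (fun G => G ∈ 𝒢) h) :
    Surely (randAlgorithm.run M [n, C, K, Δ] fuel h) (RandInv M C K h) :=
  run_surely (𝒬 := fun G => G ∈ 𝒢) (RandInv M C K) ((hS.prepare Δ).mono fun _ hs => hs.2)
    (fun _ _ _ hh hI => (hI.step hS hh).mono fun _ hs => hs.1) h hh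

theorem mean_run_cons {P : Algorithm} {ps : List ℕ} {Q : State n → Prop} {x : Update n}
    (hs : Surely (P.run M ps fuel h) Q) (g : State n → ℝ≥0∞) :
    mean (P.run M ps fuel (x :: h)) g = mean (P.run M ps fuel h) fun s =>
      mean (P.update.exec M (graphOf (x :: h)) fuel (s.announce x)) fun s' =>
        g { s' with
          recolorings := s.recolorings + changes (P.coloring M s) (P.coloring M s') } := by
  rw [Algorithm.run, mean_andThen hs]
  congr 1
  funext s
  exact mean_map _ (fun s' => { s' with
    recolorings := s.recolorings + changes (P.coloring M s) (P.coloring M s') }) g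

/-- A bound for the probability that `a` and `b` have the same random color: it is `1 / (5 * K)` when
both have no recent insertions, grows by `1 / (10 * K ^ 2)` with each recent insertion of one of them,
and never exceeds `2 / (5 * K)`. -/
noncomputable def pairBound (K : ℕ) (σ : Layers n) (a b : Fin n) : ℝ≥0∞ :=
  (2 * K + (σ.recent a).length + (σ.recent b).length : ℕ) / (10 * K * K : ℕ)

theorem one_div_le_pairBound (hK : 0 < K) (σ : Layers n) (a b : Fin n) :
    1 / (5 * K : ℕ) ≤ pairBound K σ a b := by
  rw [pairBound, ENNReal.le_div_iff_mul_le (Or.inl (by positivity))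
    (Or.inl (ENNReal.natCast_ne_top _)), one_div,
    mul_comm, ← div_eq_mul_inv]
  refine ENNReal.div_le_of_le_mul ?_
  have : 10 * K * K ≤ (2 * K + (σ.recent a).length + (σ.recent b).length) * (5 * K) := by
    nlinarith
  exact_mod_cast this

/-- An insertion at `a` recolors `a` with probability at most `pairBound`, and the new color is that of `b`
with probability at most `1 / (4 * K)`; the growth of `pairBound` makes up for this. -/
theorem div_mul_pairBound_le {σ : Layers n} (hs : σ.Settled K) (u v : Fin n) :
    1 / (4 * K : ℕ) * pairBound K σ u v ≤ 1 / (10 * K * K : ℕ) := by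
  have h1 := hs.length_recent_lt u
  have h2 := hs.length_recent_lt v
  rw [pairBound, ← mul_div_assoc]
  gcongr
  rw [one_div, mul_comm, ← div_eq_mul_inv]
  refine ENNReal.div_le_of_le_mul ?_
  rw [one_mul]
  exact_mod_cast (by omega : _ ≤ 4 * K)

/-- The expected cost of recoloring, which takes `1000 * K` steps, is constant. -/
theorem mul_pairBound_le {σ : Layers n} (hs : σ.Settled K) (u v : Fin n) :
    (1000 * K : ℕ) * pairBound K σ u v ≤ 400 := by
  have h1 := hs.length_recent_lt u
  have h2 := hs.length_recent_lt v
  rw [pairBound, ← mul_div_assoc]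
  refine ENNReal.div_le_of_le_mul ?_
  have : 1000 * K * (2 * K + (σ.recent u).length + (σ.recent v).length) ≤
      400 * (10 * K * K) := by
    have : 2 * K + (σ.recent u).length + (σ.recent v).length ≤ 4 * K := by omega
    nlinarith
  exact_mod_cast this

/-- Two vertices rarely have the same random color. It matters that the updates are fixed in advance:
the layers are deterministic, so that the bound can be applied to the next edge to be inserted. -/
theorem RandSetting.mean_clash_le (hS : RandSetting M 𝒢 C K fuel) (Δ : ℕ)
    (hh : IsHistory (fun G => G ∈ 𝒢) h) {a b : Fin n} (hab : a ≠ b) :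
    mean (randAlgorithm.run M [n, C, K, Δ] fuel h) (fun s => clash a b (palette (segLen n K) s)) ≤
      pairBound K (Layers.after M.static K h) a b := by
  have hF := hS.fits
  have hK := hF.K_pos
  have hZ := segLen_ge n K
  have hn : n ≤ segLen n K := by omega
  induction h generalizing a b with
  | nil =>
    rw [Algorithm.run, mean_map]
    refine le_trans ?_ (one_div_le_pairBound hK _ a b)
    have key := MeanLE.seq_triple (hS.preprocess Δ) fun μ' D' h => h.2 a b hab
    rw [Algorithm.prepare, start_eq_mkState]
    exact key 0 0
  | cons x h ih =>
    have hrun := hS.run Δ hh.2.2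
    have hs := Layers.settled_after hK M.static hh.2.2
    have hlt : ∀ S v, v ∈ S → M.static (graphOf (x :: h)) S v < M.W := fun S v hv =>
      ((hS.static_colors _ hh.2.1 S).1 v hv).trans_le hS.C_le
    rw [mean_run_cons hrun]
    cases x with
    | delete u v =>
      refine le_trans (mean_mono (hrun.mono ?_)) (ih hh.2.2 hab)
      rintro s ⟨μ, D, t, r, rfl, hc, hd, -⟩
      rw [announce_mkState (by omega), MeanLE.palette_mkState hn]
      exact clash_update_delete hF t r
    | insert u v =>
      have huv : u ≠ v := hh.1.1
      have hstep : ∀ s, RandInv M C K h s →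
          mean (randAlgorithm.update.exec M (graphOf (.insert u v :: h)) fuel
            (s.announce (.insert u v))) (fun s' => clash a b (palette (segLen n K) s')) ≤
          if a ∈ (Layers.after M.static K h).moved K (.insert u v) ∨
              b ∈ (Layers.after M.static K h).moved K (.insert u v)
          then (1 : ℝ≥0∞) / (5 * K : ℕ) else clash a b (palette (segLen n K) s) +
            (if a = u ∨ b = u then (1 : ℝ≥0∞) / (4 * K : ℕ) else 0) *
              clash u v (palette (segLen n K) s) := by
        rintro s ⟨μ, D, t, r, rfl, hc, hd, -⟩
        rw [announce_mkState (by omega), MeanLE.palette_mkState hn]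
        simp only [ite_mul, zero_mul]
        exact clash_update_insert hF hlt hs hc huv hd hab t r
      refine le_trans (mean_mono (hrun.mono hstep)) ?_
      -- A vertex that moves gets a new color, which clashes with probability at most `1 / (5 * K)`
      -- whatever happened before.
      by_cases hm : a ∈ (Layers.after M.static K h).moved K (.insert u v) ∨
          b ∈ (Layers.after M.static K h).moved K (.insert u v)
      · simp only [if_pos hm]
        rw [mean_const hrun]
        exact one_div_le_pairBound hK _ a b
      · simp only [if_neg hm]
        rw [mean_add_mul hrun]
        have hrec : ∀ w, w ∉ (Layers.after M.static K h).moved K (.insert u v) →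
            (Layers.after M.static K (.insert u v :: h)).recent w =
              ((Layers.after M.static K h).record u v).recent w := by
          intro w hw
          simp only [Layers.after, Layers.step]
          split_ifs with hf
          · rw [Layers.rebuild_recent, if_neg (by simpa [Layers.moved, hf] using hw)]
            simp
          · simp
        rw [not_or] at hm
        have hlen : pairBound K (Layers.after M.static K (.insert u v :: h)) a b =
            (2 * K + (((Layers.after M.static K h).record u v).recent a).length +
              (((Layers.after M.static K h).record u v).recent b).length : ℕ) /
                (10 * K * K : ℕ) := by
          rw [pairBound, hrec a hm.1, hrec b hm.2]
        rw [hlen, Layers.length_record_recent _ huv, Layers.length_record_recent _ huv]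
        -- The induction hypothesis is used for the pair `a`, `b`, and for the endpoints `u`, `v` of the
        -- new edge, which bounds the probability that `u` is recolored.
        refine le_trans (add_le_add (ih hh.2.2 hab) (mul_le_mul_right (ih hh.2.2 huv) _)) ?_
        by_cases hu : a = u ∨ b = u
        · rw [if_pos hu]
          refine le_trans (add_le_add le_rfl (div_mul_pairBound_le hs u v)) ?_
          rw [pairBound, ENNReal.div_add_div_same]
          gcongr
          have h1 : 1 ≤ (if a = u then 1 else 0) + if b = u then 1 else 0 := by
            rcases hu with hu | hu <;> simp [hu]
          exact_mod_cast (by omega)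
        · rw [if_neg hu, zero_mul, add_zero, pairBound]
          gcongr
          · exact le_add_right (le_add_right le_rfl)
          · exact le_add_right (le_add_right le_rfl)

/-- The expected time: the rebuilds, and for each update a constant number of steps and the expected
cost of recoloring. -/
theorem RandSetting.mean_time_le (hS : RandSetting M 𝒢 C K fuel) (Δ : ℕ)
    (hh : IsHistory (fun G => G ∈ 𝒢) h) :
    mean (randAlgorithm.run M [n, C, K, Δ] fuel h) (fun s => s.time) ≤
      (2000 * (h.length + Layers.rebuildCost M.static K (fun k => M.T (n / 2 ^ k)) h) : ℕ) := by
  have hF := hS.fits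
  have hK := hF.K_pos
  induction h with
  | nil =>
    rw [Algorithm.run, mean_map]
    exact mean_le ((hS.prepare Δ).mono fun s _ => by simp)
  | cons x h ih =>
    have hrun := hS.run Δ hh.2.2
    have hs := Layers.settled_after hK M.static hh.2.2
    rw [mean_run_cons hrun]
    -- `A` bounds the time of the update without the recoloring.
    obtain ⟨A, hA⟩ : ∃ A, A = 1000 + 2000 *
        (Layers.after M.static K h).weight K (fun k => M.T (n / 2 ^ k)) x := ⟨_, rfl⟩
    have hhit : (1000 * K : ℕ) * mean (randAlgorithm.run M [n, C, K, Δ] fuel h)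
        (fun s => (hits (palette (segLen n K) s) x : ℝ≥0∞)) ≤ 400 := by
      cases x with
      | delete u v =>
        simp only [hits, Nat.cast_zero]
        rw [mean_const hrun]
        simp
      | insert u v =>
        refine le_trans (mul_le_mul_right ?_ _) (mul_pairBound_le hs u v)
        refine le_trans (le_of_eq ?_) (hS.mean_clash_le Δ hh.2.2 hh.1.1)
        congr 1
        funext s
        simp [hits, clash]
    calc _ ≤ mean (randAlgorithm.run M [n, C, K, Δ] fuel h) (fun s => (s.time + (A : ℝ≥0∞) * 1) +
          (1000 * K : ℕ) * (hits (palette (segLen n K) s) x : ℝ≥0∞)) := by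
          refine mean_mono (hrun.mono fun s hI => mean_le ((hI.step hS hh).mono fun s' hs' => ?_))
          rw [mul_one]
          have := hs'.2
          rw [← hA] at this
          exact_mod_cast this
      _ = mean (randAlgorithm.run M [n, C, K, Δ] fuel h) (fun s => s.time) + A +
          (1000 * K : ℕ) * mean (randAlgorithm.run M [n, C, K, Δ] fuel h)
            (fun s => (hits (palette (segLen n K) s) x : ℝ≥0∞)) := by
          rw [mean_add_mul hrun, mean_add_mul hrun, mean_const hrun, mul_one]
      _ ≤ _ := by
          refine (add_le_add (add_le_add (ih hh.2.2) le_rfl) hhit).trans ?_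
          have : 2000 * (h.length + Layers.rebuildCost M.static K (fun k => M.T (n / 2 ^ k)) h) +
              A + 400 ≤ 2000 * ((x :: h).length +
                Layers.rebuildCost M.static K (fun k => M.T (n / 2 ^ k)) (x :: h)) := by
            simp only [Layers.rebuildCost, List.length_cons]
            omega
          exact_mod_cast this

end run

end

/-! ### Parameters -/

section parameters

variable {β : ℝ}

theorem one_le_logb (hn : 2 ≤ n) : 1 ≤ Real.logb 2 n := by
  have hn' : (2 : ℝ) ≤ n := by exact_mod_cast hn
  rw [Real.le_logb_iff_rpow_le (by norm_num) (by linarith), Real.rpow_one]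
  exact hn'

theorem natLog_add_one_le (hn : 2 ≤ n) : (Nat.log 2 n + 1 : ℝ) ≤ 2 * Real.logb 2 n := by
  have h1 := one_le_logb hn
  have h2 : (Nat.log 2 n : ℝ) ≤ Real.logb 2 n := by exact_mod_cast Real.natLog_le_logb n 2
  linarith

theorem one_le_logb_div (hβ : 0 < β) (hβ' : β ≤ Real.logb 2 n) : 1 ≤ Real.logb 2 n / β :=
  (one_le_div hβ).2 hβ'

theorem floor_pos (hβ : 0 < β) (hβ' : β ≤ Real.logb 2 n) : 0 < ⌊Real.logb 2 n / β⌋₊ :=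
  Nat.floor_pos.2 (one_le_logb_div hβ hβ')

theorem logb_le_mul_floor (hβ : 0 < β) (hβ' : β ≤ Real.logb 2 n) :
    Real.logb 2 n ≤ 2 * β * ⌊Real.logb 2 n / β⌋₊ := by
  have h1 := Nat.lt_floor_add_one (Real.logb 2 n / β)
  have h2 : (1 : ℝ) ≤ ⌊Real.logb 2 n / β⌋₊ := by exact_mod_cast floor_pos hβ hβ'
  have h3 : Real.logb 2 n / β ≤ 2 * ⌊Real.logb 2 n / β⌋₊ := by linarith
  rw [div_le_iff₀ hβ] at h3
  linarith

theorem floor_le (hβ : 0 < β) (hβ' : β ≤ Real.logb 2 n) :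
    (⌊Real.logb 2 n / β⌋₊ : ℝ) ≤ Real.logb 2 n / β :=
  Nat.floor_le (zero_le_one.trans (one_le_logb_div hβ hβ'))

theorem logb_div_le (hn : 2 ≤ n) (hβ : 0 < β) :
    Real.logb 2 n / β ≤ Real.logb 2 n ^ 2 / β := by
  have h1 := one_le_logb hn
  gcongr
  nlinarith

theorem floor_le_degreeBound (hn : 2 ≤ n) (hβ : 0 < β) :
    ⌊Real.logb 2 n / β⌋₊ ≤ degreeBound n β :=
  (Nat.floor_le_ceil _).trans (Nat.ceil_mono (logb_div_le hn hβ))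

theorem degreeBound_le (hn : 2 ≤ n) (hβ : 0 < β) (hβ' : β ≤ Real.logb 2 n) :
    (degreeBound n β : ℝ) ≤ 2 * (Real.logb 2 n ^ 2 / β) := by
  have h1 := (one_le_logb_div hβ hβ').trans (logb_div_le hn hβ)
  have h2 := Nat.ceil_lt_add_one (zero_le_one.trans h1)
  simp only [degreeBound]
  linarith

/-- The total cost of the rebuilds, when one of level `k` costs `T (n / 2 ^ k)`. -/
theorem rebuildCost_le_staticBound (hn : 2 ≤ n) (hβ : 0 < β) (hβ' : β ≤ Real.logb 2 n)
    (A : StaticAlgorithm n) {P : SimpleGraph (Fin n) → Prop} {h : List (Update n)}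
    (hh : IsHistory P h) (T : ℕ → ℕ) :
    (Layers.rebuildCost A ⌊Real.logb 2 n / β⌋₊ (fun k => T (n / 2 ^ k)) h : ℝ) ≤
      8 * staticBound n β T * h.length := by
  have hL := one_le_logb hn
  have hK := floor_pos hβ hβ'
  have hLK := logb_le_mul_floor hβ hβ'
  have key := Layers.rebuildCost_le hK A hh (fun k => T (n / 2 ^ k))
  generalize ⌊Real.logb 2 n / β⌋₊ = K at *
  generalize Layers.rebuildCost A K (fun k => T (n / 2 ^ k)) h = c at *
  have hn' : (0 : ℝ) < n := by exact_mod_cast (by omega : 0 < n)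
  have hK' : (0 : ℝ) < K := by exact_mod_cast hK
  have key' : (K : ℝ) * n * c ≤ 4 * h.length *
      ∑ k ∈ Finset.range (Nat.log 2 n + 1), (2 : ℝ) ^ k * T (n / 2 ^ k) := by exact_mod_cast key
  rw [staticBound]
  generalize ∑ k ∈ Finset.range (Nat.log 2 n + 1), (2 : ℝ) ^ k * T (n / 2 ^ k) = S at *
  have h1 : Real.logb 2 n * n * c ≤ 8 * β * S * h.length := by
    calc Real.logb 2 n * n * c ≤ 2 * β * K * n * c := by gcongr
      _ = 2 * β * (K * n * c) := by ring
      _ ≤ 2 * β * (4 * h.length * S) := by gcongr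
      _ = _ := by ring
  have h2 : 8 * (β / (n * Real.logb 2 n) * S) * h.length =
      8 * β * S * h.length / (n * Real.logb 2 n) := by
    field_simp
  rw [h2, le_div_iff₀ (by positivity)]
  linarith

/-- The total number of vertices that are moved. -/
theorem rebuildCost_le_length (hn : 2 ≤ n) (hβ : 0 < β) (hβ' : β ≤ Real.logb 2 n)
    (A : StaticAlgorithm n) {P : SimpleGraph (Fin n) → Prop} {h : List (Update n)}
    (hh : IsHistory P h) :
    (Layers.rebuildCost A ⌊Real.logb 2 n / β⌋₊ (fun k => n / 2 ^ k) h : ℝ) ≤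
      16 * β * h.length := by
  have hL := one_le_logb hn
  have hn' : (0 : ℝ) < n := by exact_mod_cast (by omega : 0 < n)
  refine (rebuildCost_le_staticBound hn hβ hβ' A hh id).trans ?_
  refine mul_le_mul_of_nonneg_right ?_ (Nat.cast_nonneg _)
  have hsum : ∑ k ∈ Finset.range (Nat.log 2 n + 1), (2 : ℝ) ^ k * id (n / 2 ^ k) ≤
      2 * Real.logb 2 n * n := by
    calc _ ≤ ∑ k ∈ Finset.range (Nat.log 2 n + 1), (n : ℝ) :=
          Finset.sum_le_sum fun k _ => by exact_mod_cast Nat.mul_div_le n (2 ^ k)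
      _ = (Nat.log 2 n + 1) * n := by simp
      _ ≤ _ := by gcongr; exact natLog_add_one_le hn
  rw [staticBound]
  calc 8 * (β / (n * Real.logb 2 n) *
        ∑ k ∈ Finset.range (Nat.log 2 n + 1), (2 : ℝ) ^ k * id (n / 2 ^ k))
      ≤ 8 * (β / (n * Real.logb 2 n) * (2 * Real.logb 2 n * n)) := by gcongr
    _ = 16 * β := by field_simp; norm_num

theorem staticBound_nonneg (hn : 2 ≤ n) (hβ : 0 < β) (T : ℕ → ℕ) : 0 ≤ staticBound n β T := by
  have hL := one_le_logb hn
  unfold staticBound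
  positivity

/-- Words that hold the seventh power of the sum of the parameters are large enough for all addresses
and colors. -/
theorem word_size_bounds {C K X W c : ℕ} (hn : 2 ≤ n) (hC : 0 < C) (hK : 0 < K) (hX : K ≤ X)
    (hc : 7 ≤ c) (hW : (n + C + X) ^ c ≤ W) :
    16 * segLen n K ≤ W ∧ C ≤ W ∧ 5 * X * ((Nat.log 2 n + 1) * C) < W := by
  obtain ⟨N, hN⟩ : ∃ N, N = n + C + X := ⟨_, rfl⟩
  rw [← hN] at hW
  have hN4 : 4 ≤ N := by omega
  have hW' : N ^ 7 ≤ W := (Nat.pow_le_pow_right (by omega) hc).trans hW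
  have hlog : Nat.log 2 n < n := Nat.log_lt_self 2 (by omega)
  have h1 : 4 ^ 4 * N ^ 3 ≤ N ^ 7 := by
    calc 4 ^ 4 * N ^ 3 ≤ N ^ 4 * N ^ 3 := Nat.mul_le_mul_right _ (Nat.pow_le_pow_left hN4 4)
      _ = N ^ 7 := by ring
  have h2 : N * 1 ≤ N * (N * N) := Nat.mul_le_mul_left _ (by nlinarith)
  have h3 : N ^ 3 = N * (N * N) := by ring
  refine ⟨?_, by omega, ?_⟩
  · have h4 : segLen n K ≤ (5 * N) * (5 * N) := by
      unfold segLen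
      exact Nat.mul_le_mul (by omega) (by omega)
    have h5 : N * (N * N) ≥ 4 * (N * N) := Nat.mul_le_mul_right _ hN4
    have h6 : (5 * N) * (5 * N) = 25 * (N * N) := by ring
    omega
  · have h4 : X * ((Nat.log 2 n + 1) * C) ≤ N * (N * N) :=
      Nat.mul_le_mul (by omega) (Nat.mul_le_mul (by omega) (by omega))
    have h5 : 5 * X * ((Nat.log 2 n + 1) * C) = 5 * (X * ((Nat.log 2 n + 1) * C)) := by ring
    omega

end parameters

theorem IsHistory.graphOf {P : SimpleGraph (Fin n) → Prop} {h : List (Update n)}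
    (hh : IsHistory P h) : P (graphOf h) := by
  cases h with
  | nil => exact hh
  | cons x h => exact hh.2.1

theorem StaticAlgorithm.Colors.pos {A : StaticAlgorithm n} {𝒢 : Set (SimpleGraph (Fin n))}
    {C : ℕ} (hA : A.Colors 𝒢 C) (hn : 2 ≤ n) {G : SimpleGraph (Fin n)} (hG : G ∈ 𝒢) : 0 < C :=
  ((hA G hG Finset.univ).1 ⟨0, by omega⟩ (Finset.mem_univ _)).pos

/-- Amortized bounds cannot be negative, since there is a nonempty legal history. -/
theorem nonneg_of_amortized {Δ : ℕ} (hn : 2 ≤ n) (hΔ : 0 < Δ) {f : List (Update n) → ℕ} {τ : ℝ}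
    (hf : ∀ h, IsHistory (MaxDegreeLE Δ) h → (f h : ℝ) ≤ τ * h.length) : 0 ≤ τ := by
  have key := hf [.insert ⟨0, by omega⟩ ⟨1, by omega⟩] ⟨⟨by simp, by simp [graphOf]⟩, ?_, ?_⟩
  · simp only [List.length_cons, List.length_nil, zero_add, Nat.cast_one, mul_one] at key
    exact (Nat.cast_nonneg _).trans key
  · refine MaxDegreeLE.of_recent (ρ := fun v : Fin n => if v = ⟨0, by omega⟩ then [⟨1, by omega⟩]
      else [⟨0, by omega⟩]) (fun v => by split_ifs <;> exact hΔ) fun u v huv => ?_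
    simp only [graphOf, Update.apply, bot_sup_eq, SimpleGraph.edge_adj] at huv
    rcases huv.1 with ⟨rfl, rfl⟩ | ⟨rfl, rfl⟩ <;> simp
  · intro v
    simp [SimpleGraph.neighborSet]

theorem randAlgorithm_bounds (n C W : ℕ) (β : ℝ) (𝒢 : Set (SimpleGraph (Fin n)))
    (A : StaticAlgorithm n) (T : ℕ → ℕ) (M : Machine n)
    (hM : M = ⟨W, A, T, DynamicAlgorithm.null n⟩) (hn : 2 ≤ n) (hβ : 0 < β)
    (hβ' : β ≤ Real.logb 2 n) (hA : A.Colors 𝒢 C) (hT : Monotone T) (hT' : ∀ m, m ≤ T m)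
    {c : ℕ} (hc : 20000 ≤ c) (hW : (n + C + degreeBound n β) ^ c ≤ W) (h : List (Update n))
    (hh : IsHistory (fun G => G ∈ 𝒢) h) :
    ∃ fuel : ℕ, none ∉ (randAlgorithm.run M (params n C β) fuel h).support ∧
      (∀ s, some s ∈ (randAlgorithm.prepare M (params n C β) fuel).support → s.time ≤ c * n) ∧
      (∀ s, some s ∈ (randAlgorithm.run M (params n C β) fuel h).support →
        Proper (graphOf h) (randAlgorithm.coloring M s) ∧
        ∀ v, (randAlgorithm.coloring M s v : ℝ) < c * (C / β * Real.logb 2 n ^ 2 *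
          (1 + Real.logb 2 (Real.logb 2 n) + max 0 (Real.logb 2 (1 / β))))) ∧
      expect (randAlgorithm.run M (params n C β) fuel h) State.recolorings ≤
        ENNReal.ofReal (c * (1 + β) * h.length) ∧
      expect (randAlgorithm.run M (params n C β) fuel h) State.time ≤
        ENNReal.ofReal (c * (1 + staticBound n β T) * h.length) := by
  have hC := hA.pos hn hh.graphOf
  have hK := floor_pos hβ hβ'
  have hKΔ := floor_le_degreeBound hn hβ
  obtain ⟨hW1, hW2, hW3⟩ := word_size_bounds hn hC hK hKΔ (by omega) hW
  have hc' : (20000 : ℝ) ≤ c := by exact_mod_cast hc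
  have hL := one_le_logb hn
  have hS : RandSetting M 𝒢 C ⌊Real.logb 2 n / β⌋₊ (segLen n ⌊Real.logb 2 n / β⌋₊) := by
    subst hM
    refine ⟨⟨hn, hK, hW1, le_rfl⟩, hT, hT', hA, rfl, hC, hW2, lt_of_le_of_lt ?_ hW3⟩
    gcongr
  have hrun := hS.run (degreeBound n β) hh
  have hcost := rebuildCost_le_staticBound hn hβ hβ' M.static hh M.T
  have hmoved := rebuildCost_le_length hn hβ hβ' M.static hh
  have hMT : M.T = T := by rw [hM]
  refine ⟨_, hrun.none_notMem, fun s hs => ?_, fun s hs => ?_, ?_, ?_⟩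
  · exact ((hS.prepare (degreeBound n β)).of_mem hs).1.trans (Nat.mul_le_mul_right _ (by omega))
  · obtain ⟨hproper, hlt⟩ := (hrun.of_mem hs).proper hS hh
    refine ⟨hproper, fun v => ?_⟩
    have h1 : (randAlgorithm.coloring M s v : ℝ) <
        5 * ⌊Real.logb 2 n / β⌋₊ * ((Nat.log 2 n + 1) * C) := by exact_mod_cast hlt v
    refine h1.trans_le ?_
    have h2 : 0 ≤ Real.logb 2 (Real.logb 2 n) := Real.logb_nonneg (by norm_num) hL
    have h3 : 0 ≤ max 0 (Real.logb 2 (1 / β)) := le_max_left _ _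
    calc (5 * ⌊Real.logb 2 n / β⌋₊ * ((Nat.log 2 n + 1) * C) : ℝ)
        ≤ 5 * (Real.logb 2 n / β) * (2 * Real.logb 2 n * C) := by
          gcongr
          · exact floor_le hβ hβ'
          · exact natLog_add_one_le hn
      _ = 10 * (C / β * Real.logb 2 n ^ 2 * 1) := by ring
      _ ≤ _ := by
          gcongr
          · linarith
          · linarith
  · refine (expect_le_mean _ _).trans (mean_le (hrun.mono ?_))
    rintro s ⟨μ, D, t, r, rfl, -, -, hr⟩
    rw [← ENNReal.ofReal_natCast]
    refine ENNReal.ofReal_le_ofReal ?_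
    have h1 : (r : ℝ) ≤ Layers.rebuildCost M.static ⌊Real.logb 2 n / β⌋₊ (fun k => n / 2 ^ k) h +
        h.length := by exact_mod_cast hr
    show (r : ℝ) ≤ _
    calc (r : ℝ) ≤ 16 * β * h.length + h.length := by linarith
      _ ≤ (20000 * (1 + β)) * h.length := by
          rw [← add_one_mul]
          gcongr
          linarith
      _ ≤ _ := by gcongr
  · refine (expect_le_mean _ _).trans ((hS.mean_time_le (degreeBound n β) hh).trans ?_)
    rw [← ENNReal.ofReal_natCast]
    refine ENNReal.ofReal_le_ofReal ?_
    push_cast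
    rw [hMT] at hcost ⊢
    have h0 := staticBound_nonneg hn hβ T
    calc _ ≤ 2000 * (h.length + 8 * staticBound n β T * h.length) := by gcongr
      _ = (2000 + 16000 * staticBound n β T) * h.length := by ring
      _ ≤ (20000 * (1 + staticBound n β T)) * h.length := by
          gcongr
          linarith
      _ ≤ _ := by gcongr

theorem detAlgorithm_bounds (n C W κ : ℕ) (β R : ℝ) (𝒢 : Set (SimpleGraph (Fin n)))
    (A : StaticAlgorithm n) (T : ℕ → ℕ) (A' : DynamicAlgorithm n) (T' : ℝ)
    (M : Machine n) (hM : M = ⟨W, A, T, A'⟩) (hn : 2 ≤ n) (hβ : 0 < β)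
    (hβ' : β ≤ Real.logb 2 n) (hA : A.Colors 𝒢 C) (hT : Monotone T) (hT' : ∀ m, m ≤ T m)
    (hA' : A'.Colors (degreeBound n β) (κ * degreeBound n β))
    (htime : A'.AmortizedTime (degreeBound n β) T')
    (hrec : A'.AmortizedRecolorings (degreeBound n β) R)
    {c : ℕ} (hc : 20000 ≤ c) (hW : (n + C + κ * degreeBound n β) ^ c ≤ W) (h : List (Update n))
    (hh : IsHistory (fun G => G ∈ 𝒢) h) :
    ∃ fuel : ℕ, none ∉ (detAlgorithm.run M (params n C β) fuel h).support ∧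
      (∀ s, some s ∈ (detAlgorithm.prepare M (params n C β) fuel).support → s.time ≤ c * n) ∧
      ∀ s, some s ∈ (detAlgorithm.run M (params n C β) fuel h).support →
        Proper (graphOf h) (detAlgorithm.coloring M s) ∧
        (∀ v, (detAlgorithm.coloring M s v : ℝ) < c * (κ * (C / β) * Real.logb 2 n ^ 3)) ∧
        (s.recolorings : ℝ) ≤ c * (1 + β + R) * h.length ∧
        (s.time : ℝ) ≤ c * (1 + staticBound n β T + T') * h.length := by
  have hC := hA.pos hn hh.graphOf
  have hK := floor_pos hβ hβ'
  have hKΔ := floor_le_degreeBound hn hβ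
  have hκ : 0 < κ * degreeBound n β :=
    ((hA' [] fun v => by simp [SimpleGraph.neighborSet]).2 ⟨0, by omega⟩).pos
  have hκ' : 0 < κ := Nat.pos_of_mul_pos_right hκ
  have hKκ : ⌊Real.logb 2 n / β⌋₊ ≤ κ * degreeBound n β :=
    hKΔ.trans (Nat.le_mul_of_pos_left _ hκ')
  obtain ⟨hW1, hW2, hW3⟩ := word_size_bounds hn hC hK hKκ (by omega) hW
  have hc' : (20000 : ℝ) ≤ c := by exact_mod_cast hc
  have hL := one_le_logb hn
  have hΔ : 0 < degreeBound n β := hK.trans_le hKΔ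
  have hR0 : 0 ≤ R := nonneg_of_amortized hn hΔ hrec
  have hT0 : 0 ≤ T' := nonneg_of_amortized hn hΔ htime
  have hS : DetSetting M 𝒢 C ⌊Real.logb 2 n / β⌋₊ (degreeBound n β) (κ * degreeBound n β)
      (segLen n ⌊Real.logb 2 n / β⌋₊) := by
    subst hM
    refine ⟨⟨hn, hK, hW1, le_rfl⟩, hT, hT', hA, hA', hKΔ, hC, hW2, lt_of_le_of_lt ?_ hW3⟩
    exact Nat.mul_le_mul_right _ (by omega)
  have hrun := hS.run h hh
  have hcost := rebuildCost_le_staticBound hn hβ hβ' M.static hh M.T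
  have hmoved := rebuildCost_le_length hn hβ hβ' M.static hh
  have hMT : M.T = T := by rw [hM]
  have hMA : M.dyn = A' := by rw [hM]
  refine ⟨_, hrun.none_notMem, fun s hs => ?_, fun s hs => ?_⟩
  · exact (hS.prepare.of_mem hs).1.trans (Nat.mul_le_mul_right _ (by omega))
  · obtain ⟨μ, D, t, r, rfl, hI⟩ := hrun.of_mem hs
    obtain ⟨hproper, hlt⟩ := hI.proper hS hh t r
    have hlen : (D.length : ℝ) ≤ 3 * h.length := by
      have := hI.length_le
      exact_mod_cast (by omega : D.length ≤ 3 * h.length)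
    refine ⟨hproper, fun v => ?_, ?_, ?_⟩
    · have h1 : (detAlgorithm.coloring M (mkState (segLen n ⌊Real.logb 2 n / β⌋₊) μ D t r) v : ℝ) <
          κ * degreeBound n β * ((Nat.log 2 n + 1) * C) := by exact_mod_cast hlt v
      refine h1.trans_le ?_
      calc (κ * degreeBound n β * ((Nat.log 2 n + 1) * C) : ℝ)
          ≤ κ * (2 * (Real.logb 2 n ^ 2 / β)) * (2 * Real.logb 2 n * C) := by
            gcongr
            · exact degreeBound_le hn hβ hβ'
            · exact natLog_add_one_le hn
        _ = 4 * (κ * (C / β) * Real.logb 2 n ^ 3) := by ring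
        _ ≤ _ := by gcongr; linarith
    · have h1 : (r : ℝ) ≤ Layers.rebuildCost M.static ⌊Real.logb 2 n / β⌋₊
          (fun k => n / 2 ^ k) h + M.dyn.totalRecolorings D := by
        exact_mod_cast hI.recolorings_le
      rw [hMA] at h1
      have h2 := hrec D hI.held.legal
      have h3 : R * D.length ≤ R * (3 * h.length) := by gcongr
      show (r : ℝ) ≤ _
      calc (r : ℝ) ≤ 16 * β * h.length + R * (3 * h.length) := by linarith
        _ = (16 * β + 3 * R) * h.length := by ring
        _ ≤ (20000 * (1 + β + R)) * h.length := by gcongr; linarith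
        _ ≤ _ := by gcongr
    · have h1 : (t : ℝ) ≤ 2000 * (h.length + Layers.rebuildCost M.static ⌊Real.logb 2 n / β⌋₊
          (fun k => M.T (n / 2 ^ k)) h) + M.dyn.totalTime D := by
        have := hI.time_le
        exact_mod_cast (by omega : t ≤ 2000 * (h.length + Layers.rebuildCost M.static
          ⌊Real.logb 2 n / β⌋₊ (fun k => M.T (n / 2 ^ k)) h) + M.dyn.totalTime D)
      rw [hMA, hMT] at h1
      rw [hMT] at hcost
      have h2 := htime D hI.held.legal
      have h3 : T' * D.length ≤ T' * (3 * h.length) := by gcongr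
      have h0 := staticBound_nonneg hn hβ T
      show (t : ℝ) ≤ _
      calc (t : ℝ) ≤ 2000 * (h.length + 8 * staticBound n β T * h.length) +
            T' * (3 * h.length) := by linarith
        _ = (2000 + 16000 * staticBound n β T + 3 * T') * h.length := by ring
        _ ≤ (20000 * (1 + staticBound n β T + T')) * h.length := by gcongr; linarith
        _ ≤ _ := by gcongr

end DynColoring

theorem theorem2 :
    -- the randomized algorithm (no dynamic black box is available)
    (∃ (P : Algorithm) (c : ℕ), ∀ (n C W : ℕ) (β : ℝ) (𝒢 : Set (SimpleGraph (Fin n)))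
      (A : StaticAlgorithm n) (T : ℕ → ℕ) (M : Machine n),
      M = ⟨W, A, T, DynamicAlgorithm.null n⟩ →
      2 ≤ n → 0 < β → β ≤ Real.logb 2 n →
      A.Colors 𝒢 C → Monotone T → (∀ m, m ≤ T m) →
      (n + C + degreeBound n β) ^ c ≤ W →
      ∀ h : List (Update n), IsHistory (fun G => G ∈ 𝒢) h →
      ∃ fuel : ℕ,
        -- it always terminates, after a preprocessing in linear time
        none ∉ (P.run M (params n C β) fuel h).support ∧
        (∀ s, some s ∈ (P.prepare M (params n C β) fuel).support → s.time ≤ c * n) ∧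
        -- it always has a proper coloring with few colors
        (∀ s, some s ∈ (P.run M (params n C β) fuel h).support →
          Proper (graphOf h) (P.coloring M s) ∧
          ∀ v, (P.coloring M s v : ℝ) < c * (C / β * Real.logb 2 n ^ 2 *
            (1 + Real.logb 2 (Real.logb 2 n) + max 0 (Real.logb 2 (1 / β))))) ∧
        -- expected amortized number of recolorings
        expect (P.run M (params n C β) fuel h) State.recolorings ≤
          ENNReal.ofReal (c * (1 + β) * h.length) ∧
        -- expected amortized update time
        expect (P.run M (params n C β) fuel h) State.time ≤
          ENNReal.ofReal (c * (1 + staticBound n β T) * h.length)) ∧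
    -- the deterministic algorithm
    (∃ (P : Algorithm) (c : ℕ), P.Deterministic ∧
      ∀ (n C W κ : ℕ) (β R : ℝ) (𝒢 : Set (SimpleGraph (Fin n)))
      (A : StaticAlgorithm n) (T : ℕ → ℕ) (A' : DynamicAlgorithm n) (T' : ℕ → ℕ → ℝ)
      (M : Machine n), M = ⟨W, A, T, A'⟩ →
      2 ≤ n → 0 < β → β ≤ Real.logb 2 n →
      A.Colors 𝒢 C → Monotone T → (∀ m, m ≤ T m) →
      A'.Colors (degreeBound n β) (κ * degreeBound n β) →
      A'.AmortizedTime (degreeBound n β) (T' (degreeBound n β) n) →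
      A'.AmortizedRecolorings (degreeBound n β) R →
      (n + C + κ * degreeBound n β) ^ c ≤ W →
      ∀ h : List (Update n), IsHistory (fun G => G ∈ 𝒢) h →
      ∃ fuel : ℕ,
        none ∉ (P.run M (params n C β) fuel h).support ∧
        (∀ s, some s ∈ (P.prepare M (params n C β) fuel).support → s.time ≤ c * n) ∧
        ∀ s, some s ∈ (P.run M (params n C β) fuel h).support →
          Proper (graphOf h) (P.coloring M s) ∧
          (∀ v, (P.coloring M s v : ℝ) < c * (κ * (C / β) * Real.logb 2 n ^ 3)) ∧
          (s.recolorings : ℝ) ≤ c * (1 + β + R) * h.length ∧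
          (s.time : ℝ) ≤ c * (1 + staticBound n β T + T' (degreeBound n β) n) * h.length) := by
  refine ⟨⟨randAlgorithm, 20000, ?_⟩, ⟨detAlgorithm, 20000, detAlgorithm_deterministic, ?_⟩⟩
  · intro n C W β 𝒢 A T M hM hn hβ hβ' hA hT hT' hW h hh
    exact randAlgorithm_bounds n C W β 𝒢 A T M hM hn hβ hβ' hA hT hT' le_rfl hW h hh
  · intro n C W κ β R 𝒢 A T A' T' M hM hn hβ hβ' hA hT hT' hA' htime hrec hW h hh
    exact detAlgorithm_bounds n C W κ β R 𝒢 A T A' _ M hM hn hβ hβ' hA hT hT' hA' htime hrec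
      le_rfl hW h hh
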